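/- Let $(\mathsf C,J)$ be a site; all groups are sheaves of groups on it. A crossed module $\partial\colon G_1\to G_0$ carries a right action of $G_0$ on $G_1$ by automorphisms with $\partial(g^a)=a^{-1}\partial(g)a$ and $g^{\partial h}=h^{-1}gh$. A butterfly $[H_\bullet,E,G_\bullet]$ between crossed modules $H_\bullet=[H_1\to H_0]$ and $G_\bullet=[G_1\to G_0]$ consists of a sheaf of groups $E$ and homomorphisms $\kappa\colon H_1\to E$, $\iota\colon G_1\to E$, $\pi\colon E\to H_0$, $\jmath\colon E\to G_0$ with $\pi\kappa=\partial_H$, $\jmath\iota=\partial_G$, $\jmath\kappa=1$, such that $1\to G_1\xrightarrow{\iota}E\xrightarrow{\pi}H_0\to1$ is exact and $\iota(g^{\jmath(e)})=e^{-1}\iota(g)e$, $\kappa(h^{\pi(e)})=e^{-1}\kappa(h)e$. It determines the crossed module $E_\bullet\colon H_1\times G_1\to E$, $(h,g)\mapsto\kappa(h)\iota(g)$, with $(h,g)^e=(h^{\pi(e)},g^{\jmath(e)})$. A gerbe is a stack in groupoids which is locally nonempty and locally connected. For a sheaf of groups $G$ let $\mathrm{TORS}(G)$ be the stack of right $G$-torsors;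 if $G$ acts on the left on $X$, $P\wedge^GX$ is the contracted product, with $pg\wedge x=p\wedge gx$. A crossed module's $G_0$ acts on the left of $G_1$ by $a\cdot g=g^{a^{-1}}$, and every group acts on itself by conjugation; with the latter action $\underline{\mathrm{Aut}}(P)\cong P\wedge^GG$, where $\alpha$ corresponds to $p\wedge g$ if $\alpha(p)=pg$. A gerbe bound by $G_\bullet$ (a $(G_1,G_0)$-gerbe) is a gerbe $\mathcal P$ with a morphism of stacks $\mu\colon\mathcal P\to\mathrm{TORS}(G_0)$ and isomorphisms of sheaves of groups $\jmath_x\colon\underline{\mathrm{Aut}}(x)\cong\mu(x)\wedge^{G_0}G_1$, functorial in $x$ (for all arrows of the fibred category $\mathcal P$), such that the composite of $\jmath_x$ with $\mathrm{id}\wedge\partial\colon\mu(x)\wedge^{G_0}G_1\to\mu(x)\wedge^{G_0}G_0\cong\underline{\mathrm{Aut}}(\mu(x))$ is the homomorphism induced by $\mu$. Let $[H_\bullet,E,G_\bullet]$ be a butterfly and $(\mathcal Q,k,\nu)$ a gerbe bound by $H_\bullet$. Let $\pi_*\colon\mathrm{TORS}(E)\to\mathrm{TORS}(H_0)$, $P\mapsto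 P\wedge^EH_0$, where $E$ acts on $H_0$ by left translations through $\pi$, and let $$\mathcal Q'=\mathcal Q\times_{\mathrm{TORS}(H_0)}\mathrm{TORS}(E)$$ be the stack fibre product of $\nu$ and $\pi_*$, whose objects are the triples $(x,f,P)$ with $x$ an object of $\mathcal Q$, $P$ an $E$-torsor and $f\colon\nu(x)\cong\pi_*(P)$; let $\nu'\colon\mathcal Q'\to\mathrm{TORS}(E)$ be the projection $(x,f,P)\mapsto P$. Then: 1. $\mathcal Q'$ is a gerbe. 2. The map $\theta\colon H_1\times G_1\to H_1\times_{H_0}E$, $(h,g)\mapsto(h,\kappa(h)\iota(g))$, is an isomorphism of sheaves of groups. 3. For every $E$-torsor $P$ (over any object of $\mathsf C$) the projections induce isomorphisms $P\wedge^E(H_1\times_{H_0}E)\cong(P\wedge^EH_1)\times_{P\wedge^EH_0}(P\wedge^EE)$ and $P\wedge^E(H_1\times G_1)\cong(P\wedge^EH_1)\times(P\wedge^EG_1)$; in this item and in 4, $E$ acts on $H_1$ and $H_0$ through $\pi$ (by the action of the crossed module $H_\bullet$, respectively by conjugation), on $G_1$ through $\jmath$, on itself by conjugation, and componentwise on $H_1\times_{H_0}E$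 and $H_1\times G_1$. 4. $\mathcal Q'$ is bound by $E_\bullet$, with the morphism $\nu'$ and isomorphisms $k'_{(x,f,P)}\colon\underline{\mathrm{Aut}}(x,f,P)\cong P\wedge^E(H_1\times G_1)$ such that $(\mathrm{id}\wedge\theta)\circ k'_{(x,f,P)}$ is an isomorphism $k''_{(x,f,P)}\colon\underline{\mathrm{Aut}}(x,f,P)\cong P\wedge^E(H_1\times_{H_0}E)$ which sends an automorphism $(\phi,\alpha)$, $\phi\in\underline{\mathrm{Aut}}(x)$, $\alpha\in\underline{\mathrm{Aut}}(P)$, to the section with the following components: in $P\wedge^EH_1$ the image of $\phi$ under $$\underline{\mathrm{Aut}}(x)\xrightarrow{k_x}\nu(x)\wedge^{H_0}H_1\xrightarrow{f\wedge\mathrm{id}}(P\wedge^EH_0)\wedge^{H_0}H_1\cong P\wedge^EH_1,$$ and in $P\wedge^EE\cong\underline{\mathrm{Aut}}(P)$ the section corresponding to $\alpha$. -/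

import Mathlib

open CategoryTheory Opposite

universe v u w v₁ u₁

namespace ButterflyGerbe

/-! ### Sheaves of sets and of groups, in terms of sections -/

section SheafOfSets

variable {D : Type u₁} [Category.{v₁} D] {K : GrothendieckTopology D}

/-- Sections of a sheaf of sets. -/
abbrev Sec (P : Sheaf K (Type w)) (X : D) : Type w := P.obj.obj (op X)

/-- Restriction of sections. -/
def rs (P : Sheaf K (Type w)) {Y X : D} (f : Y ⟶ X) (s : Sec P X) : Sec P Y :=
  P.obj.map f.op s

@[simp] theorem rs_id (P : Sheaf K (Type w)) {X : D} (s : Sec P X) : rs P (𝟙 X) s = s := by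
  simp [rs]

theorem rs_rs (P : Sheaf K (Type w)) {Z Y X : D} (g : Z ⟶ Y) (f : Y ⟶ X) (s : Sec P X) :
    rs P g (rs P f s) = rs P (g ≫ f) s := by
  simp [rs]

theorem sec_ext (P : Sheaf K (Type w)) {X : D} {R : Sieve X} (hR : R ∈ K X) {s t : Sec P X}
    (h : ∀ ⦃Y : D⦄ (f : Y ⟶ X), R f → rs P f s = rs P f t) : s = t := by
  have hP := (isSheaf_iff_isSheaf_of_type K P.obj).1 P.property
  exact (hP R hR).isSeparatedFor.ext (fun Y f hf => h f hf)

theorem sec_glue (P : Sheaf K (Type w)) {X : D} {R : Sieve X} (hR : R ∈ K X)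
    (s : ∀ ⦃Y : D⦄ (f : Y ⟶ X), R f → Sec P Y)
    (hs : ∀ ⦃Y Z : D⦄ (f : Y ⟶ X) (g : Z ⟶ Y) (hf : R f),
      rs P g (s f hf) = s (g ≫ f) (R.downward_closed hf g)) :
    ∃ t : Sec P X, ∀ ⦃Y : D⦄ (f : Y ⟶ X) (hf : R f), rs P f t = s f hf := by
  have hP := (isSheaf_iff_isSheaf_of_type K P.obj).1 P.property
  have hc : Presieve.FamilyOfElements.Compatible
      (fun Y f hf => s f hf : Presieve.FamilyOfElements P.obj R.arrows) := by
    intro Y₁ Y₂ Z g₁ g₂ f₁ f₂ h₁ h₂ h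
    change rs P g₁ (s f₁ h₁) = rs P g₂ (s f₂ h₂)
    rw [hs, hs]
    congr 1
  obtain ⟨t, ht, -⟩ := hP R hR _ hc
  exact ⟨t, fun Y f hf => ht f hf⟩

end SheafOfSets

variable {C : Type u} [Category.{v} C] {J : GrothendieckTopology C}

/-- Sheaves of groups on the site `(C, J)`, i.e. group objects of the topos. -/
abbrev GroupSheaf (J : GrothendieckTopology C) := Sheaf J GrpCat.{max u v}

namespace GroupSheaf

/-- The group of sections of a sheaf of groups. -/
abbrev sec (G : GroupSheaf J) (U : C) : Type (max u v) := G.obj.obj (op U)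

/-- Restriction of sections of a sheaf of groups. -/
def res (G : GroupSheaf J) {V U : C} (f : V ⟶ U) : G.sec U →* G.sec V := (G.obj.map f.op).hom

@[simp] theorem res_id (G : GroupSheaf J) {U : C} (x : G.sec U) : G.res (𝟙 U) x = x := by
  simp [res]

theorem res_res (G : GroupSheaf J) {W V U : C} (g : W ⟶ V) (f : V ⟶ U) (x : G.sec U) :
    G.res g (G.res f x) = G.res (g ≫ f) x := by
  simp [res]

/-- The restriction to `C/U` of the sheaf of sets underlying a sheaf of groups. -/
noncomputable def on (G : GroupSheaf J) (U : C) : Sheaf (J.over U) (Type (max u v)) :=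
  (J.overPullback _ U).obj ((sheafCompose J (forget GrpCat)).obj G)

theorem rs_on (G : GroupSheaf J) {U : C} {T T' : Over U} (k : T' ⟶ T) (x : G.sec T.left) :
    rs (G.on U) k x = G.res k.left x := rfl

end GroupSheaf

/-- Homomorphisms of sheaves of groups, on sections. -/
def homApp {G H : GroupSheaf J} (φ : G ⟶ H) (U : C) : G.sec U →* H.sec U :=
  (φ.hom.app (op U)).hom

theorem homApp_res {G H : GroupSheaf J} (φ : G ⟶ H) {V U : C} (f : V ⟶ U) (x : G.sec U) :
    homApp φ V (G.res f x) = H.res f (homApp φ U x) := by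
  have h := φ.hom.naturality f.op
  exact congrArg (fun k => k.hom x) h

/-- A left action of a sheaf of groups `G` on (the sheaf of sets underlying) a sheaf of
groups `X`. -/
structure LeftAction (G X : GroupSheaf J) where
  smul : ∀ {U : C}, G.sec U → X.sec U → X.sec U
  one_smul : ∀ {U : C} (x : X.sec U), smul 1 x = x
  mul_smul : ∀ {U : C} (a b : G.sec U) (x : X.sec U), smul (a * b) x = smul a (smul b x)
  res_smul : ∀ {V U : C} (f : V ⟶ U) (a : G.sec U) (x : X.sec U),
    X.res f (smul a x) = smul (G.res f a) (X.res f x)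

/-- A left action of a sheaf of groups `G` on a sheaf of groups `X` by group automorphisms. -/
structure GroupAction (G X : GroupSheaf J) extends LeftAction G X where
  smul_mul : ∀ {U : C} (a : G.sec U) (x y : X.sec U), smul a (x * y) = smul a x * smul a y

theorem LeftAction.inv_smul_smul {G X : GroupSheaf J} (a : LeftAction G X) {U : C} (g : G.sec U)
    (x : X.sec U) : a.smul g⁻¹ (a.smul g x) = x := by
  rw [← a.mul_smul, inv_mul_cancel, a.one_smul]

theorem LeftAction.smul_inv_smul {G X : GroupSheaf J} (a : LeftAction G X) {U : C} (g : G.sec U)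
    (x : X.sec U) : a.smul g (a.smul g⁻¹ x) = x := by
  rw [← a.mul_smul, mul_inv_cancel, a.one_smul]

theorem GroupAction.smul_one {G X : GroupSheaf J} (a : GroupAction G X) {U : C} (g : G.sec U) :
    a.smul g (1 : X.sec U) = 1 := by
  have h := a.smul_mul g (1 : X.sec U) 1
  rw [mul_one] at h
  exact left_eq_mul.1 h

theorem GroupAction.smul_inv {G X : GroupSheaf J} (a : GroupAction G X) {U : C} (g : G.sec U)
    (x : X.sec U) : a.smul g x⁻¹ = (a.smul g x)⁻¹ := by
  rw [eq_inv_iff_mul_eq_one, ← a.smul_mul, inv_mul_cancel, a.smul_one]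

/-- The action of `G` on itself by conjugation, `g • x = g x g⁻¹`. -/
def conjAction (G : GroupSheaf J) : GroupAction G G where
  smul g x := g * x * g⁻¹
  one_smul x := by simp
  mul_smul a b x := by simp [mul_assoc]
  res_smul f a x := by simp
  smul_mul a x y := by simp [mul_assoc]

/-- The action of `G` on `H` by left translations through a homomorphism `φ : G ⟶ H`. -/
def translationAction {G H : GroupSheaf J} (φ : G ⟶ H) : LeftAction G H where
  smul {U} g x := homApp φ U g * x
  one_smul x := by simp
  mul_smul a b x := by simp [mul_assoc]
  res_smul f a x := by simp [homApp_res]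

/-- The pullback of an action by automorphisms along a homomorphism. -/
def GroupAction.comap {E G X : GroupSheaf J} (a : GroupAction G X) (φ : E ⟶ G) :
    GroupAction E X where
  smul {U} g x := a.smul (homApp φ U g) x
  one_smul x := by simp [a.one_smul]
  mul_smul b c x := by simp [a.mul_smul]
  res_smul f b x := by rw [a.res_smul, homApp_res]
  smul_mul b x y := a.smul_mul _ x y

/-! ### Crossed modules and butterflies -/

/-- A crossed module `∂ : G₁ ⟶ G₀` of sheaves of groups, with `G₀` acting on `G₁` on the right;
`act g a` is `g ^ a`. -/
structure CrossedModule (J : GrothendieckTopology C) where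
  /-- the source -/
  G₁ : GroupSheaf J
  /-- the target -/
  G₀ : GroupSheaf J
  /-- the boundary homomorphism -/
  del : G₁ ⟶ G₀
  /-- the right action -/
  act : ∀ {U : C}, G₁.sec U → G₀.sec U → G₁.sec U
  act_one : ∀ {U : C} (g : G₁.sec U), act g 1 = g
  act_mul : ∀ {U : C} (g : G₁.sec U) (a b : G₀.sec U), act g (a * b) = act (act g a) b
  mul_act : ∀ {U : C} (g h : G₁.sec U) (a : G₀.sec U), act (g * h) a = act g a * act h a
  res_act : ∀ {V U : C} (f : V ⟶ U) (g : G₁.sec U) (a : G₀.sec U),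
    G₁.res f (act g a) = act (G₁.res f g) (G₀.res f a)
  del_act : ∀ {U : C} (g : G₁.sec U) (a : G₀.sec U),
    homApp del U (act g a) = a⁻¹ * homApp del U g * a
  act_del : ∀ {U : C} (g h : G₁.sec U), act g (homApp del U h) = h⁻¹ * g * h

/-- The left action `a • g = g ^ (a⁻¹)` of `G₀` on `G₁`. -/
def CrossedModule.leftAction (G : CrossedModule J) : GroupAction G.G₀ G.G₁ where
  smul a g := G.act g a⁻¹
  one_smul g := by simp [G.act_one]
  mul_smul a b g := by simp [G.act_mul]
  res_smul f a g := by simp [G.res_act]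
  smul_mul a g h := G.mul_act g h a⁻¹

/-- A butterfly from the crossed module `H` to the crossed module `G`. -/
structure Butterfly (H G : CrossedModule J) where
  /-- the centre of the butterfly -/
  E : GroupSheaf J
  κ : H.G₁ ⟶ E
  ι : G.G₁ ⟶ E
  π : E ⟶ H.G₀
  j : E ⟶ G.G₀
  /-- the left wing commutes -/
  κ_π : κ ≫ π = H.del
  /-- the right wing commutes -/
  ι_j : ι ≫ j = G.del
  /-- the NW-SE sequence is a complex -/
  κ_j : ∀ {U : C} (h : H.G₁.sec U), homApp j U (homApp κ U h) = 1
  /-- the NE-SW sequence `1 → G₁ → E → H₀ → 1` is an extension of sheaves of groups -/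
  ι_injective : ∀ U : C, Function.Injective (homApp ι U)
  exact : ∀ {U : C} (e : E.sec U), homApp π U e = 1 ↔ ∃ g : G.G₁.sec U, homApp ι U g = e
  π_surjective : ∀ {U : C} (a : H.G₀.sec U), ∃ R ∈ J U, ∀ ⦃V : C⦄ (f : V ⟶ U), R f →
    ∃ e : E.sec V, homApp π V e = H.G₀.res f a
  ι_act : ∀ {U : C} (g : G.G₁.sec U) (e : E.sec U),
    homApp ι U (G.act g (homApp j U e)) = e⁻¹ * homApp ι U g * e
  κ_act : ∀ {U : C} (h : H.G₁.sec U) (e : E.sec U),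
    homApp κ U (H.act h (homApp π U e)) = e⁻¹ * homApp κ U h * e

theorem isSheaf_of_glue (F : Cᵒᵖ ⥤ GrpCat.{max u v})
    (hsep : ∀ {U : C} {R : Sieve U}, R ∈ J U → ∀ s t : F.obj (op U),
      (∀ ⦃V : C⦄ (f : V ⟶ U), R f → F.map f.op s = F.map f.op t) → s = t)
    (hglue : ∀ {U : C} {R : Sieve U}, R ∈ J U →
      ∀ s : (∀ ⦃V : C⦄ (f : V ⟶ U), R f → F.obj (op V)),
      (∀ ⦃V W : C⦄ (f : V ⟶ U) (g : W ⟶ V) (hf : R f),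
        F.map g.op (s f hf) = s (g ≫ f) (R.downward_closed hf g)) →
      ∃ t : F.obj (op U), ∀ ⦃V : C⦄ (f : V ⟶ U) (hf : R f), F.map f.op t = s f hf) :
    Presheaf.IsSheaf J F := by
  rw [Presheaf.isSheaf_iff_isSheaf_forget J F (forget GrpCat), isSheaf_iff_isSheaf_of_type]
  intro U R hR x hx
  obtain ⟨t, ht⟩ := hglue hR (fun V f hf => x f hf) (fun V W f g hf => by
    have := hx g (𝟙 W) hf (R.downward_closed hf g) (by simp)
    simpa using this)
  refine ⟨t, fun V f hf => ht f hf, fun t' ht' => hsep hR _ _ fun V f hf => ?_⟩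
  exact (ht' f hf).trans (ht f hf).symm

namespace GroupSheaf

theorem sec_ext (G : GroupSheaf J) {U : C} {R : Sieve U} (hR : R ∈ J U) {s t : G.sec U}
    (h : ∀ ⦃V : C⦄ (f : V ⟶ U), R f → G.res f s = G.res f t) : s = t :=
  ButterflyGerbe.sec_ext ((sheafCompose J (forget GrpCat)).obj G) hR h

theorem sec_glue (G : GroupSheaf J) {U : C} {R : Sieve U} (hR : R ∈ J U)
    (s : ∀ ⦃V : C⦄ (f : V ⟶ U), R f → G.sec V)
    (hs : ∀ ⦃V W : C⦄ (f : V ⟶ U) (g : W ⟶ V) (hf : R f),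
      G.res g (s f hf) = s (g ≫ f) (R.downward_closed hf g)) :
    ∃ t : G.sec U, ∀ ⦃V : C⦄ (f : V ⟶ U) (hf : R f), G.res f t = s f hf :=
  ButterflyGerbe.sec_glue ((sheafCompose J (forget GrpCat)).obj G) hR s hs

/-- A sheaf of groups from its groups of sections. -/
def ofSections (A : C → Type (max u v)) [∀ U, Group (A U)]
    (r : ∀ {V U : C}, (V ⟶ U) → (A U →* A V))
    (r_id : ∀ (U : C) (x : A U), r (𝟙 U) x = x)
    (r_comp : ∀ {W V U : C} (g : W ⟶ V) (f : V ⟶ U) (x : A U), r (g ≫ f) x = r g (r f x))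
    (hsep : ∀ {U : C} {R : Sieve U}, R ∈ J U → ∀ s t : A U,
      (∀ ⦃V : C⦄ (f : V ⟶ U), R f → r f s = r f t) → s = t)
    (hglue : ∀ {U : C} {R : Sieve U}, R ∈ J U →
      ∀ s : (∀ ⦃V : C⦄ (f : V ⟶ U), R f → A V),
      (∀ ⦃V W : C⦄ (f : V ⟶ U) (g : W ⟶ V) (hf : R f),
        r g (s f hf) = s (g ≫ f) (R.downward_closed hf g)) →
      ∃ t : A U, ∀ ⦃V : C⦄ (f : V ⟶ U) (hf : R f), r f t = s f hf) : GroupSheaf J where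
  obj :=
    { obj := fun U => GrpCat.of (A U.unop)
      map := fun f => GrpCat.ofHom (r f.unop)
      map_id := fun U => by
        ext x
        exact r_id _ x
      map_comp := fun f g => by
        ext x
        exact r_comp _ _ x }
  property := isSheaf_of_glue _ hsep hglue

/-- The product of two sheaves of groups. -/
def prod (G H : GroupSheaf J) : GroupSheaf J :=
  ofSections (fun U => G.sec U × H.sec U) (fun f => (G.res f).prodMap (H.res f))
    (fun _ x => Prod.ext (G.res_id x.1) (H.res_id x.2))
    (fun g f x => Prod.ext (G.res_res g f x.1).symm (H.res_res g f x.2).symm)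
    (fun hR s t h => Prod.ext (G.sec_ext hR fun _ f hf => congrArg Prod.fst (h f hf))
      (H.sec_ext hR fun _ f hf => congrArg Prod.snd (h f hf)))
    (fun hR s hs => by
      obtain ⟨a, ha⟩ := G.sec_glue hR (fun V f hf => (s f hf).1)
        (fun V W f g hf => congrArg Prod.fst (hs f g hf))
      obtain ⟨b, hb⟩ := H.sec_glue hR (fun V f hf => (s f hf).2)
        (fun V W f g hf => congrArg Prod.snd (hs f g hf))
      exact ⟨(a, b), fun V f hf => Prod.ext (ha f hf) (hb f hf)⟩)

/-- Sections of the fibre product of two homomorphisms of sheaves of groups. -/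
def fibreSub {G H K : GroupSheaf J} (φ : G ⟶ K) (ψ : H ⟶ K) (U : C) :
    Subgroup (G.sec U × H.sec U) where
  carrier := {x | homApp φ U x.1 = homApp ψ U x.2}
  one_mem' := by simp
  mul_mem' {x y} hx hy := by
    have hx' : homApp φ U x.1 = homApp ψ U x.2 := hx
    have hy' : homApp φ U y.1 = homApp ψ U y.2 := hy
    change homApp φ U (x.1 * y.1) = homApp ψ U (x.2 * y.2)
    rw [map_mul, map_mul, hx', hy']
  inv_mem' {x} hx := by
    have hx' : homApp φ U x.1 = homApp ψ U x.2 := hx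
    change homApp φ U (x.1)⁻¹ = homApp ψ U (x.2)⁻¹
    rw [map_inv, map_inv, hx']

theorem mem_fibreSub {G H K : GroupSheaf J} {φ : G ⟶ K} {ψ : H ⟶ K} {U : C}
    {x : G.sec U × H.sec U} : x ∈ fibreSub φ ψ U ↔ homApp φ U x.1 = homApp ψ U x.2 := Iff.rfl

/-- The fibre product of two homomorphisms of sheaves of groups. -/
def fibreProd {G H K : GroupSheaf J} (φ : G ⟶ K) (ψ : H ⟶ K) : GroupSheaf J :=
  ofSections (fun U => fibreSub φ ψ U)
    (fun {V U} f => (((G.res f).prodMap (H.res f)).comp (fibreSub φ ψ U).subtype).codRestrict _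
      (fun x => by
        have h := mem_fibreSub.1 x.2
        change homApp φ V (G.res f x.1.1) = homApp ψ V (H.res f x.1.2)
        rw [homApp_res, homApp_res, h]))
    (fun _ x => Subtype.ext (Prod.ext (G.res_id x.1.1) (H.res_id x.1.2)))
    (fun g f x => Subtype.ext
      (Prod.ext (G.res_res g f x.1.1).symm (H.res_res g f x.1.2).symm))
    (fun hR s t h => Subtype.ext
      (Prod.ext (G.sec_ext hR fun _ f hf => congrArg (fun x => x.1.1) (h f hf))
        (H.sec_ext hR fun _ f hf => congrArg (fun x => x.1.2) (h f hf))))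
    (fun {U R} hR s hs => by
      obtain ⟨a, ha⟩ := G.sec_glue hR (fun V f hf => (s f hf).1.1)
        (fun V W f g hf => congrArg (fun x => x.1.1) (hs f g hf))
      obtain ⟨b, hb⟩ := H.sec_glue hR (fun V f hf => (s f hf).1.2)
        (fun V W f g hf => congrArg (fun x => x.1.2) (hs f g hf))
      have hab : homApp φ U a = homApp ψ U b := K.sec_ext hR fun V f hf => by
        rw [← homApp_res, ← homApp_res, ha f hf, hb f hf]
        exact mem_fibreSub.1 (s f hf).2
      exact ⟨⟨(a, b), hab⟩, fun V f hf => Subtype.ext (Prod.ext (ha f hf) (hb f hf))⟩)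

end GroupSheaf

/-- A homomorphism of sheaves of groups from its values on sections. -/
def mkHom {G H : GroupSheaf J} (φ : ∀ U : C, G.sec U →* H.sec U)
    (hφ : ∀ {V U : C} (f : V ⟶ U) (x : G.sec U), φ V (G.res f x) = H.res f (φ U x)) : G ⟶ H :=
  ObjectProperty.homMk
    { app := fun U => GrpCat.ofHom (φ U.unop)
      naturality := fun U V f => by
        ext x
        exact hφ f.unop x }

@[simp] theorem homApp_mkHom {G H : GroupSheaf J} (φ : ∀ U : C, G.sec U →* H.sec U)
    (hφ : ∀ {V U : C} (f : V ⟶ U) (x : G.sec U), φ V (G.res f x) = H.res f (φ U x)) (U : C) :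
    homApp (mkHom φ hφ) U = φ U := rfl

namespace Butterfly

variable {H G : CrossedModule J} (B : Butterfly H G)

theorem π_κ {U : C} (h : H.G₁.sec U) : homApp B.π U (homApp B.κ U h) = homApp H.del U h :=
  congrArg (fun φ => homApp φ U h) B.κ_π

theorem j_ι {U : C} (g : G.G₁.sec U) : homApp B.j U (homApp B.ι U g) = homApp G.del U g :=
  congrArg (fun φ => homApp φ U g) B.ι_j

theorem π_ι {U : C} (g : G.G₁.sec U) : homApp B.π U (homApp B.ι U g) = 1 :=
  (B.exact _).2 ⟨g, rfl⟩

theorem commute {U : C} (h : H.G₁.sec U) (g : G.G₁.sec U) :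
    homApp B.κ U h * homApp B.ι U g = homApp B.ι U g * homApp B.κ U h := by
  have e := B.ι_act g (homApp B.κ U h)
  rw [B.κ_j, G.act_one, mul_assoc, eq_inv_mul_iff_mul_eq] at e
  exact e

/-- The homomorphism `∂_E : H₁ × G₁ ⟶ E`, `(h, g) ↦ κ h * ι g`. -/
def delE : H.G₁.prod G.G₁ ⟶ B.E :=
  mkHom (fun U =>
    { toFun := fun x => homApp B.κ U x.1 * homApp B.ι U x.2
      map_one' := by
        change homApp B.κ U 1 * homApp B.ι U 1 = 1
        simp
      map_mul' := fun x y => by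
        change homApp B.κ U (x.1 * y.1) * homApp B.ι U (x.2 * y.2) =
          homApp B.κ U x.1 * homApp B.ι U x.2 * (homApp B.κ U y.1 * homApp B.ι U y.2)
        rw [map_mul, map_mul, mul_assoc, mul_assoc, ← mul_assoc (homApp B.κ U y.1),
          B.commute y.1 x.2, mul_assoc] })
    (fun {V U} f x => by
      change homApp B.κ V (H.G₁.res f x.1) * homApp B.ι V (G.G₁.res f x.2) =
        B.E.res f (homApp B.κ U x.1 * homApp B.ι U x.2)
      rw [map_mul, homApp_res, homApp_res])

theorem delE_apply {U : C} (x : (H.G₁.prod G.G₁).sec U) :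
    homApp B.delE U x = homApp B.κ U x.1 * homApp B.ι U x.2 := rfl

/-- The crossed module `E_• : H₁ × G₁ ⟶ E` of a butterfly, with
`(h, g) ^ e = (h ^ π e, g ^ j e)`. -/
def crossedModule : CrossedModule J where
  G₁ := H.G₁.prod G.G₁
  G₀ := B.E
  del := B.delE
  act {U} x e := (H.act x.1 (homApp B.π U e), G.act x.2 (homApp B.j U e))
  act_one x := Prod.ext (by simp [H.act_one]) (by simp [G.act_one])
  act_mul x a b := Prod.ext (by simp [H.act_mul]) (by simp [G.act_mul])
  mul_act x y a := Prod.ext (H.mul_act _ _ _) (G.mul_act _ _ _)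
  res_act f x a := Prod.ext ((H.res_act _ _ _).trans (by rw [← homApp_res]; rfl))
    ((G.res_act _ _ _).trans (by rw [← homApp_res]; rfl))
  del_act {U} x a := by
    change homApp B.κ U (H.act x.1 (homApp B.π U a)) * homApp B.ι U (G.act x.2 (homApp B.j U a)) =
      a⁻¹ * (homApp B.κ U x.1 * homApp B.ι U x.2) * a
    rw [B.κ_act, B.ι_act]
    group
  act_del {U} x y := by
    have hπ : homApp B.π U (homApp B.delE U y) = homApp H.del U y.1 := by
      rw [delE_apply, map_mul, B.π_κ, B.π_ι, mul_one]
    have hj : homApp B.j U (homApp B.delE U y) = homApp G.del U y.2 := by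
      rw [delE_apply, map_mul, B.κ_j, B.j_ι, one_mul]
    exact Prod.ext (by rw [hπ, H.act_del]; rfl) (by rw [hj, G.act_del]; rfl)

/-- The sheaf of groups `H₁ ×_{H₀} E`, formed with `∂ : H₁ ⟶ H₀` and `π : E ⟶ H₀`. -/
abbrev K : GroupSheaf J := GroupSheaf.fibreProd H.del B.π

/-- The action `e • (h, e') = (h ^ (π e)⁻¹, e e' e⁻¹)` of `E` on `H₁ ×_{H₀} E`. -/
def actionK : GroupAction B.E B.K where
  smul {U} e x := ⟨(H.act x.1.1 (homApp B.π U e)⁻¹, e * x.1.2 * e⁻¹), by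
    have h : homApp H.del U x.1.1 = homApp B.π U x.1.2 := x.2
    change homApp H.del U (H.act x.1.1 (homApp B.π U e)⁻¹) = homApp B.π U (e * x.1.2 * e⁻¹)
    rw [H.del_act, h]
    simp⟩
  one_smul {U} x := Subtype.ext (Prod.ext
    (by
      change H.act x.1.1 (homApp B.π U 1)⁻¹ = x.1.1
      simp [H.act_one])
    (by
      change 1 * x.1.2 * 1⁻¹ = x.1.2
      simp))
  mul_smul {U} a b x := Subtype.ext (Prod.ext
    (by
      change H.act x.1.1 (homApp B.π U (a * b))⁻¹ =
        H.act (H.act x.1.1 (homApp B.π U b)⁻¹) (homApp B.π U a)⁻¹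
      simp [H.act_mul])
    (by
      change a * b * x.1.2 * (a * b)⁻¹ = a * (b * x.1.2 * b⁻¹) * a⁻¹
      group))
  res_smul {V U} f a x := Subtype.ext (Prod.ext
    (by
      change H.G₁.res f (H.act x.1.1 (homApp B.π U a)⁻¹) =
        H.act (H.G₁.res f x.1.1) (homApp B.π V (B.E.res f a))⁻¹
      rw [H.res_act, map_inv, homApp_res])
    (by
      change B.E.res f (a * x.1.2 * a⁻¹) = B.E.res f a * B.E.res f x.1.2 * (B.E.res f a)⁻¹
      simp))
  smul_mul a x y := Subtype.ext (Prod.ext (H.mul_act _ _ _) (by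
    change a * (x.1.2 * y.1.2) * a⁻¹ = a * x.1.2 * a⁻¹ * (a * y.1.2 * a⁻¹)
    group))

/-- The homomorphism `θ : H₁ × G₁ ⟶ H₁ ×_{H₀} E`, `(h, g) ↦ (h, κ h * ι g)`. -/
def θ : H.G₁.prod G.G₁ ⟶ B.K :=
  mkHom (fun U =>
    { toFun := fun x => ⟨(x.1, homApp B.delE U x), by
        change homApp H.del U x.1 = homApp B.π U (homApp B.delE U x)
        rw [delE_apply, map_mul, B.π_κ, B.π_ι]
        exact (mul_one _).symm⟩
      map_one' := Subtype.ext (Prod.ext rfl (map_one _))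
      map_mul' := fun x y => Subtype.ext (Prod.ext rfl (map_mul _ x y)) })
    (fun f x => Subtype.ext (Prod.ext rfl (homApp_res B.delE f x)))

/-- The projection `H₁ ×_{H₀} E ⟶ H₁`. -/
def prH : B.K ⟶ H.G₁ :=
  mkHom (fun _ => (MonoidHom.fst _ _).comp (Subgroup.subtype _)) (fun _ _ => rfl)

/-- The projection `H₁ ×_{H₀} E ⟶ E`. -/
def prE : B.K ⟶ B.E :=
  mkHom (fun _ => (MonoidHom.snd _ _).comp (Subgroup.subtype _)) (fun _ _ => rfl)

/-- The projection `H₁ × G₁ ⟶ H₁`. -/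
def fstHom (_ : Butterfly H G) : H.G₁.prod G.G₁ ⟶ H.G₁ :=
  mkHom (fun _ => MonoidHom.fst _ _) (fun _ _ => rfl)

/-- The projection `H₁ × G₁ ⟶ G₁`. -/
def sndHom (_ : Butterfly H G) : H.G₁.prod G.G₁ ⟶ G.G₁ :=
  mkHom (fun _ => MonoidHom.snd _ _) (fun _ _ => rfl)

end Butterfly

/-! ### Torsors -/

/-- A right torsor under (the restriction to `C/U` of) the sheaf of groups `G`. -/
structure Torsor (G : GroupSheaf J) (U : C) where
  /-- the underlying sheaf of sets on `C/U` -/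
  sheaf : Sheaf (J.over U) (Type (max u v))
  /-- the right action -/
  act : ∀ {T : Over U}, Sec sheaf T → G.sec T.left → Sec sheaf T
  act_one : ∀ {T : Over U} (p : Sec sheaf T), act p 1 = p
  act_mul : ∀ {T : Over U} (p : Sec sheaf T) (g h : G.sec T.left),
    act p (g * h) = act (act p g) h
  rs_act : ∀ {T' T : Over U} (k : T' ⟶ T) (p : Sec sheaf T) (g : G.sec T.left),
    rs sheaf k (act p g) = act (rs sheaf k p) (G.res k.left g)
  simply_transitive : ∀ {T : Over U} (p q : Sec sheaf T), ∃! g : G.sec T.left, act p g = q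
  locally_nonempty : ∃ R ∈ J U, ∀ ⦃V : C⦄ (f : V ⟶ U), R f → Nonempty (Sec sheaf (Over.mk f))

namespace Torsor

variable {G : GroupSheaf J} {U : C}

/-- Sections of a torsor. -/
abbrev sec (P : Torsor G U) (T : Over U) : Type (max u v) := Sec P.sheaf T

/-- Restriction of sections of a torsor. -/
abbrev res (P : Torsor G U) {T' T : Over U} (k : T' ⟶ T) (p : P.sec T) : P.sec T' :=
  rs P.sheaf k p

theorem res_res (P : Torsor G U) {T'' T' T : Over U} (l : T'' ⟶ T') (k : T' ⟶ T) (p : P.sec T) :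
    P.res l (P.res k p) = P.res (l ≫ k) p := rs_rs _ _ _ _

/-- The section `g` of `G` with `q = p g`. -/
noncomputable def diff (P : Torsor G U) {T : Over U} (p q : P.sec T) : G.sec T.left :=
  (P.simply_transitive p q).choose

theorem act_diff (P : Torsor G U) {T : Over U} (p q : P.sec T) : P.act p (P.diff p q) = q :=
  (P.simply_transitive p q).choose_spec.1

theorem act_left_cancel (P : Torsor G U) {T : Over U} {p : P.sec T} {g h : G.sec T.left}
    (e : P.act p g = P.act p h) : g = h :=
  (P.simply_transitive p (P.act p h)).unique e rfl

theorem diff_act (P : Torsor G U) {T : Over U} (p : P.sec T) (g : G.sec T.left) :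
    P.diff p (P.act p g) = g :=
  P.act_left_cancel (P.act_diff p (P.act p g))

theorem res_diff (P : Torsor G U) {T' T : Over U} (k : T' ⟶ T) (p q : P.sec T) :
    G.res k.left (P.diff p q) = P.diff (P.res k p) (P.res k q) := by
  apply P.act_left_cancel (p := P.res k p)
  rw [P.act_diff, ← P.rs_act, P.act_diff]

/-- The sieve on `T` of those arrows over whose source the torsor has a section. -/
def sieve (P : Torsor G U) (T : Over U) : Sieve T where
  arrows T' _ := Nonempty (P.sec T')
  downward_closed := fun ⟨p⟩ g => ⟨P.res g p⟩

theorem sieve_mem (P : Torsor G U) (T : Over U) : P.sieve T ∈ J.over U T := by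
  obtain ⟨R, hR, h⟩ := P.locally_nonempty
  rw [GrothendieckTopology.mem_over_iff]
  refine J.superset_covering ?_ (J.pullback_stable T.hom hR)
  intro Z g hg
  rw [Sieve.overEquiv_iff]
  exact h _ hg

/-- Sections of a sheaf on `C/U` can be constructed using local sections of a torsor. -/
theorem descend (P : Torsor G U) (Z : Sheaf (J.over U) (Type (max u v))) (T : Over U)
    (s : ∀ ⦃T' : Over U⦄, (T' ⟶ T) → P.sec T' → Sec Z T')
    (hs : ∀ ⦃T' T'' : Over U⦄ (k : T' ⟶ T) (l : T'' ⟶ T') (p : P.sec T'),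
      rs Z l (s k p) = s (l ≫ k) (P.res l p))
    (hc : ∀ ⦃T' : Over U⦄ (k : T' ⟶ T) (p : P.sec T') (g : G.sec T'.left),
      s k (P.act p g) = s k p) :
    ∃ z : Sec Z T, ∀ ⦃T' : Over U⦄ (k : T' ⟶ T) (p : P.sec T'), rs Z k z = s k p := by
  have hc' : ∀ ⦃T' : Over U⦄ (k : T' ⟶ T) (p q : P.sec T'), s k p = s k q := fun T' k p q => by
    rw [← P.act_diff p q, hc]
  obtain ⟨z, hz⟩ := sec_glue Z (P.sieve_mem T) (fun T' k (h : Nonempty _) => s k h.some)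
    (fun T' T'' k l h => by
      rw [hs]
      exact hc' _ _ _)
  refine ⟨z, fun T' k p => ?_⟩
  rw [hz k ⟨p⟩]
  exact hc' _ _ _

theorem sec_ext (P : Torsor G U) (Z : Sheaf (J.over U) (Type (max u v))) {T : Over U}
    {z z' : Sec Z T}
    (h : ∀ ⦃T' : Over U⦄ (k : T' ⟶ T), P.sec T' → rs Z k z = rs Z k z') : z = z' :=
  ButterflyGerbe.sec_ext Z (P.sieve_mem T) (fun _ k (⟨p⟩ : Nonempty _) => h k p)

/-- Morphisms of torsors: equivariant morphisms of sheaves. -/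
@[ext]
structure Hom (P Q : Torsor G U) where
  app : ∀ {T : Over U}, P.sec T → Q.sec T
  app_res : ∀ {T' T : Over U} (k : T' ⟶ T) (p : P.sec T), app (P.res k p) = Q.res k (app p)
  app_act : ∀ {T : Over U} (p : P.sec T) (g : G.sec T.left), app (P.act p g) = Q.act (app p) g

instance : Category (Torsor G U) where
  Hom P Q := Hom P Q
  id P := ⟨fun p => p, fun _ _ => rfl, fun _ _ => rfl⟩
  comp φ ψ := ⟨fun p => ψ.app (φ.app p), fun k p => by rw [φ.app_res, ψ.app_res],
    fun p g => by rw [φ.app_act, ψ.app_act]⟩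

/-- The value of a morphism of torsors on a section. -/
def ap {P Q : Torsor G U} (φ : P ⟶ Q) {T : Over U} (p : P.sec T) : Q.sec T := Hom.app φ p

@[simp] theorem ap_id (P : Torsor G U) {T : Over U} (p : P.sec T) : ap (𝟙 P) p = p := rfl

@[simp] theorem ap_comp {P Q R : Torsor G U} (φ : P ⟶ Q) (ψ : Q ⟶ R) {T : Over U}
    (p : P.sec T) : ap (φ ≫ ψ) p = ap ψ (ap φ p) := rfl

theorem ap_res {P Q : Torsor G U} (φ : P ⟶ Q) {T' T : Over U} (k : T' ⟶ T) (p : P.sec T) :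
    ap φ (P.res k p) = Q.res k (ap φ p) := Hom.app_res φ k p

theorem ap_act {P Q : Torsor G U} (φ : P ⟶ Q) {T : Over U} (p : P.sec T) (g : G.sec T.left) :
    ap φ (P.act p g) = Q.act (ap φ p) g := Hom.app_act φ p g

@[ext] theorem hom_ext {P Q : Torsor G U} {φ ψ : P ⟶ Q}
    (h : ∀ (T : Over U) (p : P.sec T), ap φ p = ap ψ p) : φ = ψ := by
  apply Hom.ext
  funext T p
  exact h T p

/-- Constructor for morphisms of torsors. -/
def mkMor {P Q : Torsor G U} (app : ∀ {T : Over U}, P.sec T → Q.sec T)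
    (app_res : ∀ {T' T : Over U} (k : T' ⟶ T) (p : P.sec T), app (P.res k p) = Q.res k (app p))
    (app_act : ∀ {T : Over U} (p : P.sec T) (g : G.sec T.left),
      app (P.act p g) = Q.act (app p) g) : P ⟶ Q :=
  ⟨app, app_res, app_act⟩

theorem ap_bijective {P Q : Torsor G U} (φ : P ⟶ Q) (T : Over U) :
    Function.Bijective (fun p : P.sec T => ap φ p) := by
  have inj : ∀ T : Over U, Function.Injective (fun p : P.sec T => ap φ p) := fun T p q h => by
    have h' : ap φ p = ap φ q := h
    rw [← P.act_diff p q, ap_act] at h'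
    have h'' : P.diff p q = 1 := Q.act_left_cancel (p := ap φ p) (by rw [← h', Q.act_one])
    rw [← P.act_diff p q, h'', P.act_one]
  refine ⟨inj T, fun q => ?_⟩
  have ex : ∀ {T' : Over U} (p : P.sec T') (q' : Q.sec T'),
      ap φ (P.act p (Q.diff (ap φ p) q')) = q' := fun p q' => by
    rw [ap_act, Q.act_diff]
  obtain ⟨p, hp⟩ := P.descend P.sheaf T
    (fun T' k p => P.act p (Q.diff (ap φ p) (Q.res k q)))
    (fun T' T'' k l p => inj _ (by
      change ap φ (P.res l _) = ap φ _
      rw [ap_res, ex, ex, res_res]))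
    (fun T' k p g => inj _ (by
      change ap φ _ = ap φ _
      rw [ex, ex]))
  refine ⟨p, P.sec_ext Q.sheaf fun T' k p' => ?_⟩
  change Q.res k (ap φ p) = Q.res k q
  rw [← ap_res]
  have := hp k p'
  change ap φ (rs P.sheaf k p) = _
  rw [this, ex]

instance isIso_hom {P Q : Torsor G U} (φ : P ⟶ Q) : IsIso φ := by
  let e := fun T : Over U => Equiv.ofBijective _ (ap_bijective φ T)
  have he : ∀ {T : Over U} (q : Q.sec T), ap φ ((e T).symm q) = q :=
    fun {T} q => (e T).apply_symm_apply q
  have he' : ∀ {T : Over U} (p : P.sec T), (e T).symm (ap φ p) = p :=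
    fun {T} q => (e T).symm_apply_apply q
  refine ⟨mkMor (fun {T} q => (e T).symm q) (fun {T' T} k q => ?_) (fun {T} q g => ?_), ?_, ?_⟩
  · apply (e T').injective
    change ap φ ((e T').symm _) = ap φ (P.res k ((e T).symm q))
    rw [he, ap_res, he]
  · apply (e T).injective
    change ap φ ((e T).symm _) = ap φ (P.act ((e T).symm q) g)
    rw [he, ap_act, he]
  · ext T p
    exact he' p
  · ext T p
    exact he p

theorem ap_hom_inv {P Q : Torsor G U} (e : P ≅ Q) {T : Over U} (q : Q.sec T) :
    ap e.hom (ap e.inv q) = q := by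
  rw [← ap_comp, e.inv_hom_id, ap_id]

theorem ap_inv_hom {P Q : Torsor G U} (e : P ≅ Q) {T : Over U} (p : P.sec T) :
    ap e.inv (ap e.hom p) = p := by
  rw [← ap_comp, e.hom_inv_id, ap_id]

/-- The pullback of a torsor along `f : V ⟶ U`. -/
def pullback (P : Torsor G U) {V : C} (f : V ⟶ U) : Torsor G V where
  sheaf := (J.overMapPullback _ f).obj P.sheaf
  act {T} p g := P.act (T := (Over.map f).obj T) p g
  act_one {T} p := P.act_one (T := (Over.map f).obj T) p
  act_mul {T} p g h := P.act_mul (T := (Over.map f).obj T) p g h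
  rs_act k p g := P.rs_act ((Over.map f).map k) p g
  simply_transitive {T} p q := P.simply_transitive (T := (Over.map f).obj T) p q
  locally_nonempty := by
    obtain ⟨R, hR, h⟩ := P.locally_nonempty
    exact ⟨R.pullback f, J.pullback_stable f hR, fun W g hg => h (g ≫ f) hg⟩

/-- Pullback of morphisms of torsors. -/
def pullbackMap {P Q : Torsor G U} (φ : P ⟶ Q) {V : C} (f : V ⟶ U) :
    P.pullback f ⟶ Q.pullback f :=
  mkMor (fun {T} p => ap φ (T := (Over.map f).obj T) p)
    (fun k p => ap_res φ ((Over.map f).map k) p)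
    (fun {T} p g => ap_act φ (T := (Over.map f).obj T) p g)

theorem ap_pullbackMap {P Q : Torsor G U} (φ : P ⟶ Q) {V : C} (f : V ⟶ U) {T : Over V}
    (p : (P.pullback f).sec T) :
    ap (pullbackMap φ f) p = ap φ (T := (Over.map f).obj T) p := rfl

/-- The isomorphism `id^* P ≅ P`. -/
noncomputable def pullbackId (P : Torsor G U) : P.pullback (𝟙 U) ≅ P :=
  @asIso _ _ _ _ (mkMor (P := P.pullback (𝟙 U)) (Q := P)
    (fun {T} p => P.res (Over.homMk (𝟙 T.left) (by simp) : T ⟶ (Over.map (𝟙 U)).obj T) p)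
    (fun {T' T} k p => by
      refine (P.res_res _ _ _).trans (Eq.trans ?_ (P.res_res _ _ _).symm)
      congr 1
      ext
      simp)
    (fun {T} p g => (P.rs_act _ _ _).trans (by
      congr 1
      exact G.res_id g))) (isIso_hom _)

theorem ap_pullbackId (P : Torsor G U) {T : Over U} (p : (P.pullback (𝟙 U)).sec T) :
    ap P.pullbackId.hom p =
      P.res (Over.homMk (𝟙 T.left) (by simp) : T ⟶ (Over.map (𝟙 U)).obj T) p := rfl

/-- The isomorphism `(f ∘ g)^* P ≅ g^* f^* P`. -/
noncomputable def pullbackComp (P : Torsor G U) {W V : C} (g : W ⟶ V) (f : V ⟶ U) :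
    P.pullback (g ≫ f) ≅ (P.pullback f).pullback g :=
  @asIso _ _ _ _ (mkMor (P := P.pullback (g ≫ f)) (Q := (P.pullback f).pullback g)
    (fun {T} p => P.res (Over.homMk (𝟙 T.left) (by simp) :
      (Over.map f).obj ((Over.map g).obj T) ⟶ (Over.map (g ≫ f)).obj T) p)
    (fun {T' T} k p => by
      refine (P.res_res _ _ _).trans (Eq.trans ?_ (P.res_res _ _ _).symm)
      congr 1
      ext
      simp)
    (fun {T} p h => (P.rs_act _ _ _).trans (by
      congr 1
      exact G.res_id h))) (isIso_hom _)

theorem ap_pullbackComp (P : Torsor G U) {W V : C} (g : W ⟶ V) (f : V ⟶ U) {T : Over W}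
    (p : (P.pullback (g ≫ f)).sec T) :
    ap (P.pullbackComp g f).hom p = P.res (Over.homMk (𝟙 T.left) (by simp) :
      (Over.map f).obj ((Over.map g).obj T) ⟶ (Over.map (g ≫ f)).obj T) p := rfl

theorem ap_pullbackComp_inv (P : Torsor G U) {W V : C} (g : W ⟶ V) (f : V ⟶ U) {T : Over W}
    (p : ((P.pullback f).pullback g).sec T) :
    ap (P.pullbackComp g f).inv p = P.res (Over.homMk (𝟙 T.left) (by simp) :
      (Over.map (g ≫ f)).obj T ⟶ (Over.map f).obj ((Over.map g).obj T)) p := by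
  apply (ap_bijective (P.pullbackComp g f).hom T).1
  change ap (P.pullbackComp g f).hom _ = ap (P.pullbackComp g f).hom _
  rw [ap_hom_inv]
  refine Eq.trans ?_ (P.res_res _ _ _).symm
  refine (rs_id P.sheaf _).symm.trans ?_
  congr 1
  ext
  simp

theorem ap_eqToHom (P : Torsor G U) {V : C} {f g : V ⟶ U} (h : f = g) {T : Over V}
    (p : (P.pullback f).sec T) :
    ap (eqToHom (by rw [h]) : P.pullback f ⟶ P.pullback g) p =
      P.res (Over.homMk (𝟙 T.left) (by simp [h]) :
        (Over.map g).obj T ⟶ (Over.map f).obj T) p := by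
  subst h
  refine (rs_id P.sheaf _).symm.trans ?_
  congr 1

/-- Pullback of torsors along `f : V ⟶ U`, as a functor. -/
def pullbackFunctor (G : GroupSheaf J) {V U : C} (f : V ⟶ U) : Torsor G U ⥤ Torsor G V where
  obj P := P.pullback f
  map φ := pullbackMap φ f

theorem pullbackFunctor_congr (G : GroupSheaf J) {V U : C} {f g : V ⟶ U} (h : f = g)
    (P : Torsor G U) :
    (eqToHom (by rw [h]) : (pullbackFunctor G f).toCatHom ⟶
      (pullbackFunctor G g).toCatHom).toNatTrans.app P =
      (eqToHom (by rw [h]) : P.pullback f ⟶ P.pullback g) := by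
  subst h
  rfl

end Torsor

open Bicategory in
/-- The stack `TORS(G)` of right `G`-torsors: its fibre over `U` is the category of torsors
under the restriction of `G` to `C/U`. -/
noncomputable def TORS (G : GroupSheaf J) :
    LocallyDiscrete Cᵒᵖ ⥤ᵖ Cat.{max u v, max (u + 1) (v + 1)} :=
  LocallyDiscrete.mkPseudofunctor
    (fun U => Cat.of (Torsor G U.unop))
    (fun f => (Torsor.pullbackFunctor G f.unop).toCatHom)
    (fun U => Cat.Hom.isoMk (NatIso.ofComponents (fun P => Torsor.pullbackId P) (fun {P Q} φ => by
      refine Torsor.hom_ext fun T p => ?_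
      exact (Torsor.ap_res φ _ _).symm)))
    (fun f g => Cat.Hom.isoMk (NatIso.ofComponents
      (fun P => Torsor.pullbackComp P g.unop f.unop) (fun {P Q} φ => by
        refine Torsor.hom_ext fun T p => ?_
        exact (Torsor.ap_res φ _ _).symm)))
    (fun {a b c d} f g h => by
      have e : ((f ≫ g) ≫ h).unop = (f ≫ g ≫ h).unop := by simp
      ext P : 3
      refine Eq.trans ?_ (Torsor.pullbackFunctor_congr G e P).symm
      refine Torsor.hom_ext fun T p => ?_
      refine Eq.trans ?_ (Torsor.ap_eqToHom P e p).symm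
      refine (Torsor.ap_pullbackComp_inv P (h.unop ≫ g.unop) f.unop _).trans ?_
      refine (congrArg _ (Torsor.ap_pullbackComp_inv (P.pullback f.unop) h.unop g.unop _)).trans ?_
      refine (P.res_res _ _ _).trans ((P.res_res _ _ _).trans ((P.res_res _ _ _).trans ?_))
      congr 1
      ext
      simp)
    (fun {a b} f => by
      have e : (𝟙 a ≫ f).unop = f.unop := by simp
      ext P : 3
      refine Eq.trans ?_ (Torsor.pullbackFunctor_congr G e P).symm
      refine Torsor.hom_ext fun T p => ?_
      refine Eq.trans ?_ (Torsor.ap_eqToHom P e p).symm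
      refine (P.res_res _ _ _).trans ?_
      congr 1
      ext
      simp)
    (fun {a b} f => by
      have e : (f ≫ 𝟙 b).unop = f.unop := by simp
      ext P : 3
      refine Eq.trans ?_ (Torsor.pullbackFunctor_congr G e P).symm
      refine Torsor.hom_ext fun T p => ?_
      refine Eq.trans ?_ (Torsor.ap_eqToHom P e p).symm
      refine (P.res_res _ _ _).trans ?_
      congr 1
      ext
      simp)

/-! ### Contracted products -/

namespace Torsor

section Contracted

variable {G X : GroupSheaf J} {U : C} (P : Torsor G U) (a : LeftAction G X)

/-- The relation `(p, g • x) ∼ (p g, x)`. -/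
def orbitRel (T : Over U) (y z : P.sec T × X.sec T.left) : Prop :=
  ∃ g : G.sec T.left, z.1 = P.act y.1 g ∧ y.2 = a.smul g z.2

/-- The presheaf `T ↦ (P(T) × X(T)) / ∼`. -/
def orbits : (Over U)ᵒᵖ ⥤ Type (max u v) where
  obj T := Quot (P.orbitRel a T.unop)
  map {T T'} k := TypeCat.ofHom (Quot.map
    (fun y => (P.res k.unop y.1, X.res k.unop.left y.2)) (by
      rintro ⟨p, x⟩ ⟨q, y⟩ ⟨g, h₁, h₂⟩
      have h₁' : q = P.act p g := h₁
      have h₂' : x = a.smul g y := h₂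
      exact ⟨G.res k.unop.left g, by rw [h₁']; exact P.rs_act _ _ _,
        by rw [h₂']; exact a.res_smul _ _ _⟩))
  map_id T := by
    ext ⟨p, x⟩
    exact congrArg (Quot.mk _) (Prod.ext (rs_id P.sheaf p) (X.res_id x))
  map_comp k l := by
    ext ⟨p, x⟩
    exact congrArg (Quot.mk _) (Prod.ext (P.res_res _ _ p).symm (X.res_res _ _ x).symm)

/-- The contracted product `P ∧ᴳ X`: the sheaf on `C/U` associated to the presheaf quotient
of `P × X` by the relation `(p g, x) ∼ (p, g • x)`. -/
noncomputable def contr : Sheaf (J.over U) (Type (max u v)) :=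
  (presheafToSheaf (J.over U) (Type (max u v))).obj (P.orbits a)

/-- Sections of the contracted product. -/
abbrev csec (T : Over U) : Type (max u v) := Sec (P.contr a) T

/-- The section `p ∧ x` of the contracted product. -/
noncomputable def wedge {T : Over U} (p : P.sec T) (x : X.sec T.left) : P.csec a T :=
  (toSheafify (J.over U) (P.orbits a)).app (op T) (Quot.mk _ (p, x))

theorem rs_wedge {T' T : Over U} (k : T' ⟶ T) (p : P.sec T) (x : X.sec T.left) :
    rs (P.contr a) k (P.wedge a p x) = P.wedge a (P.res k p) (X.res k.left x) := by
  have h := (toSheafify (J.over U) (P.orbits a)).naturality k.op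
  exact (ConcreteCategory.congr_hom h (Quot.mk _ (p, x))).symm

theorem wedge_act {T : Over U} (p : P.sec T) (g : G.sec T.left) (x : X.sec T.left) :
    P.wedge a (P.act p g) x = P.wedge a p (a.smul g x) := by
  have h : (Quot.mk (P.orbitRel a T) (p, a.smul g x)) = Quot.mk _ (P.act p g, x) :=
    Quot.sound ⟨g, rfl, rfl⟩
  exact congrArg (fun y => (toSheafify (J.over U) (P.orbits a)).app (op T) y) h.symm

theorem orbitRel_of_eq {T : Over U} {y z : P.sec T × X.sec T.left}
    (h : Quot.mk (P.orbitRel a T) y = Quot.mk _ z) : P.orbitRel a T y z := by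
  have e : _root_.Equivalence (P.orbitRel a T) :=
    { refl := fun y => ⟨1, (P.act_one _).symm, (a.one_smul _).symm⟩
      symm := by
        rintro ⟨p, x⟩ ⟨q, y⟩ ⟨g, h₁, h₂⟩
        have h₁' : q = P.act p g := h₁
        have h₂' : x = a.smul g y := h₂
        refine ⟨g⁻¹, ?_, ?_⟩
        · change p = P.act q g⁻¹
          rw [h₁', ← P.act_mul, mul_inv_cancel, P.act_one]
        · change y = a.smul g⁻¹ x
          rw [h₂', a.inv_smul_smul]
      trans := by
        rintro ⟨p, x⟩ ⟨q, y⟩ ⟨r, z⟩ ⟨g, h₁, h₂⟩ ⟨g', h₁', h₂'⟩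
        have e₁ : q = P.act p g := h₁
        have e₂ : x = a.smul g y := h₂
        have e₃ : r = P.act q g' := h₁'
        have e₄ : y = a.smul g' z := h₂'
        refine ⟨g * g', ?_, ?_⟩
        · change r = P.act p (g * g')
          rw [e₃, e₁, P.act_mul]
        · change x = a.smul (g * g') z
          rw [e₂, e₄, a.mul_smul] }
  exact e.eqvGen_iff.1 (Quot.eqvGen_exact h)

theorem wedge_injective {T : Over U} {p : P.sec T} {x y : X.sec T.left}
    (h : P.wedge a p x = P.wedge a p y) : x = y := by
  have hR := Presheaf.equalizerSieve_mem (J.over U) (toSheafify (J.over U) (P.orbits a))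
    (X := op T) (Quot.mk _ (p, x)) (Quot.mk _ (p, y)) h
  refine ButterflyGerbe.sec_ext (X.on U) hR fun T' k hk => ?_
  have hk' : Quot.mk (P.orbitRel a T') (P.res k p, X.res k.left x) =
      Quot.mk _ (P.res k p, X.res k.left y) := hk
  obtain ⟨g, h₁, h₂⟩ := P.orbitRel_of_eq a hk'
  have h₁' : P.act (P.res k p) 1 = P.act (P.res k p) g := (P.act_one _).trans h₁
  have h₂' : X.res k.left x = a.smul g (X.res k.left y) := h₂
  have hg : (1 : G.sec T'.left) = g := P.act_left_cancel h₁'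
  rw [← hg, a.one_smul] at h₂'
  exact h₂'

/-- If `p` is a section of `P`, then every section of `P ∧ᴳ X` is uniquely of the form
`p ∧ x`. -/
theorem exists_wedge {T : Over U} (z : P.csec a T) (p : P.sec T) :
    ∃ x : X.sec T.left, P.wedge a p x = z := by
  have hR := Presheaf.imageSieve_mem (J.over U) (toSheafify (J.over U) (P.orbits a))
    (U := op T) z
  have hloc : ∀ ⦃T' : Over U⦄ (k : T' ⟶ T),
      Presheaf.imageSieve (toSheafify (J.over U) (P.orbits a)) z k →
      ∃ x : X.sec T'.left, P.wedge a (P.res k p) x = rs (P.contr a) k z := by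
    rintro T' k ⟨⟨q, y⟩, hy⟩
    refine ⟨a.smul (P.diff (P.res k p) q) y, ?_⟩
    rw [← wedge_act, P.act_diff]
    exact hy
  choose s hs using hloc
  obtain ⟨x, hx⟩ := ButterflyGerbe.sec_glue (X.on U) hR (fun T' k hk => s k hk)
    (fun T' T'' k l hk => by
      apply P.wedge_injective a (p := P.res (l ≫ k) p)
      rw [hs, ← rs_rs, ← hs k hk, rs_wedge, res_res]
      rfl)
  refine ⟨x, ButterflyGerbe.sec_ext (P.contr a) hR fun T' k hk => ?_⟩
  exact (P.rs_wedge a k p x).trans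
    ((congrArg (fun y => P.wedge a (P.res k p) y) (hx k hk)).trans (hs k hk))

/-- The coordinate of a section `z` of `P ∧ᴳ X` with respect to a section `p` of `P`:
the section `x` of `X` with `z = p ∧ x`. -/
noncomputable def coord {T : Over U} (z : P.csec a T) (p : P.sec T) : X.sec T.left :=
  (P.exists_wedge a z p).choose

@[simp] theorem wedge_coord {T : Over U} (z : P.csec a T) (p : P.sec T) :
    P.wedge a p (P.coord a z p) = z :=
  (P.exists_wedge a z p).choose_spec

@[simp] theorem coord_wedge {T : Over U} (p : P.sec T) (x : X.sec T.left) :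
    P.coord a (P.wedge a p x) p = x :=
  P.wedge_injective a (P.wedge_coord a _ _)

theorem coord_rs {T' T : Over U} (k : T' ⟶ T) (z : P.csec a T) (p : P.sec T) :
    P.coord a (rs (P.contr a) k z) (P.res k p) = X.res k.left (P.coord a z p) := by
  apply P.wedge_injective a (p := P.res k p)
  rw [wedge_coord, ← rs_wedge, wedge_coord]

theorem coord_act {T : Over U} (z : P.csec a T) (p : P.sec T) (g : G.sec T.left) :
    P.coord a z (P.act p g) = a.smul g⁻¹ (P.coord a z p) := by
  apply P.wedge_injective a (p := P.act p g)
  rw [wedge_coord, wedge_act, a.smul_inv_smul, wedge_coord]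

theorem csec_ext {T : Over U} {z z' : P.csec a T}
    (h : ∀ ⦃T' : Over U⦄ (k : T' ⟶ T) (p : P.sec T'),
      P.coord a (rs (P.contr a) k z) p = P.coord a (rs (P.contr a) k z') p) : z = z' :=
  P.sec_ext (P.contr a) fun T' k p => by
    rw [← P.wedge_coord a (rs (P.contr a) k z) p, h k p, wedge_coord]

theorem csec_ext_of {T : Over U} (p : P.sec T) {z z' : P.csec a T}
    (h : P.coord a z p = P.coord a z' p) : z = z' := by
  rw [← P.wedge_coord a z p, h, wedge_coord]

theorem exists_csec {T : Over U} (s : ∀ ⦃T' : Over U⦄, (T' ⟶ T) → P.sec T' → X.sec T'.left)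
    (hs : ∀ ⦃T' T'' : Over U⦄ (k : T' ⟶ T) (l : T'' ⟶ T') (p : P.sec T'),
      X.res l.left (s k p) = s (l ≫ k) (P.res l p))
    (ha : ∀ ⦃T' : Over U⦄ (k : T' ⟶ T) (p : P.sec T') (g : G.sec T'.left),
      s k (P.act p g) = a.smul g⁻¹ (s k p)) :
    ∃ z : P.csec a T, ∀ ⦃T' : Over U⦄ (k : T' ⟶ T) (p : P.sec T'),
      P.coord a (rs (P.contr a) k z) p = s k p := by
  obtain ⟨z, hz⟩ := P.descend (P.contr a) T (fun T' k p => P.wedge a p (s k p))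
    (fun T' T'' k l p => by rw [rs_wedge, hs])
    (fun T' k p g => by rw [wedge_act, ha, a.smul_inv_smul])
  refine ⟨z, fun T' k p => ?_⟩
  rw [hz k p, coord_wedge]

/-- The section of `P ∧ᴳ X` over `T` which is locally `p ∧ s p`, for a natural family `s` of
maps with `s (p g) = g⁻¹ • s p`. -/
noncomputable def ofCoord {T : Over U}
    (s : ∀ ⦃T' : Over U⦄, (T' ⟶ T) → P.sec T' → X.sec T'.left)
    (hs : ∀ ⦃T' T'' : Over U⦄ (k : T' ⟶ T) (l : T'' ⟶ T') (p : P.sec T'),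
      X.res l.left (s k p) = s (l ≫ k) (P.res l p))
    (ha : ∀ ⦃T' : Over U⦄ (k : T' ⟶ T) (p : P.sec T') (g : G.sec T'.left),
      s k (P.act p g) = a.smul g⁻¹ (s k p)) : P.csec a T :=
  (P.exists_csec a s hs ha).choose

theorem coord_rs_ofCoord {T : Over U}
    (s : ∀ ⦃T' : Over U⦄, (T' ⟶ T) → P.sec T' → X.sec T'.left)
    (hs : ∀ ⦃T' T'' : Over U⦄ (k : T' ⟶ T) (l : T'' ⟶ T') (p : P.sec T'),
      X.res l.left (s k p) = s (l ≫ k) (P.res l p))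
    (ha : ∀ ⦃T' : Over U⦄ (k : T' ⟶ T) (p : P.sec T') (g : G.sec T'.left),
      s k (P.act p g) = a.smul g⁻¹ (s k p)) ⦃T' : Over U⦄ (k : T' ⟶ T) (p : P.sec T') :
    P.coord a (rs (P.contr a) k (P.ofCoord a s hs ha)) p = s k p :=
  (P.exists_csec a s hs ha).choose_spec k p

theorem coord_ofCoord {T : Over U}
    (s : ∀ ⦃T' : Over U⦄, (T' ⟶ T) → P.sec T' → X.sec T'.left)
    (hs : ∀ ⦃T' T'' : Over U⦄ (k : T' ⟶ T) (l : T'' ⟶ T') (p : P.sec T'),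
      X.res l.left (s k p) = s (l ≫ k) (P.res l p))
    (ha : ∀ ⦃T' : Over U⦄ (k : T' ⟶ T) (p : P.sec T') (g : G.sec T'.left),
      s k (P.act p g) = a.smul g⁻¹ (s k p)) (p : P.sec T) :
    P.coord a (P.ofCoord a s hs ha) p = s (𝟙 T) p := by
  rw [← P.coord_rs_ofCoord a s hs ha (𝟙 T) p, rs_id]

end Contracted

/-! #### The group structure on `P ∧ᴳ X` when `G` acts by group automorphisms -/

section Group

variable {G X : GroupSheaf J} {U : C} (P : Torsor G U) (a : GroupAction G X)

noncomputable instance (T : Over U) : Mul (P.csec a.toLeftAction T) where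
  mul z w := P.ofCoord a.toLeftAction
    (fun _ k p => P.coord a.toLeftAction (rs (P.contr a.toLeftAction) k z) p *
      P.coord a.toLeftAction (rs (P.contr a.toLeftAction) k w) p)
    (fun T' T'' k l p => by rw [map_mul, ← coord_rs, ← coord_rs, rs_rs, rs_rs])
    (fun T' k p g => by rw [coord_act, coord_act, a.smul_mul])

noncomputable instance (T : Over U) : One (P.csec a.toLeftAction T) where
  one := P.ofCoord a.toLeftAction (fun _ _ _ => 1)
    (fun _ _ _ _ _ => map_one _) (fun _ _ _ _ => (a.smul_one _).symm)

noncomputable instance (T : Over U) : Inv (P.csec a.toLeftAction T) where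
  inv z := P.ofCoord a.toLeftAction
    (fun _ k p => (P.coord a.toLeftAction (rs (P.contr a.toLeftAction) k z) p)⁻¹)
    (fun T' T'' k l p => by rw [map_inv, ← coord_rs, rs_rs])
    (fun T' k p g => by rw [coord_act, a.smul_inv])

theorem coord_mul {T : Over U} (z w : P.csec a.toLeftAction T) (p : P.sec T) :
    P.coord a.toLeftAction (z * w) p =
      P.coord a.toLeftAction z p * P.coord a.toLeftAction w p := by
  refine (P.coord_ofCoord _ _ _ _ p).trans ?_
  rw [rs_id, rs_id]

theorem coord_one {T : Over U} (p : P.sec T) :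
    P.coord a.toLeftAction (1 : P.csec a.toLeftAction T) p = 1 :=
  P.coord_ofCoord _ _ _ _ p

theorem coord_inv {T : Over U} (z : P.csec a.toLeftAction T) (p : P.sec T) :
    P.coord a.toLeftAction z⁻¹ p = (P.coord a.toLeftAction z p)⁻¹ := by
  refine (P.coord_ofCoord _ _ _ _ p).trans ?_
  rw [rs_id]

/-- The multiplication is `(p ∧ x) (p ∧ y) = p ∧ (x y)`. -/
theorem wedge_mul {T : Over U} (p : P.sec T) (x y : X.sec T.left) :
    P.wedge a.toLeftAction p x * P.wedge a.toLeftAction p y = P.wedge a.toLeftAction p (x * y) :=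
  P.csec_ext_of _ p (by rw [coord_mul, coord_wedge, coord_wedge, coord_wedge])

theorem rs_mul {T' T : Over U} (k : T' ⟶ T) (z w : P.csec a.toLeftAction T) :
    rs (P.contr a.toLeftAction) k (z * w) =
      rs (P.contr a.toLeftAction) k z * rs (P.contr a.toLeftAction) k w := by
  refine P.csec_ext _ fun T'' l p => ?_
  have h : ∀ z w : P.csec a.toLeftAction T, ∀ (T'' : Over U) (m : T'' ⟶ T) (p : P.sec T''),
      P.coord a.toLeftAction (rs (P.contr a.toLeftAction) m (z * w)) p =
      P.coord a.toLeftAction (rs (P.contr a.toLeftAction) m z) p *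
        P.coord a.toLeftAction (rs (P.contr a.toLeftAction) m w) p :=
    fun z w T'' m p => P.coord_rs_ofCoord _ _ _ _ m p
  have h' : ∀ z w : P.csec a.toLeftAction T', ∀ (T'' : Over U) (m : T'' ⟶ T') (p : P.sec T''),
      P.coord a.toLeftAction (rs (P.contr a.toLeftAction) m (z * w)) p =
      P.coord a.toLeftAction (rs (P.contr a.toLeftAction) m z) p *
        P.coord a.toLeftAction (rs (P.contr a.toLeftAction) m w) p :=
    fun z w T'' m p => P.coord_rs_ofCoord _ _ _ _ m p
  rw [h', rs_rs, rs_rs, rs_rs, h]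

theorem rs_one {T' T : Over U} (k : T' ⟶ T) :
    rs (P.contr a.toLeftAction) k (1 : P.csec a.toLeftAction T) = 1 := by
  refine P.csec_ext _ fun T'' l p => ?_
  rw [rs_rs]
  have h : ∀ (T T' : Over U) (k : T' ⟶ T) (p : P.sec T'), P.coord a.toLeftAction
      (rs (P.contr a.toLeftAction) k (1 : P.csec a.toLeftAction T)) p = 1 :=
    fun T T' k p => P.coord_rs_ofCoord _ _ _ _ k p
  rw [h, h]

theorem rs_inv {T' T : Over U} (k : T' ⟶ T) (z : P.csec a.toLeftAction T) :
    rs (P.contr a.toLeftAction) k z⁻¹ = (rs (P.contr a.toLeftAction) k z)⁻¹ := by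
  refine P.csec_ext _ fun T'' l p => ?_
  have h : ∀ (T T' : Over U) (k : T' ⟶ T) (z : P.csec a.toLeftAction T) (p : P.sec T'),
      P.coord a.toLeftAction (rs (P.contr a.toLeftAction) k z⁻¹) p =
      (P.coord a.toLeftAction (rs (P.contr a.toLeftAction) k z) p)⁻¹ :=
    fun T T' k z p => P.coord_rs_ofCoord _ _ _ _ k p
  rw [rs_rs, h, h, rs_rs]

noncomputable instance (T : Over U) : Group (P.csec a.toLeftAction T) :=
  Group.ofLeftAxioms
    (fun x y z => P.csec_ext _ fun T' k p => by
      simp only [rs_mul, coord_mul, mul_assoc])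
    (fun x => P.csec_ext _ fun T' k p => by
      rw [rs_mul, coord_mul, rs_one, coord_one, one_mul])
    (fun x => P.csec_ext _ fun T' k p => by
      rw [rs_mul, coord_mul, rs_inv, coord_inv, rs_one, coord_one, inv_mul_cancel])

/-- The sheaf of groups `P ∧ᴳ X` on `C/U`. -/
noncomputable def twist : (Over U)ᵒᵖ ⥤ GrpCat.{max u v} where
  obj T := GrpCat.of (P.csec a.toLeftAction T.unop)
  map k := GrpCat.ofHom (MonoidHom.mk' (fun z => rs (P.contr a.toLeftAction) k.unop z)
    (fun z w => P.rs_mul a k.unop z w))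
  map_id T := by
    ext z
    exact rs_id (P.contr a.toLeftAction) z
  map_comp k l := by
    ext z
    exact (rs_rs (P.contr a.toLeftAction) _ _ z).symm

end Group

/-! #### Functoriality of the contracted product -/

section Maps

variable {G X Y : GroupSheaf J} {U : C}

/-- The map `id ∧ u : P ∧ᴳ X ⟶ P ∧ᴳ Y`, `p ∧ x ↦ p ∧ u x`, for a `G`-equivariant
homomorphism `u : X ⟶ Y`. -/
noncomputable def cmap (P : Torsor G U) (a : LeftAction G X) (b : LeftAction G Y) (u : X ⟶ Y)
    (hu : ∀ {V : C} (g : G.sec V) (x : X.sec V),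
      homApp u V (a.smul g x) = b.smul g (homApp u V x)) {T : Over U} (z : P.csec a T) :
    P.csec b T :=
  P.ofCoord b (fun T' k p => homApp u T'.left (P.coord a (rs (P.contr a) k z) p))
    (fun T' T'' k l p => by rw [← homApp_res, ← coord_rs, rs_rs])
    (fun T' k p g => by rw [coord_act, hu])

theorem coord_cmap (P : Torsor G U) (a : LeftAction G X) (b : LeftAction G Y) (u : X ⟶ Y)
    (hu : ∀ {V : C} (g : G.sec V) (x : X.sec V),
      homApp u V (a.smul g x) = b.smul g (homApp u V x)) {T : Over U} (z : P.csec a T)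
    (p : P.sec T) : P.coord b (P.cmap a b u hu z) p = homApp u T.left (P.coord a z p) := by
  refine (P.coord_ofCoord _ _ _ _ p).trans ?_
  rw [rs_id]

theorem cmap_wedge (P : Torsor G U) (a : LeftAction G X) (b : LeftAction G Y) (u : X ⟶ Y)
    (hu : ∀ {V : C} (g : G.sec V) (x : X.sec V),
      homApp u V (a.smul g x) = b.smul g (homApp u V x)) {T : Over U} (p : P.sec T)
    (x : X.sec T.left) :
    P.cmap a b u hu (P.wedge a p x) = P.wedge b p (homApp u T.left x) :=
  P.csec_ext_of b p (by rw [coord_cmap, coord_wedge, coord_wedge])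

/-- The map `φ ∧ id : P ∧ᴳ X ⟶ P' ∧ᴳ X`, `p ∧ x ↦ φ p ∧ x`, for a morphism of torsors
`φ : P ⟶ P'`. -/
noncomputable def mapTorsor {P P' : Torsor G U} (φ : P ⟶ P') (a : LeftAction G X) {T : Over U}
    (z : P.csec a T) : P'.csec a T :=
  P'.ofCoord a (fun _ k p => P.coord a (rs (P.contr a) k z) (ap (inv φ) p))
    (fun T' T'' k l p => by rw [← coord_rs, rs_rs, ap_res])
    (fun T' k p g => by rw [ap_act, coord_act])

theorem coord_mapTorsor {P P' : Torsor G U} (φ : P ⟶ P') (a : LeftAction G X) {T : Over U}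
    (z : P.csec a T) (p : P.sec T) :
    P'.coord a (mapTorsor φ a z) (ap φ p) = P.coord a z p := by
  refine (P'.coord_ofCoord _ _ _ _ _).trans ?_
  rw [rs_id, ← ap_comp, IsIso.hom_inv_id, ap_id]

theorem mapTorsor_wedge {P P' : Torsor G U} (φ : P ⟶ P') (a : LeftAction G X) {T : Over U}
    (p : P.sec T) (x : X.sec T.left) :
    mapTorsor φ a (P.wedge a p x) = P'.wedge a (ap φ p) x :=
  P'.csec_ext_of a (ap φ p) (by rw [coord_mapTorsor, coord_wedge, coord_wedge])

theorem coord_rs_mapTorsor {P P' : Torsor G U} (φ : P ⟶ P') (a : LeftAction G X) {T' T : Over U}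
    (k : T' ⟶ T) (z : P.csec a T) (p : P.sec T') :
    P'.coord a (rs (P'.contr a) k (mapTorsor φ a z)) (ap φ p) =
      P.coord a (rs (P.contr a) k z) p := by
  refine (P'.coord_rs_ofCoord _ _ _ _ _ _).trans ?_
  rw [← ap_comp, IsIso.hom_inv_id, ap_id]

theorem rs_mapTorsor {P P' : Torsor G U} (φ : P ⟶ P') (a : LeftAction G X) {T' T : Over U}
    (k : T' ⟶ T) (z : P.csec a T) :
    mapTorsor φ a (rs (P.contr a) k z) = rs (P'.contr a) k (mapTorsor φ a z) := by
  refine P.sec_ext (P'.contr a) fun T'' l p => ?_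
  refine P'.csec_ext_of a (ap φ p) ?_
  rw [coord_rs_mapTorsor, rs_rs, rs_rs, coord_rs_mapTorsor]

/-- The comparison map `(P ∧ᴳ X)|_V ⟶ P|_V ∧ᴳ X`, `p ∧ x ↦ p ∧ x`, for `f : V ⟶ U`. -/
noncomputable def baseChange (P : Torsor G U) (a : LeftAction G X) {V : C} (f : V ⟶ U)
    {T : Over V} (z : P.csec a ((Over.map f).obj T)) : (P.pullback f).csec a T :=
  (P.pullback f).ofCoord a
    (fun _ k p => P.coord a (rs (P.contr a) ((Over.map f).map k) z) p)
    (fun T' T'' k l p => by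
      refine (P.coord_rs a ((Over.map f).map l) _ p).symm.trans ?_
      rw [rs_rs, ← Functor.map_comp]
      rfl)
    (fun T' k p g => P.coord_act a (T := (Over.map f).obj T') _ p g)

theorem coord_baseChange (P : Torsor G U) (a : LeftAction G X) {V : C} (f : V ⟶ U)
    {T : Over V} (z : P.csec a ((Over.map f).obj T)) (p : (P.pullback f).sec T) :
    (P.pullback f).coord a (P.baseChange a f z) p = P.coord a z p := by
  refine ((P.pullback f).coord_ofCoord _ _ _ _ p).trans ?_
  refine congrArg (fun y => P.coord a (T := (Over.map f).obj T) y p) ?_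
  rw [CategoryTheory.Functor.map_id, rs_id]

theorem coord_rs_baseChange (P : Torsor G U) (a : LeftAction G X) {V : C} (f : V ⟶ U)
    {T' T : Over V} (k : T' ⟶ T) (z : P.csec a ((Over.map f).obj T))
    (p : (P.pullback f).sec T') :
    (P.pullback f).coord a (rs ((P.pullback f).contr a) k (P.baseChange a f z)) p =
      P.coord a (rs (P.contr a) ((Over.map f).map k) z) p :=
  (P.pullback f).coord_rs_ofCoord _ _ _ _ k p

theorem baseChange_wedge (P : Torsor G U) (a : LeftAction G X) {V : C} (f : V ⟶ U)
    {T : Over V} (p : (P.pullback f).sec T) (x : X.sec T.left) :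
    P.baseChange a f (P.wedge a (T := (Over.map f).obj T) p x) =
      (P.pullback f).wedge a p x :=
  (P.pullback f).csec_ext_of a p (by
    rw [coord_baseChange, coord_wedge]
    exact P.coord_wedge a (T := (Over.map f).obj T) p x)

theorem rs_baseChange (P : Torsor G U) (a : LeftAction G X) {V : C} (f : V ⟶ U)
    {T' T : Over V} (k : T' ⟶ T) (z : P.csec a ((Over.map f).obj T)) :
    P.baseChange a f (rs (P.contr a) ((Over.map f).map k) z) =
      rs ((P.pullback f).contr a) k (P.baseChange a f z) := by
  refine (P.pullback f).csec_ext a fun T'' l p => ?_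
  rw [rs_rs]
  refine (P.coord_rs_baseChange a f _ _ _).trans
    (Eq.trans ?_ (P.coord_rs_baseChange a f _ _ _).symm)
  refine congrArg (fun y => P.coord a (T := (Over.map f).obj T'') y p) ?_
  rw [rs_rs, ← Functor.map_comp]

end Maps

/-! #### Extension of the structural group -/

section Extend

variable {G H : GroupSheaf J} {U : C} (φ : G ⟶ H)

/-- The sheaf underlying `P ∧ᴳ H`, where `G` acts on `H` by left translations through
`φ : G ⟶ H`. -/
noncomputable abbrev extSec (P : Torsor G U) (T : Over U) : Type (max u v) :=
  P.csec (translationAction φ) T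

/-- The right action `(p ∧ h) h' = p ∧ h h'`. -/
noncomputable def extAct (P : Torsor G U) {T : Over U} (z : P.extSec φ T) (h : H.sec T.left) :
    P.extSec φ T :=
  P.ofCoord (translationAction φ)
    (fun T' k p => P.coord (translationAction φ) (rs (P.contr (translationAction φ)) k z) p *
      H.res k.left h)
    (fun T' T'' k l p => by
      rw [map_mul, ← coord_rs, rs_rs, GroupSheaf.res_res]
      rfl)
    (fun T' k p g => by
      rw [coord_act]
      exact mul_assoc _ _ _)

theorem coord_extAct (P : Torsor G U) {T : Over U} (z : P.extSec φ T) (h : H.sec T.left)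
    (p : P.sec T) : P.coord (translationAction φ) (P.extAct φ z h) p =
      P.coord (translationAction φ) z p * h := by
  refine (P.coord_ofCoord _ _ _ _ p).trans ?_
  rw [rs_id]
  congr 1
  exact H.res_id h

theorem coord_rs_extAct (P : Torsor G U) {T' T : Over U} (k : T' ⟶ T) (z : P.extSec φ T)
    (h : H.sec T.left) (p : P.sec T') :
    P.coord (translationAction φ) (rs (P.contr (translationAction φ)) k (P.extAct φ z h)) p =
      P.coord (translationAction φ) (rs (P.contr (translationAction φ)) k z) p *
        H.res k.left h :=
  P.coord_rs_ofCoord _ _ _ _ k p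

theorem extAct_wedge (P : Torsor G U) {T : Over U} (p : P.sec T) (x h : H.sec T.left) :
    P.extAct φ (P.wedge (translationAction φ) p x) h =
      P.wedge (translationAction φ) p (x * h) :=
  P.csec_ext_of _ p (by rw [coord_extAct, coord_wedge, coord_wedge])

theorem rs_extAct (P : Torsor G U) {T' T : Over U} (k : T' ⟶ T) (z : P.extSec φ T)
    (h : H.sec T.left) :
    rs (P.contr (translationAction φ)) k (P.extAct φ z h) =
      P.extAct φ (rs (P.contr (translationAction φ)) k z) (H.res k.left h) := by
  refine P.csec_ext _ fun T'' l p => ?_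
  rw [rs_rs, coord_rs_extAct, coord_rs_extAct, rs_rs, GroupSheaf.res_res]
  rfl

theorem extAct_one (P : Torsor G U) {T : Over U} (z : P.extSec φ T) : P.extAct φ z 1 = z :=
  P.sec_ext _ fun T' k p => P.csec_ext_of _ p (by rw [coord_rs_extAct, map_one, mul_one])

theorem extAct_mul (P : Torsor G U) {T : Over U} (z : P.extSec φ T) (g h : H.sec T.left) :
    P.extAct φ z (g * h) = P.extAct φ (P.extAct φ z g) h :=
  P.sec_ext _ fun T' k p => P.csec_ext_of _ p (by
    simp only [coord_rs_extAct, map_mul, mul_assoc])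

theorem extAct_simply_transitive (P : Torsor G U) {T : Over U} (z w : P.extSec φ T) :
    ∃! h : H.sec T.left, P.extAct φ z h = w := by
  have ex : ∃ h : H.sec T.left, ∀ ⦃T' : Over U⦄ (k : T' ⟶ T) (p : P.sec T'),
      H.res k.left h =
        (P.coord (translationAction φ) (rs (P.contr (translationAction φ)) k z) p)⁻¹ *
          P.coord (translationAction φ) (rs (P.contr (translationAction φ)) k w) p :=
    P.descend (H.on U) T
      (fun T' k p =>
        (P.coord (translationAction φ) (rs (P.contr (translationAction φ)) k z) p)⁻¹ *
          P.coord (translationAction φ) (rs (P.contr (translationAction φ)) k w) p)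
      (fun T' T'' k l p => by
        rw [GroupSheaf.rs_on, map_mul, map_inv, ← coord_rs, ← coord_rs, rs_rs, rs_rs])
      (fun T' k p g => by
        have h : ∀ x y : H.sec T'.left, ((translationAction φ).smul g⁻¹ x)⁻¹ *
            (translationAction φ).smul g⁻¹ y = x⁻¹ * y := fun x y => by
          simp [translationAction]
        rw [coord_act, coord_act, h])
  obtain ⟨h, hh⟩ := ex
  refine ⟨h, ?_, fun h' hh' => ?_⟩
  · refine P.sec_ext _ fun T' k p => P.csec_ext_of _ p ?_
    rw [coord_rs_extAct, hh k p, mul_inv_cancel_left]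
  · refine P.sec_ext (H.on U) fun T' k p => ?_
    refine Eq.trans ?_ (hh k p).symm
    rw [← hh', coord_rs_extAct, inv_mul_cancel_left]
    rfl

/-- The extension `φ_* P = P ∧ᴳ H` of the structural group of a torsor along `φ : G ⟶ H`. -/
noncomputable def extend (P : Torsor G U) : Torsor H U where
  sheaf := P.contr (translationAction φ)
  act z h := P.extAct φ z h
  act_one z := P.extAct_one φ z
  act_mul z g h := P.extAct_mul φ z g h
  rs_act k z h := P.rs_extAct φ k z h
  simply_transitive z w := P.extAct_simply_transitive φ z w
  locally_nonempty := by
    obtain ⟨R, hR, h⟩ := P.locally_nonempty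
    exact ⟨R, hR, fun V f hf => ⟨P.wedge (translationAction φ) (h f hf).some 1⟩⟩

/-- The map `P ⟶ φ_* P`, `p ↦ p ∧ 1`. -/
noncomputable def unit (P : Torsor G U) {T : Over U} (p : P.sec T) : (P.extend φ).sec T :=
  P.wedge (translationAction φ) p 1

theorem res_unit (P : Torsor G U) {T' T : Over U} (k : T' ⟶ T) (p : P.sec T) :
    (P.extend φ).res k (P.unit φ p) = P.unit φ (P.res k p) :=
  (P.rs_wedge _ k p 1).trans (congrArg _ (map_one _))

theorem unit_act (P : Torsor G U) {T : Over U} (p : P.sec T) (g : G.sec T.left) :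
    P.unit φ (P.act p g) = (P.extend φ).act (P.unit φ p) (homApp φ T.left g) := by
  refine (P.wedge_act _ p g 1).trans (Eq.trans ?_ (P.extAct_wedge φ p 1 _).symm)
  simp [translationAction]

theorem exists_act_unit (P : Torsor G U) {T : Over U} (p : P.sec T) (z : (P.extend φ).sec T) :
    ∃ h : H.sec T.left, z = (P.extend φ).act (P.unit φ p) h := by
  refine ⟨P.coord (translationAction φ) z p, ?_⟩
  refine Eq.trans ?_ (P.extAct_wedge φ p 1 _).symm
  rw [one_mul]
  exact (P.wedge_coord (translationAction φ) z p).symm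

/-- Morphisms out of `φ_* P` are determined by their values on `p ∧ 1`. -/
theorem extend_hom_ext {P : Torsor G U} {Q : Torsor H U} {α β : P.extend φ ⟶ Q}
    (h : ∀ (T : Over U) (p : P.sec T), ap α (P.unit φ p) = ap β (P.unit φ p)) : α = β := by
  refine hom_ext fun T z => P.sec_ext Q.sheaf fun T' k p => ?_
  obtain ⟨g, hg⟩ := P.exists_act_unit φ p ((P.extend φ).res k z)
  change Q.res k (ap α z) = Q.res k (ap β z)
  rw [← ap_res, ← ap_res, hg, ap_act, ap_act, h]

theorem mapTorsor_extAct {P Q : Torsor G U} (ψ : P ⟶ Q) {T : Over U} (z : P.extSec φ T)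
    (h : H.sec T.left) : mapTorsor ψ (translationAction φ) (P.extAct φ z h) =
      Q.extAct φ (mapTorsor ψ (translationAction φ) z) h :=
  P.sec_ext _ fun T' k p => Q.csec_ext_of _ (ap ψ p) (by
    rw [coord_rs_mapTorsor, coord_rs_extAct, coord_rs_extAct, coord_rs_mapTorsor])

/-- Functoriality of `φ_* P` in `P`: `p ∧ h ↦ ψ p ∧ h`. -/
noncomputable def extendMap {P Q : Torsor G U} (ψ : P ⟶ Q) : P.extend φ ⟶ Q.extend φ :=
  mkMor (fun z => mapTorsor ψ (translationAction φ) z)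
    (fun k z => rs_mapTorsor ψ _ k z)
    (fun z h => mapTorsor_extAct φ ψ z h)

theorem ap_extendMap_unit {P Q : Torsor G U} (ψ : P ⟶ Q) {T : Over U} (p : P.sec T) :
    ap (extendMap φ ψ) (P.unit φ p) = Q.unit φ (ap ψ p) :=
  mapTorsor_wedge ψ _ p 1

theorem baseChange_extAct (P : Torsor G U) {V : C} (f : V ⟶ U) {T : Over V}
    (z : P.extSec φ ((Over.map f).obj T)) (h : H.sec T.left) :
    P.baseChange (translationAction φ) f (P.extAct φ (T := (Over.map f).obj T) z h) =
      (P.pullback f).extAct φ (P.baseChange (translationAction φ) f z) h := by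
  refine (P.pullback f).sec_ext _ fun T' k p => (P.pullback f).csec_ext_of _ p ?_
  rw [coord_rs_extAct, coord_rs_baseChange, coord_rs_baseChange]
  exact P.coord_rs_extAct φ ((Over.map f).map k) z h p

/-- Compatibility of `φ_*` with pullbacks: `(φ_* P)|_V ⟶ φ_* (P|_V)`, `p ∧ h ↦ p ∧ h`. -/
noncomputable def extendPullback (P : Torsor G U) {V : C} (f : V ⟶ U) :
    (P.extend φ).pullback f ⟶ (P.pullback f).extend φ :=
  mkMor (P := (P.extend φ).pullback f) (Q := (P.pullback f).extend φ)
    (fun z => P.baseChange (translationAction φ) f z)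
    (fun k z => P.rs_baseChange (translationAction φ) f k z)
    (fun z h => P.baseChange_extAct φ f z h)

theorem ap_extendPullback_unit (P : Torsor G U) {V : C} (f : V ⟶ U) {T : Over V}
    (p : (P.pullback f).sec T) :
    ap (P.extendPullback φ f) (P.unit φ (T := (Over.map f).obj T) p) =
      (P.pullback f).unit φ p :=
  P.baseChange_wedge _ f p 1

/-- The isomorphism `(P ∧ᴳ H) ∧ᴴ X ≅ P ∧ᴳ X`, `(p ∧ h) ∧ x ↦ p ∧ h x`. -/
noncomputable def assoc {X : GroupSheaf J} (P : Torsor G U) (a : GroupAction H X) {T : Over U}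
    (z : (P.extend φ).csec a.toLeftAction T) : P.csec (a.comap φ).toLeftAction T :=
  P.ofCoord (a.comap φ).toLeftAction
    (fun _ k p => (P.extend φ).coord a.toLeftAction
      (rs ((P.extend φ).contr a.toLeftAction) k z) (P.unit φ p))
    (fun T' T'' k l p => by rw [← coord_rs, rs_rs, res_unit])
    (fun T' k p g => by
      rw [unit_act, coord_act, ← map_inv]
      rfl)

theorem coord_assoc {X : GroupSheaf J} (P : Torsor G U) (a : GroupAction H X) {T : Over U}
    (z : (P.extend φ).csec a.toLeftAction T) (p : P.sec T) :
    P.coord (a.comap φ).toLeftAction (P.assoc φ a z) p =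
      (P.extend φ).coord a.toLeftAction z (P.unit φ p) := by
  refine (P.coord_ofCoord _ _ _ _ p).trans ?_
  rw [rs_id]

theorem assoc_wedge {X : GroupSheaf J} (P : Torsor G U) (a : GroupAction H X) {T : Over U}
    (p : P.sec T) (h : H.sec T.left) (x : X.sec T.left) :
    P.assoc φ a ((P.extend φ).wedge a.toLeftAction (P.wedge (translationAction φ) p h) x) =
      P.wedge (a.comap φ).toLeftAction p (a.smul h x) := by
  refine P.csec_ext_of _ p ?_
  rw [coord_assoc, coord_wedge]
  have e : P.wedge (translationAction φ) p h = (P.extend φ).act (P.unit φ p) h := by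
    refine Eq.trans ?_ (P.extAct_wedge φ p 1 h).symm
    rw [one_mul]
  rw [e, wedge_act, coord_wedge]

end Extend

end Torsor

namespace Torsor

/-- The functor `P ↦ φ_* P`. -/
noncomputable def extendFunctor {G H : GroupSheaf J} (φ : G ⟶ H) (U : C) :
    Torsor G U ⥤ Torsor H U where
  obj P := P.extend φ
  map ψ := extendMap φ ψ
  map_id P := extend_hom_ext φ fun T p => ap_extendMap_unit φ _ p
  map_comp ψ χ := extend_hom_ext φ fun T p => by
    rw [ap_comp, ap_extendMap_unit, ap_extendMap_unit, ap_extendMap_unit, ap_comp]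

/-- The isomorphism `φ_* (P|_V) ≅ (φ_* P)|_V`. -/
noncomputable def extendPullbackIso {G H : GroupSheaf J} (φ : G ⟶ H) {U V : C} (f : V ⟶ U)
    (P : Torsor G U) : (P.pullback f).extend φ ≅ (P.extend φ).pullback f :=
  (asIso (P.extendPullback φ f)).symm

theorem ap_extendPullbackIso_unit {G H : GroupSheaf J} (φ : G ⟶ H) {U V : C} (f : V ⟶ U)
    (P : Torsor G U) {T : Over V} (p : (P.pullback f).sec T) :
    ap (extendPullbackIso φ f P).hom ((P.pullback f).unit φ p) =
      P.unit φ (T := (Over.map f).obj T) p := by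
  rw [← ap_extendPullback_unit]
  exact ap_inv_hom (asIso (P.extendPullback φ f)) _

end Torsor

open Bicategory in
theorem naturality_naturality_of_id {F F' : LocallyDiscrete Cᵒᵖ ⥤ᵖ Cat.{v₁, u₁}}
    {a b : LocallyDiscrete Cᵒᵖ} {f g : a ⟶ b} (η : f ⟶ g) (α : ∀ c, F.obj c ⟶ F'.obj c)
    (β : ∀ f : a ⟶ b, F.map f ≫ α b ≅ α a ≫ F'.map f) :
    F.map₂ η ▷ α b ≫ (β g).hom = (β f).hom ≫ α a ◁ F'.map₂ η := by
  obtain rfl := LocallyDiscrete.eq_of_hom η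
  obtain rfl := Subsingleton.elim η (𝟙 f)
  simp

open Bicategory in
/-- Compatibility of `φ_*` with pullbacks, as a natural isomorphism. -/
noncomputable def extensionNaturality {G H : GroupSheaf J} (φ : G ⟶ H)
    {a b : LocallyDiscrete Cᵒᵖ} (f : a ⟶ b) :
    (TORS G).map f ≫ (Torsor.extendFunctor φ b.as.unop).toCatHom ≅
      (Torsor.extendFunctor φ a.as.unop).toCatHom ≫ (TORS H).map f :=
  Cat.Hom.isoMk (NatIso.ofComponents
    (fun P => Torsor.extendPullbackIso φ f.as.unop P) (fun {P Q} ψ => by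
      refine Torsor.extend_hom_ext φ fun T p => ?_
      refine (congrArg (fun y => Torsor.ap (Torsor.extendPullbackIso φ f.as.unop Q).hom y)
        (Torsor.ap_extendMap_unit φ (Torsor.pullbackMap ψ f.as.unop) p)).trans ?_
      refine (Torsor.ap_extendPullbackIso_unit φ f.as.unop Q _).trans ?_
      refine Eq.trans ?_ (congrArg
        (fun y => Torsor.ap (Torsor.pullbackMap (Torsor.extendMap φ ψ) f.as.unop) y)
        (Torsor.ap_extendPullbackIso_unit φ f.as.unop P p).symm)
      exact (Torsor.ap_extendMap_unit φ ψ (T := (Over.map f.as.unop).obj T) p).symm))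

open Bicategory in
/-- The morphism of stacks `φ_* : TORS(G) ⟶ TORS(H)`, `P ↦ P ∧ᴳ H`, for `φ : G ⟶ H`. -/
noncomputable def extension {G H : GroupSheaf J} (φ : G ⟶ H) :
    Pseudofunctor.StrongTrans (TORS G) (TORS H) where
  app U := (Torsor.extendFunctor φ U.as.unop).toCatHom
  naturality f := extensionNaturality φ f
  naturality_naturality η := naturality_naturality_of_id (F := TORS G) (F' := TORS H) η
    (fun U => (Torsor.extendFunctor φ U.as.unop).toCatHom) (fun f => extensionNaturality φ f)
  naturality_id a := by
    ext P : 3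
    refine Torsor.extend_hom_ext φ fun T p => ?_
    refine (congrArg (fun y => Torsor.ap (Torsor.pullbackId (P.extend φ)).hom y)
      (Torsor.ap_extendPullbackIso_unit φ (𝟙 a.as.unop) P p)).trans ?_
    refine Eq.trans ?_ (Torsor.ap_extendMap_unit φ (Torsor.pullbackId P).hom p).symm
    exact P.res_unit φ _ _
  naturality_comp {a b c} f g := by
    ext P : 3
    refine Torsor.extend_hom_ext φ fun T p => ?_
    refine (congrArg
      (fun y => Torsor.ap (Torsor.pullbackComp (P.extend φ) g.as.unop f.as.unop).hom y)
      (Torsor.ap_extendPullbackIso_unit φ (g.as.unop ≫ f.as.unop) P p)).trans ?_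
    refine (P.res_unit φ _ _).trans ?_
    refine Eq.trans ?_ (congrArg (fun y => Torsor.ap
      (Torsor.pullbackMap (Torsor.extendPullbackIso φ f.as.unop P).hom g.as.unop)
        (Torsor.ap (Torsor.extendPullbackIso φ g.as.unop (P.pullback f.as.unop)).hom y))
      (Torsor.ap_extendMap_unit φ (Torsor.pullbackComp P g.as.unop f.as.unop).hom p).symm)
    refine Eq.trans ?_ (congrArg (fun y => Torsor.ap
      (Torsor.pullbackMap (Torsor.extendPullbackIso φ f.as.unop P).hom g.as.unop) y)
      (Torsor.ap_extendPullbackIso_unit φ g.as.unop (P.pullback f.as.unop) _).symm)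
    exact (Torsor.ap_extendPullbackIso_unit φ f.as.unop P
      (T := (Over.map g.as.unop).obj T) _).symm

/-! ### Fibre products of stacks -/

section FibreProducts

open Bicategory Pseudofunctor

/-- Pseudofunctors (fibred categories) over `C`, with values in large categories. -/
abbrev Fibred (C : Type u) [Category.{v} C] :=
  LocallyDiscrete Cᵒᵖ ⥤ᵖ Cat.{max u v, max (u + 1) (v + 1)}

namespace Fibred

variable {F F' K : Fibred C}

/-- The value of a 2-morphism of `Cat` at an object. -/
abbrev at2 {A B : Cat.{v₁, u₁}} {f g : A ⟶ B} (η : f ⟶ g) (x : A) :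
    f.toFunctor.obj x ⟶ g.toFunctor.obj x := η.toNatTrans.app x

theorem at2_hom_inv {A B : Cat.{v₁, u₁}} {f g : A ⟶ B} (η : f ≅ g) (x : A) :
    at2 η.hom x ≫ at2 η.inv x = 𝟙 _ :=
  congrArg (fun t => at2 t x) η.hom_inv_id

theorem at2_inv_hom {A B : Cat.{v₁, u₁}} {f g : A ⟶ B} (η : f ≅ g) (x : A) :
    at2 η.inv x ≫ at2 η.hom x = 𝟙 _ :=
  congrArg (fun t => at2 t x) η.inv_hom_id

/-- The value of an invertible 2-morphism of `Cat` at an object. -/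
@[simps]
def iso2 {A B : Cat.{v₁, u₁}} {f g : A ⟶ B} (η : f ≅ g) (x : A) :
    f.toFunctor.obj x ≅ g.toFunctor.obj x where
  hom := at2 η.hom x
  inv := at2 η.inv x
  hom_inv_id := at2_hom_inv η x
  inv_hom_id := at2_inv_hom η x

theorem at2_naturality {A B : Cat.{v₁, u₁}} {f g : A ⟶ B} (η : f ⟶ g) {x y : A} (m : x ⟶ y) :
    f.toFunctor.map m ≫ at2 η y = at2 η x ≫ g.toFunctor.map m :=
  η.toNatTrans.naturality m

theorem trans_id (α : StrongTrans F K) (a : LocallyDiscrete Cᵒᵖ) (x : F.obj a) :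
    at2 (α.naturality (𝟙 a)).hom x ≫ at2 (K.mapId a).hom ((α.app a).toFunctor.obj x) =
      (α.app a).toFunctor.map (at2 (F.mapId a).hom x) := by
  refine Eq.trans (congrArg (fun t => at2 t x) (α.naturality_id a)) ?_
  change (α.app a).toFunctor.map (at2 (F.mapId a).hom x) ≫ 𝟙 _ ≫ 𝟙 _ = _
  rw [Category.id_comp, Category.comp_id]

theorem trans_comp (α : StrongTrans F K) {a b c : LocallyDiscrete Cᵒᵖ} (f : a ⟶ b) (g : b ⟶ c)
    (x : F.obj a) :
    at2 (α.naturality (f ≫ g)).hom x ≫ at2 (K.mapComp f g).hom ((α.app a).toFunctor.obj x) =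
      (α.app c).toFunctor.map (at2 (F.mapComp f g).hom x) ≫
        at2 (α.naturality g).hom ((F.map f).toFunctor.obj x) ≫
          (K.map g).toFunctor.map (at2 (α.naturality f).hom x) := by
  refine Eq.trans (congrArg (fun t => at2 t x) (α.naturality_comp f g)) ?_
  change (α.app c).toFunctor.map (at2 (F.mapComp f g).hom x) ≫ 𝟙 _ ≫
        at2 (α.naturality g).hom ((F.map f).toFunctor.obj x) ≫ 𝟙 _ ≫
          (K.map g).toFunctor.map (at2 (α.naturality f).hom x) ≫ 𝟙 _ = _
  rw [Category.id_comp, Category.id_comp, Category.comp_id]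

open Limits

variable (α : StrongTrans F K) (β : StrongTrans F' K)

/-- The fibre over `a` of the fibre product: triples `(x, y, f)` with `f : α x ≅ β y`. -/
abbrev fibreCat (a : LocallyDiscrete Cᵒᵖ) :=
  CategoricalPullback (α.app a).toFunctor (β.app a).toFunctor

/-- Pullback along `f` of `(x, y, i)`. -/
def fibreObj {a b : LocallyDiscrete Cᵒᵖ} (f : a ⟶ b) (x : fibreCat α β a) :
    fibreCat α β b where
  fst := (F.map f).toFunctor.obj x.fst
  snd := (F'.map f).toFunctor.obj x.snd
  iso := iso2 (α.naturality f) x.fst ≪≫ (K.map f).toFunctor.mapIso x.iso ≪≫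
    (iso2 (β.naturality f) x.snd).symm

/-- Pullback along `f`, as a functor. -/
def fibreMap {a b : LocallyDiscrete Cᵒᵖ} (f : a ⟶ b) : fibreCat α β a ⥤ fibreCat α β b where
  obj x := fibreObj α β f x
  map {x y} m :=
    { fst := (F.map f).toFunctor.map m.fst
      snd := (F'.map f).toFunctor.map m.snd
      w := by
        change (α.app b).toFunctor.map ((F.map f).toFunctor.map m.fst) ≫
          at2 (α.naturality f).hom y.fst ≫ (K.map f).toFunctor.map y.iso.hom ≫
            at2 (β.naturality f).inv y.snd =
          (at2 (α.naturality f).hom x.fst ≫ (K.map f).toFunctor.map x.iso.hom ≫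
            at2 (β.naturality f).inv x.snd) ≫
              (β.app b).toFunctor.map ((F'.map f).toFunctor.map m.snd)
        have h₁ := at2_naturality (α.naturality f).hom m.fst
        have h₂ := at2_naturality (β.naturality f).inv m.snd
        have h₃ := congrArg (fun t => (K.map f).toFunctor.map t) m.w
        rw [Functor.map_comp, Functor.map_comp] at h₃
        refine (Category.assoc _ _ _).symm.trans ?_
        refine (congrArg (fun t => t ≫ _) h₁).trans ?_
        refine (Category.assoc _ _ _).trans ?_
        rw [Category.assoc, Category.assoc]
        refine congrArg (fun t => _ ≫ t) ?_
        refine (Category.assoc _ _ _).symm.trans ?_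
        refine (congrArg (fun t => t ≫ _) h₃).trans ?_
        rw [Category.assoc]
        exact congrArg (fun t => _ ≫ t) h₂ }
  map_id x := CategoricalPullback.hom_ext (CategoryTheory.Functor.map_id _ _)
    (CategoryTheory.Functor.map_id _ _)
  map_comp m n := CategoricalPullback.hom_ext (Functor.map_comp _ _ _) (Functor.map_comp _ _ _)

/-- The isomorphism `id^* x ≅ x`. -/
def fibreId (a : LocallyDiscrete Cᵒᵖ) (x : fibreCat α β a) : fibreObj α β (𝟙 a) x ≅ x :=
  CategoricalPullback.mkIso (iso2 (F.mapId a) x.fst) (iso2 (F'.mapId a) x.snd) (by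
    have h₁ := trans_id α a x.fst
    have h₂ := trans_id β a x.snd
    have h₃ := at2_naturality (K.mapId a).hom x.iso.hom
    change (α.app a).toFunctor.map (at2 (F.mapId a).hom x.fst) ≫ x.iso.hom =
      (at2 (α.naturality (𝟙 a)).hom x.fst ≫ (K.map (𝟙 a)).toFunctor.map x.iso.hom ≫
            at2 (β.naturality (𝟙 a)).inv x.snd) ≫
        (β.app a).toFunctor.map (at2 (F'.mapId a).hom x.snd)
    rw [← h₁, ← h₂, Category.assoc, Category.assoc, Category.assoc,
      ← Category.assoc (at2 (β.naturality (𝟙 a)).inv x.snd), at2_inv_hom, Category.id_comp]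
    exact congrArg (fun t => _ ≫ t) h₃.symm)

theorem comp_aux {D : Type u₁} [Category.{v₁} D] {X₀ X₁ X₂ X₃ Y₀ Y₁ Y₂ Y₃ Z W : D}
    {p : X₀ ⟶ X₁} {A : X₁ ⟶ X₂} {a : X₂ ⟶ X₃} {NA : X₀ ⟶ Z} {k₁ : Z ⟶ X₃} {i : Z ⟶ W}
    {k₂ : W ⟶ Y₃} {i' : X₃ ⟶ Y₃} {b : Y₂ ⟶ Y₃} {B : Y₁ ⟶ Y₂} {NB : Y₀ ⟶ W} {q : Y₀ ⟶ Y₁}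
    (h₁ : NA ≫ k₁ = p ≫ A ≫ a) (h₂ : NB ≫ k₂ = q ≫ B ≫ b) (h₃ : i ≫ k₂ = k₁ ≫ i')
    {b' : Y₃ ⟶ Y₂} {B' : Y₂ ⟶ Y₁} {NB' : W ⟶ Y₀} (hb : b ≫ b' = 𝟙 _) (hB : B ≫ B' = 𝟙 _)
    (hN : NB' ≫ NB = 𝟙 _) :
    p ≫ A ≫ a ≫ i' ≫ b' ≫ B' = (NA ≫ i ≫ NB') ≫ q := by
  have e₁ : p ≫ A ≫ a ≫ i' ≫ b' ≫ B' = (p ≫ A ≫ a) ≫ i' ≫ b' ≫ B' := by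
    simp only [Category.assoc]
  have e₂ : k₂ ≫ b' ≫ B' = NB' ≫ q := by
    have : k₂ = NB' ≫ q ≫ B ≫ b := by rw [← h₂, ← Category.assoc, hN, Category.id_comp]
    rw [this]
    simp only [Category.assoc]
    rw [← Category.assoc b, hb, Category.id_comp, hB, Category.comp_id]
  rw [e₁, ← h₁, Category.assoc, ← Category.assoc k₁, ← h₃, Category.assoc, e₂]
  simp only [Category.assoc]

/-- The isomorphism `(f ≫ g)^* x ≅ g^* f^* x`. -/
def fibreComp {a b c : LocallyDiscrete Cᵒᵖ} (f : a ⟶ b) (g : b ⟶ c) (x : fibreCat α β a) :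
    fibreObj α β (f ≫ g) x ≅ fibreObj α β g (fibreObj α β f x) :=
  CategoricalPullback.mkIso (iso2 (F.mapComp f g) x.fst) (iso2 (F'.mapComp f g) x.snd) (by
    refine Eq.trans ?_ (comp_aux (trans_comp α f g x.fst) (trans_comp β f g x.snd)
      (at2_naturality (K.mapComp f g).hom x.iso.hom)
      (b' := (K.map g).toFunctor.map (at2 (β.naturality f).inv x.snd))
      (B' := at2 (β.naturality g).inv ((F'.map f).toFunctor.obj x.snd))
      (NB' := at2 (β.naturality (f ≫ g)).inv x.snd)
      (((K.map g).toFunctor.map_comp _ _).symm.trans ((congrArg (fun t =>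
        (K.map g).toFunctor.map t) (at2_hom_inv (β.naturality f) x.snd)).trans
        ((K.map g).toFunctor.map_id _)))
      (at2_hom_inv _ _) (at2_inv_hom _ _))
    change (α.app c).toFunctor.map (at2 (F.mapComp f g).hom x.fst) ≫
        at2 (α.naturality g).hom ((F.map f).toFunctor.obj x.fst) ≫
          (K.map g).toFunctor.map (at2 (α.naturality f).hom x.fst ≫
            (K.map f).toFunctor.map x.iso.hom ≫ at2 (β.naturality f).inv x.snd) ≫
            at2 (β.naturality g).inv ((F'.map f).toFunctor.obj x.snd) = _
    rw [Functor.map_comp, Functor.map_comp, Category.assoc, Category.assoc]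
    rfl)

theorem map₂_eq (F : Fibred C) {a b : LocallyDiscrete Cᵒᵖ} {f g : a ⟶ b} (η : f ⟶ g)
    (h : F.map f = F.map g) : F.map₂ η = eqToHom h := by
  obtain rfl := LocallyDiscrete.eq_of_hom η
  obtain rfl := Subsingleton.elim η (𝟙 f)
  simp

theorem fst_eqToHom {a b : LocallyDiscrete Cᵒᵖ} {f g : a ⟶ b} (h : f = g)
    (x : fibreCat α β a) :
    CategoricalPullback.Hom.fst (at2 (eqToHom (by rw [h]) :
      (fibreMap α β f).toCatHom ⟶ (fibreMap α β g).toCatHom) x) =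
      at2 (eqToHom (by rw [h]) : F.map f ⟶ F.map g) x.fst := by
  subst h
  rfl

theorem snd_eqToHom {a b : LocallyDiscrete Cᵒᵖ} {f g : a ⟶ b} (h : f = g)
    (x : fibreCat α β a) :
    CategoricalPullback.Hom.snd (at2 (eqToHom (by rw [h]) :
      (fibreMap α β f).toCatHom ⟶ (fibreMap α β g).toCatHom) x) =
      at2 (eqToHom (by rw [h]) : F'.map f ⟶ F'.map g) x.snd := by
  subst h
  rfl

/-- The fibre product `F ×_K F'` of two morphisms of fibred categories. -/
def fibreProduct : Fibred C :=
  pseudofunctorOfIsLocallyDiscrete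
    (fun a => Cat.of (fibreCat α β a))
    (fun f => (fibreMap α β f).toCatHom)
    (fun a => Cat.Hom.isoMk (NatIso.ofComponents (fun x => fibreId α β a x) (by
      intro x y m
      exact CategoricalPullback.hom_ext (at2_naturality (F.mapId a).hom m.fst)
        (at2_naturality (F'.mapId a).hom m.snd))))
    (fun f g => Cat.Hom.isoMk (NatIso.ofComponents (fun x => fibreComp α β f g x) (by
      intro x y m
      exact CategoricalPullback.hom_ext (at2_naturality (F.mapComp f g).hom m.fst)
        (at2_naturality (F'.mapComp f g).hom m.snd))))
    (fun f g h => by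
      ext x : 3
      refine CategoricalPullback.hom_ext
        (Eq.trans ?_ (fst_eqToHom α β (Category.assoc f g h) x).symm) (Eq.trans ?_ (snd_eqToHom α β (Category.assoc f g h) x).symm)
      · rw [← map₂_eq F (α_ f g h).hom (by simp)]
        exact congrArg (fun t => at2 t x.fst) (F.map₂_associator f g h).symm
      · rw [← map₂_eq F' (α_ f g h).hom (by simp)]
        exact congrArg (fun t => at2 t x.snd) (F'.map₂_associator f g h).symm)
    (fun f => by
      ext x : 3
      refine CategoricalPullback.hom_ext
        (Eq.trans ?_ (fst_eqToHom α β (Category.id_comp f) x).symm) (Eq.trans ?_ (snd_eqToHom α β (Category.id_comp f) x).symm)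
      · rw [← map₂_eq F (λ_ f).hom (by simp)]
        exact congrArg (fun t => at2 t x.fst) (F.map₂_left_unitor f).symm
      · rw [← map₂_eq F' (λ_ f).hom (by simp)]
        exact congrArg (fun t => at2 t x.snd) (F'.map₂_left_unitor f).symm)
    (fun f => by
      ext x : 3
      refine CategoricalPullback.hom_ext
        (Eq.trans ?_ (fst_eqToHom α β (Category.comp_id f) x).symm) (Eq.trans ?_ (snd_eqToHom α β (Category.comp_id f) x).symm)
      · rw [← map₂_eq F (ρ_ f).hom (by simp)]
        exact congrArg (fun t => at2 t x.fst) (F.map₂_right_unitor f).symm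
      · rw [← map₂_eq F' (ρ_ f).hom (by simp)]
        exact congrArg (fun t => at2 t x.snd) (F'.map₂_right_unitor f).symm)

/-- Compatibility of the first projection with pullbacks. -/
def fstNaturality {a b : LocallyDiscrete Cᵒᵖ} (f : a ⟶ b) :
    (fibreMap α β f).toCatHom ≫
        (CategoricalPullback.π₁ (α.app b).toFunctor (β.app b).toFunctor).toCatHom ≅
      (CategoricalPullback.π₁ (α.app a).toFunctor (β.app a).toFunctor).toCatHom ≫ F.map f :=
  Cat.Hom.isoMk (NatIso.ofComponents (fun x => Iso.refl ((F.map f).toFunctor.obj x.fst)) (by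
    intro x y m
    exact (Category.comp_id _).trans (Category.id_comp _).symm))

/-- The first projection `F ×_K F' ⟶ F`. -/
def fstTrans : StrongTrans (fibreProduct α β) F where
  app a := (CategoricalPullback.π₁ (α.app a).toFunctor (β.app a).toFunctor).toCatHom
  naturality f := fstNaturality α β f
  naturality_naturality η := naturality_naturality_of_id (F := fibreProduct α β) (F' := F) η
    (fun a => (CategoricalPullback.π₁ (α.app a).toFunctor (β.app a).toFunctor).toCatHom)
    (fun f => fstNaturality α β f)
  naturality_id a := by
    ext x : 3
    change 𝟙 _ ≫ at2 (F.mapId a).hom x.fst = at2 (F.mapId a).hom x.fst ≫ 𝟙 _ ≫ 𝟙 _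
    rw [Category.id_comp]
    exact ((congrArg (fun t => _ ≫ t) (Category.comp_id _)).trans (Category.comp_id _)).symm
  naturality_comp {a b c} f g := by
    ext x : 3
    change 𝟙 _ ≫ at2 (F.mapComp f g).hom x.fst = at2 (F.mapComp f g).hom x.fst ≫ 𝟙 _ ≫ 𝟙 _ ≫
      𝟙 _ ≫ (F.map g).toFunctor.map (𝟙 ((F.map f).toFunctor.obj x.fst)) ≫ 𝟙 _
    have h := (F.map g).toFunctor.map_id ((F.map f).toFunctor.obj x.fst)
    rw [Category.id_comp]
    refine Eq.symm ((congrArg (fun t => _ ≫ t) ?_).trans (Category.comp_id _))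
    refine (Category.id_comp _).trans ((Category.id_comp _).trans ((Category.id_comp _).trans ?_))
    exact (Category.comp_id _).trans h

/-- Compatibility of the second projection with pullbacks. -/
def sndNaturality {a b : LocallyDiscrete Cᵒᵖ} (f : a ⟶ b) :
    (fibreMap α β f).toCatHom ≫
        (CategoricalPullback.π₂ (α.app b).toFunctor (β.app b).toFunctor).toCatHom ≅
      (CategoricalPullback.π₂ (α.app a).toFunctor (β.app a).toFunctor).toCatHom ≫ F'.map f :=
  Cat.Hom.isoMk (NatIso.ofComponents (fun x => Iso.refl ((F'.map f).toFunctor.obj x.snd)) (by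
    intro x y m
    exact (Category.comp_id _).trans (Category.id_comp _).symm))

/-- The second projection `F ×_K F' ⟶ F'`. -/
def sndTrans : StrongTrans (fibreProduct α β) F' where
  app a := (CategoricalPullback.π₂ (α.app a).toFunctor (β.app a).toFunctor).toCatHom
  naturality f := sndNaturality α β f
  naturality_naturality η := naturality_naturality_of_id (F := fibreProduct α β) (F' := F') η
    (fun a => (CategoricalPullback.π₂ (α.app a).toFunctor (β.app a).toFunctor).toCatHom)
    (fun f => sndNaturality α β f)
  naturality_id a := by
    ext x : 3
    change 𝟙 _ ≫ at2 (F'.mapId a).hom x.snd = at2 (F'.mapId a).hom x.snd ≫ 𝟙 _ ≫ 𝟙 _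
    rw [Category.id_comp]
    exact ((congrArg (fun t => _ ≫ t) (Category.comp_id _)).trans (Category.comp_id _)).symm
  naturality_comp {a b c} f g := by
    ext x : 3
    change 𝟙 _ ≫ at2 (F'.mapComp f g).hom x.snd = at2 (F'.mapComp f g).hom x.snd ≫ 𝟙 _ ≫ 𝟙 _ ≫
      𝟙 _ ≫ (F'.map g).toFunctor.map (𝟙 ((F'.map f).toFunctor.obj x.snd)) ≫ 𝟙 _
    have h := (F'.map g).toFunctor.map_id ((F'.map f).toFunctor.obj x.snd)
    rw [Category.id_comp]
    refine Eq.symm ((congrArg (fun t => _ ≫ t) ?_).trans (Category.comp_id _))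
    refine (Category.id_comp _).trans ((Category.id_comp _).trans ((Category.id_comp _).trans ?_))
    exact (Category.comp_id _).trans h

end Fibred

end FibreProducts

/-! ### Gerbes and bindings -/

section Gerbes

open Bicategory Pseudofunctor Fibred

/-- A gerbe over the site `(C, J)`: a stack in groupoids which is locally nonempty and locally
connected. -/
structure IsGerbe (J : GrothendieckTopology C) (F : Fibred C) : Prop where
  isStack : F.IsStack J
  isGroupoid : ∀ U : C, IsGroupoid (F.obj ⟨op U⟩)
  locally_nonempty : ∀ U : C, ∃ R ∈ J U, ∀ ⦃V : C⦄ (f : V ⟶ U), R f →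
    Nonempty (F.obj ⟨op V⟩)
  locally_connected : ∀ (U : C) (x y : F.obj ⟨op U⟩), ∃ R ∈ J U, ∀ ⦃V : C⦄ (f : V ⟶ U), R f →
    Nonempty ((F.map f.op.toLoc).toFunctor.obj x ≅ (F.map f.op.toLoc).toFunctor.obj y)

namespace Fibred

variable {F K : Fibred C}

/-- The group `Aut(x)(T) = Aut(T^* x)`, for `T : C/U` and `x` an object over `U`. -/
abbrev AutOver (F : Fibred C) {U : C} (x : F.obj ⟨op U⟩) (T : Over U) : Type (max u v) :=
  Aut ((F.map T.hom.op.toLoc).toFunctor.obj x)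

/-- Restriction of automorphisms. -/
def resAut (F : Fibred C) {U : C} (x : F.obj ⟨op U⟩) {T' T : Over U} (k : T' ⟶ T) :
    AutOver F x T →* AutOver F x T' :=
  (iso2 (F.mapComp' T.hom.op.toLoc k.left.op.toLoc T'.hom.op.toLoc
      (by rw [← Quiver.Hom.comp_toLoc, ← op_comp, Over.w])) x).symm.conjAut.toMonoidHom.comp
    (Functor.mapAut _ (F.map k.left.op.toLoc).toFunctor)

theorem resAut_hom (F : Fibred C) {U : C} (x : F.obj ⟨op U⟩) {T' T : Over U} (k : T' ⟶ T)
    (α : AutOver F x T) : (resAut F x k α).hom =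
      LocallyDiscreteOpToCat.pullHom α.hom k.left T'.hom T'.hom := by
  rfl

/-- The presheaf of groups `Aut(x)` on `C/U` of an object `x` over `U`. -/
def autPresheaf (F : Fibred C) {U : C} (x : F.obj ⟨op U⟩) : (Over U)ᵒᵖ ⥤ GrpCat.{max u v} where
  obj T := GrpCat.of (AutOver F x T.unop)
  map k := GrpCat.ofHom (resAut F x k.unop)
  map_id T := by
    ext α
    refine (resAut_hom F x _ α).trans ?_
    exact LocallyDiscreteOpToCat.pullHom_id _
  map_comp k l := by
    ext α
    refine (resAut_hom F x _ α).trans ?_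
    refine Eq.trans ?_ (resAut_hom F x l.unop (resAut F x k.unop α)).symm
    rw [resAut_hom, LocallyDiscreteOpToCat.pullHom_pullHom]
    rfl

/-- Conjugation `Aut(x) ≅ Aut(y)` by an isomorphism `e : x ≅ y`. -/
def conjAut (F : Fibred C) {U : C} {x y : F.obj ⟨op U⟩} (e : x ≅ y) (T : Over U) :
    AutOver F x T →* AutOver F y T :=
  ((F.map T.hom.op.toLoc).toFunctor.mapIso e).conjAut.toMonoidHom

/-- The identification `Aut(x)|_V ≅ Aut(f^* x)`, for `f : V ⟶ U`. -/
def baseChangeAut (F : Fibred C) {U V : C} (f : V ⟶ U) (x : F.obj ⟨op U⟩) (T : Over V) :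
    AutOver F x ((Over.map f).obj T) →* AutOver F ((F.map f.op.toLoc).toFunctor.obj x) T :=
  (iso2 (F.mapComp f.op.toLoc T.hom.op.toLoc) x).conjAut.toMonoidHom

/-- The homomorphism `Aut(x) ⟶ Aut(μ x)` induced by a morphism `μ`. -/
def mapAut (μ : StrongTrans F K) {U : C} (x : F.obj ⟨op U⟩) (T : Over U) :
    AutOver F x T →* AutOver K ((μ.app ⟨op U⟩).toFunctor.obj x) T :=
  (iso2 (μ.naturality T.hom.op.toLoc) x).conjAut.toMonoidHom.comp
    (Functor.mapAut _ (μ.app ⟨op T.left⟩).toFunctor)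

end Fibred

namespace Torsor

variable {G : GroupSheaf J} {U : C}

theorem diff_act_act (P : Torsor G U) {T : Over U} (p q : P.sec T) (g : G.sec T.left) :
    P.diff (P.act p g) (P.act q g) = (conjAction G).smul g⁻¹ (P.diff p q) := by
  apply P.act_left_cancel (p := P.act p g)
  have h : g * (conjAction G).smul g⁻¹ (P.diff p q) = P.diff p q * g := by
    simp [conjAction, mul_assoc]
  rw [P.act_diff, ← P.act_mul, h, P.act_mul, P.act_diff]

/-- The restriction of a section of `P` over `T'` to `T' ⟶ T`, as a section of the restriction
of `P` to `T`. -/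
def shift (P : Torsor G U) {T' T : Over U} (k : T' ⟶ T) (p : P.sec T') :
    (P.pullback T.hom).sec (Over.mk k.left) :=
  P.res (Over.homMk (𝟙 T'.left) (by simp) : (Over.map T.hom).obj (Over.mk k.left) ⟶ T') p

theorem res_shift (P : Torsor G U) {T'' T' T : Over U} (l : T'' ⟶ T') (k : T' ⟶ T)
    (p : P.sec T') : (P.pullback T.hom).res
      (Over.homMk l.left (by simp) : Over.mk (l ≫ k).left ⟶ Over.mk k.left) (P.shift k p) =
        P.shift (l ≫ k) (P.res l p) := by
  refine (P.res_res _ _ _).trans (Eq.trans ?_ (P.res_res _ _ _).symm)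
  congr 1
  ext
  simp

theorem shift_act (P : Torsor G U) {T' T : Over U} (k : T' ⟶ T) (p : P.sec T')
    (g : G.sec T'.left) :
    P.shift k (P.act p g) = (P.pullback T.hom).act (T := Over.mk k.left) (P.shift k p) g :=
  (P.rs_act _ _ _).trans (congrArg _ (G.res_id g))

/-- The canonical isomorphism `Aut(P) ≅ P ∧ᴳ G`, with `G` acting on itself by conjugation: an
automorphism `α` goes to the section which is `p ∧ g` wherever `α p = p g`. -/
noncomputable def autToAd (P : Torsor G U) (T : Over U) (α : Aut (P.pullback T.hom)) :
    P.csec (conjAction G).toLeftAction T :=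
  P.ofCoord (conjAction G).toLeftAction
    (fun T' k p => (P.pullback T.hom).diff (T := Over.mk k.left) (P.shift k p)
      (ap α.hom (P.shift k p)))
    (fun T' T'' k l p => by
      refine ((P.pullback T.hom).res_diff
        (Over.homMk l.left (by simp) : Over.mk (l ≫ k).left ⟶ Over.mk k.left) _ _).trans ?_
      rw [← ap_res, res_shift])
    (fun T' k p g => by
      rw [shift_act, ap_act]
      exact (P.pullback T.hom).diff_act_act (T := Over.mk k.left) _ _ g)

end Torsor

/-- The `G`-torsor `μ x` on `U` attached to an object `x` over `U` by a morphism
`μ : F ⟶ TORS(G)`. -/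
noncomputable abbrev torsorOf {F : Fibred C} {G : GroupSheaf J} (μ : StrongTrans F (TORS G)) {U : C}
    (x : F.obj ⟨op U⟩) : Torsor G U := (μ.app ⟨op U⟩).toFunctor.obj x

/-- The isomorphism `μ x ≅ μ y` attached to `e : x ≅ y`. -/
noncomputable abbrev torsorMap {F : Fibred C} {G : GroupSheaf J} (μ : StrongTrans F (TORS G)) {U : C}
    {x y : F.obj ⟨op U⟩} (e : x ⟶ y) : torsorOf μ x ⟶ torsorOf μ y :=
  (μ.app ⟨op U⟩).toFunctor.map e

/-- The isomorphism `(μ x)|_V ≅ μ (f^* x)`. -/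
noncomputable abbrev torsorPullback {F : Fibred C} {G : GroupSheaf J} (μ : StrongTrans F (TORS G)) {U V : C}
    (f : V ⟶ U) (x : F.obj ⟨op U⟩) :
    (torsorOf μ x).pullback f ⟶ torsorOf μ ((F.map f.op.toLoc).toFunctor.obj x) :=
  at2 (μ.naturality f.op.toLoc).inv x

theorem CrossedModule.del_leftAction (G : CrossedModule J) {V : C} (a : G.G₀.sec V)
    (g : G.G₁.sec V) : homApp G.del V (G.leftAction.smul a g) =
      (conjAction G.G₀).smul a (homApp G.del V g) := by
  refine (G.del_act g a⁻¹).trans ?_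
  rw [inv_inv]
  rfl

/-- The homomorphism `id ∧ ∂ : P ∧ G₁ ⟶ P ∧ G₀`. -/
noncomputable abbrev CrossedModule.cdel (G : CrossedModule J) {U : C} (P : Torsor G.G₀ U)
    {T : Over U} (z : P.csec G.leftAction.toLeftAction T) :
    P.csec (conjAction G.G₀).toLeftAction T :=
  P.cmap _ _ G.del (fun a g => G.del_leftAction a g) z

/-- The value of an isomorphism `Aut(x) ≅ P ∧ᴳ X` on an automorphism of `T^* x`. -/
noncomputable def adApp {F : Fibred C} {U : C} {x : F.obj ⟨op U⟩} {G X : GroupSheaf J}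
    {P : Torsor G U} {a : GroupAction G X} (i : autPresheaf F x ≅ P.twist a) {T : Over U}
    (α : AutOver F x T) : P.csec a.toLeftAction T :=
  i.hom.app (op T) α

/-- The structure of a gerbe bound by the crossed module `G` on a fibred category `F` with a
given morphism `μ : F ⟶ TORS(G₀)`. -/
structure Binding (G : CrossedModule J) {F : Fibred C} (μ : StrongTrans F (TORS G.G₀)) where
  /-- the isomorphism `Aut(x) ≅ μ x ∧ G₁` of sheaves of groups on `C/U` -/
  iso : ∀ {U : C} (x : F.obj ⟨op U⟩), autPresheaf F x ≅ (torsorOf μ x).twist G.leftAction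
  /-- functoriality with respect to isomorphisms `x ≅ y` over `U` -/
  natural : ∀ {U : C} {x y : F.obj ⟨op U⟩} (e : x ≅ y) (T : Over U) (α : AutOver F x T),
    adApp (iso y) (conjAut F e T α) =
      Torsor.mapTorsor (torsorMap μ e.hom) G.leftAction.toLeftAction
        (adApp (iso x) α)
  /-- functoriality with respect to the cartesian arrows `f^* x ⟶ x` -/
  baseChange : ∀ {U V : C} (f : V ⟶ U) (x : F.obj ⟨op U⟩) (T : Over V)
    (α : AutOver F x ((Over.map f).obj T)),
    adApp (iso ((F.map f.op.toLoc).toFunctor.obj x)) (baseChangeAut F f x T α) =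
      Torsor.mapTorsor (torsorPullback μ f x) G.leftAction.toLeftAction
        ((torsorOf μ x).baseChange G.leftAction.toLeftAction f
          (adApp (iso x) (T := (Over.map f).obj T) α))
  /-- the composition `Aut(x) ≅ μ x ∧ G₁ ⟶ μ x ∧ G₀ ≅ Aut(μ x)` is the homomorphism induced
  by `μ` -/
  compat : ∀ {U : C} (x : F.obj ⟨op U⟩) (T : Over U) (α : AutOver F x T),
    (torsorOf μ x).autToAd T (mapAut μ x T α) =
      G.cdel (torsorOf μ x) (adApp (iso x) α)

end Gerbes

/-! ### The maps attached to a butterfly -/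

namespace Butterfly

open Bicategory Pseudofunctor Fibred

variable {H G : CrossedModule J} (B : Butterfly H G)

theorem θ_smul {V : C} (e : B.E.sec V) (x : (H.G₁.prod G.G₁).sec V) :
    homApp B.θ V (B.crossedModule.leftAction.smul e x) = B.actionK.smul e (homApp B.θ V x) := by
  refine Subtype.ext (Prod.ext ?_ ?_)
  · change H.act x.1 (homApp B.π V e⁻¹) = H.act x.1 (homApp B.π V e)⁻¹
    rw [map_inv]
  · refine (B.crossedModule.del_act x e⁻¹).trans ?_
    exact congrArg (fun t => t * homApp B.delE V x * e⁻¹) (inv_inv e)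

variable {U : C} (P : Torsor B.E U) {T : Over U}

/-- The homomorphism `id ∧ θ : P ∧ (H₁ × G₁) ⟶ P ∧ (H₁ ×_{H₀} E)`. -/
noncomputable def cθ (z : P.csec B.crossedModule.leftAction.toLeftAction T) :
    P.csec B.actionK.toLeftAction T :=
  P.cmap _ _ B.θ (fun e x => B.θ_smul e x) z

/-- The projection `P ∧ (H₁ ×_{H₀} E) ⟶ P ∧ H₁`. -/
noncomputable def cprH (z : P.csec B.actionK.toLeftAction T) :
    P.csec (H.leftAction.comap B.π).toLeftAction T :=
  P.cmap _ _ B.prH (fun _ _ => rfl) z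

/-- The projection `P ∧ (H₁ ×_{H₀} E) ⟶ P ∧ E`. -/
noncomputable def cprE (z : P.csec B.actionK.toLeftAction T) :
    P.csec (conjAction B.E).toLeftAction T :=
  P.cmap _ _ B.prE (fun _ _ => rfl) z

/-- The homomorphism `id ∧ ∂ : P ∧ H₁ ⟶ P ∧ H₀`. -/
noncomputable def cdelH (z : P.csec (H.leftAction.comap B.π).toLeftAction T) :
    P.csec ((conjAction H.G₀).comap B.π).toLeftAction T :=
  P.cmap _ _ H.del (fun e x => H.del_leftAction (homApp B.π _ e) x) z

/-- The homomorphism `id ∧ π : P ∧ E ⟶ P ∧ H₀`. -/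
noncomputable def cπ (z : P.csec (conjAction B.E).toLeftAction T) :
    P.csec ((conjAction H.G₀).comap B.π).toLeftAction T :=
  P.cmap _ _ B.π (fun e x => by simp [conjAction, GroupAction.comap]) z

/-- The projection `P ∧ (H₁ × G₁) ⟶ P ∧ H₁`. -/
noncomputable def cfst (z : P.csec B.crossedModule.leftAction.toLeftAction T) :
    P.csec (H.leftAction.comap B.π).toLeftAction T :=
  P.cmap _ _ B.fstHom (fun {V} e x => by
    change H.act x.1 (homApp B.π V e⁻¹) = H.act x.1 (homApp B.π V e)⁻¹
    rw [map_inv]) z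

/-- The projection `P ∧ (H₁ × G₁) ⟶ P ∧ G₁`. -/
noncomputable def csnd (z : P.csec B.crossedModule.leftAction.toLeftAction T) :
    P.csec (G.leftAction.comap B.j).toLeftAction T :=
  P.cmap _ _ B.sndHom (fun {V} e x => by
    change G.act x.2 (homApp B.j V e⁻¹) = G.act x.2 (homApp B.j V e)⁻¹
    rw [map_inv]) z

/-- The fibre product `Q' = Q ×_{TORS(H₀)} TORS(E)`, formed with `ν : Q ⟶ TORS(H₀)` and
`π_* : TORS(E) ⟶ TORS(H₀)`. -/
noncomputable abbrev pullbackGerbe {Q : Fibred C} (ν : StrongTrans Q (TORS H.G₀)) : Fibred C :=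
  fibreProduct ν (extension B.π)

/-- The projection `Q' ⟶ Q`, `(x, f, P) ↦ x`. -/
noncomputable abbrev toQ {Q : Fibred C} (ν : StrongTrans Q (TORS H.G₀)) :
    StrongTrans (B.pullbackGerbe ν) Q :=
  fstTrans ν (extension B.π)

/-- The projection `ν' : Q' ⟶ TORS(E)`, `(x, f, P) ↦ P`. -/
noncomputable abbrev toTORS {Q : Fibred C} (ν : StrongTrans Q (TORS H.G₀)) :
    StrongTrans (B.pullbackGerbe ν) (TORS B.E) :=
  sndTrans ν (extension B.π)

/-- The underlying object `x` of `(x, f, P)`. -/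
noncomputable abbrev objX {Q : Fibred C} (ν : StrongTrans Q (TORS H.G₀))
    (q : (B.pullbackGerbe ν).obj ⟨op U⟩) : Q.obj ⟨op U⟩ :=
  ((B.toQ ν).app ⟨op U⟩).toFunctor.obj q

/-- The isomorphism `f : ν x ≅ π_* P` of `(x, f, P)`. -/
noncomputable def structureMap {Q : Fibred C} (ν : StrongTrans Q (TORS H.G₀))
    (q : (B.pullbackGerbe ν).obj ⟨op U⟩) :
    torsorOf ν (B.objX ν q) ⟶ (torsorOf (B.toTORS ν) q).extend B.π :=
  (Limits.CategoricalPullback.iso q).hom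

/-- The composition `Aut(x) ≅ ν x ∧ H₁ ≅ (P ∧ᴱ H₀) ∧ H₁ ≅ P ∧ᴱ H₁` of `k`, of `f ∧ id` and
of the associativity isomorphism, evaluated on the first component of an automorphism of
`(x, f, P)`. -/
noncomputable def compH {Q : Fibred C} {ν : StrongTrans Q (TORS H.G₀)} (k : Binding H ν)
    (q : (B.pullbackGerbe ν).obj ⟨op U⟩) (α : AutOver (B.pullbackGerbe ν) q T) :
    (torsorOf (B.toTORS ν) q).csec (H.leftAction.comap B.π).toLeftAction T :=
  (torsorOf (B.toTORS ν) q).assoc B.π H.leftAction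
    (Torsor.mapTorsor (B.structureMap ν q) H.leftAction.toLeftAction
      (adApp (k.iso (B.objX ν q)) (mapAut (B.toQ ν) q T α)))

/-- The second component of an automorphism of `(x, f, P)`, as a section of `P ∧ᴱ E ≅ Aut(P)`. -/
noncomputable def compE {Q : Fibred C} (ν : StrongTrans Q (TORS H.G₀))
    (q : (B.pullbackGerbe ν).obj ⟨op U⟩) (α : AutOver (B.pullbackGerbe ν) q T) :
    (torsorOf (B.toTORS ν) q).csec (conjAction B.E).toLeftAction T :=
  (torsorOf (B.toTORS ν) q).autToAd T (mapAut (B.toTORS ν) q T α)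

end Butterfly

end ButterflyGerbe

open ButterflyGerbe ButterflyGerbe.Fibred

/-! An automorphism of a triple `(x, f, P)` is a pair `(φ, α)` of automorphisms of `x` and `P` whose
images `ν φ` and `π_* α` correspond to each other under `f`. The binding of `Q`, followed by `f` and
the associativity isomorphism, turns `φ` into a section of `P ∧ H₁`; the isomorphism `Aut P ≅ P ∧ E`
turns `α` into a section of `P ∧ E`. The compatibility axiom of the binding says that `id ∧ ∂`
computes `ν` on automorphisms, and `id ∧ π` computes `π_*`. So the condition on `(φ, α)` says
exactly that the two sections have the same image in `P ∧ H₀` (`Butterfly.cdelH_assoc_eq_iff`).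
Contracted products commute with fibre products (`Butterfly.ext_cpr`, `Butterfly.exists_cpr`), hence
`Aut (x, f, P) ≅ P ∧ (H₁ ×_{H₀} E)` (`Butterfly.comp_bijective`).

The map `θ` is bijective because `κ h` and `e` have the same image in `H₀` whenever `(h, e)` lies in
the fibre product, so that `(κ h)⁻¹ e` comes from a unique section of `G₁`
(`Butterfly.θ_bijective`). Transporting along `θ` gives the binding by `E_•`. Its compatibility
axiom holds because the second component of `θ` is the boundary of `E_•`; its functoriality is
checked on the two components separately.

That `Q'` is a stack is formal once torsors are known to form a stack: a fibre product of stacks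
over a prestack is a stack (`Fibred.isStack_fibreProduct`), and torsors glue (`TORS_isStack`). Local
nonemptiness follows by trivializing `ν x` and pairing `x` with the trivial `E`-torsor. For local
connectedness, localize until the objects of `Q` are isomorphic and both torsors have sections; the
discrepancy between the two structure maps is then a section of `H₀`, which lifts locally to `E`
because `π` is an epimorphism, and the lift corrects the isomorphism of torsors
(`Butterfly.locIso_of_sec`).

Two devices keep the coherence isomorphisms under control. Sections of `P ∧ X` are handled through
their coordinates, that is, as equivariant functions on the sections of `P`. Morphisms between
pullbacks of torsors are handled through their values `vl`, on which all comparison isomorphisms act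
as restrictions along identities. -/

namespace ButterflyGerbe

variable {C : Type u} [Category.{v} C] {J : GrothendieckTopology C}

/-! ### Morphisms of fibred categories acting on morphisms between pullbacks. -/

namespace Fibred

open Bicategory Pseudofunctor LocallyDiscreteOpToCat

variable {F F' K : Fibred C}

section HomMap

/-- The map `(f₁^* M₁ ⟶ f₂^* M₂) → (f₁^* α M₁ ⟶ f₂^* α M₂)` induced by a morphism `α` of fibred
categories. -/
def homMap (α : StrongTrans F K) {X₁ X₂ Y : C} {M₁ : F.obj ⟨op X₁⟩} {M₂ : F.obj ⟨op X₂⟩}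
    {f₁ : Y ⟶ X₁} {f₂ : Y ⟶ X₂}
    (φ : (F.map f₁.op.toLoc).toFunctor.obj M₁ ⟶ (F.map f₂.op.toLoc).toFunctor.obj M₂) :
    (K.map f₁.op.toLoc).toFunctor.obj ((α.app ⟨op X₁⟩).toFunctor.obj M₁) ⟶
      (K.map f₂.op.toLoc).toFunctor.obj ((α.app ⟨op X₂⟩).toFunctor.obj M₂) :=
  at2 (α.naturality f₁.op.toLoc).inv M₁ ≫ (α.app ⟨op Y⟩).toFunctor.map φ ≫
    at2 (α.naturality f₂.op.toLoc).hom M₂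

variable (α : StrongTrans F K)

theorem trans_comp' {a b c : LocallyDiscrete Cᵒᵖ} (f : a ⟶ b) (g : b ⟶ c) (fg : a ⟶ c)
    (h : f ≫ g = fg) (x : F.obj a) :
    at2 (α.naturality fg).hom x ≫ at2 (K.mapComp' f g fg h).hom ((α.app a).toFunctor.obj x) =
      (α.app c).toFunctor.map (at2 (F.mapComp' f g fg h).hom x) ≫
        at2 (α.naturality g).hom ((F.map f).toFunctor.obj x) ≫
          (K.map g).toFunctor.map (at2 (α.naturality f).hom x) := by
  subst h
  simp only [mapComp'_eq_mapComp]
  exact trans_comp α f g x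

theorem map_at2_hom_inv {A B A' : Cat.{v₁, u₁}} {f g : A ⟶ B} (η : f ≅ g) (G : B ⟶ A') (x : A) :
    G.toFunctor.map (at2 η.hom x) ≫ G.toFunctor.map (at2 η.inv x) = 𝟙 _ := by
  rw [← Functor.map_comp, at2_hom_inv, CategoryTheory.Functor.map_id]

theorem map_at2_inv_hom {A B A' : Cat.{v₁, u₁}} {f g : A ⟶ B} (η : f ≅ g) (G : B ⟶ A') (x : A) :
    G.toFunctor.map (at2 η.inv x) ≫ G.toFunctor.map (at2 η.hom x) = 𝟙 _ := by
  rw [← Functor.map_comp, at2_inv_hom, CategoryTheory.Functor.map_id]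

/-- This is the diagram chase behind `pullHom_homMap`, in an arbitrary category so that rewriting is
not hindered by the pseudofunctor terms. The letters `c` and `m` play the comparisons of the source
and of the target, and `n`, `p`, `s` the naturality isomorphisms at the composite and at its two
factors. -/
theorem comp_conj_comp {D : Type u₁} [Category.{v₁} D] {A₁ A₂ B₁ B₂ C₁ C₂ E₁ E₂ H₁ H₂ : D}
    {n₁ : C₁ ⟶ A₁} {n₁' : A₁ ⟶ C₁} {m₁ : A₁ ⟶ B₁} {c₁ : C₁ ⟶ E₁} {p₁ : E₁ ⟶ H₁} {s₁ : H₁ ⟶ B₁}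
    {s₁' : B₁ ⟶ H₁} {n₂ : C₂ ⟶ A₂} {m₂ : A₂ ⟶ B₂} {m₂' : B₂ ⟶ A₂} {c₂ : C₂ ⟶ E₂} {c₂' : E₂ ⟶ C₂}
    {p₂ : E₂ ⟶ H₂} {s₂ : H₂ ⟶ B₂} {φ : H₁ ⟶ H₂} {ψ : E₁ ⟶ E₂}
    (h₁ : n₁ ≫ m₁ = c₁ ≫ p₁ ≫ s₁) (h₂ : n₂ ≫ m₂ = c₂ ≫ p₂ ≫ s₂) (hφ : ψ ≫ p₂ = p₁ ≫ φ)
    (hs : s₁ ≫ s₁' = 𝟙 _) (hn : n₁' ≫ n₁ = 𝟙 _) (hc : c₂' ≫ c₂ = 𝟙 _) (hm : m₂ ≫ m₂' = 𝟙 _) :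
    m₁ ≫ (s₁' ≫ φ ≫ s₂) ≫ m₂' = n₁' ≫ (c₁ ≫ ψ ≫ c₂') ≫ n₂ := by
  have e₁ : m₁ = n₁' ≫ c₁ ≫ p₁ ≫ s₁ := by rw [← h₁, reassoc_of% hn]
  have e₂ : p₂ ≫ s₂ = c₂' ≫ n₂ ≫ m₂ := by rw [h₂, reassoc_of% hc]
  simp only [Category.assoc, e₁, reassoc_of% hs]
  rw [← reassoc_of% hφ, reassoc_of% e₂, hm, Category.comp_id]

/-- At each end the coherence of `α` with composition relates the naturality isomorphism at `g ≫ fᵢ`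
to those at `g` and `fᵢ`; in the middle `α` is natural along `g`. Every later compatibility of
projections, descent data and automorphism groups with restriction goes back to this. -/
theorem pullHom_homMap {X₁ X₂ Y : C} {M₁ : F.obj ⟨op X₁⟩} {M₂ : F.obj ⟨op X₂⟩}
    {f₁ : Y ⟶ X₁} {f₂ : Y ⟶ X₂}
    (φ : (F.map f₁.op.toLoc).toFunctor.obj M₁ ⟶ (F.map f₂.op.toLoc).toFunctor.obj M₂) {Y' : C}
    (g : Y' ⟶ Y) (gf₁ : Y' ⟶ X₁) (gf₂ : Y' ⟶ X₂) (h₁ : g ≫ f₁ = gf₁) (h₂ : g ≫ f₂ = gf₂) :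
    pullHom (homMap α φ) g gf₁ gf₂ h₁ h₂ = homMap α (pullHom φ g gf₁ gf₂ h₁ h₂) := by
  unfold pullHom homMap
  rw [Functor.map_comp, Functor.map_comp, Functor.map_comp, Functor.map_comp]
  exact comp_conj_comp
    (trans_comp' α f₁.op.toLoc g.op.toLoc gf₁.op.toLoc (by rw [← h₁]; rfl) M₁)
    (trans_comp' α f₂.op.toLoc g.op.toLoc gf₂.op.toLoc (by rw [← h₂]; rfl) M₂)
    (at2_naturality (α.naturality g.op.toLoc).hom φ)
    (map_at2_hom_inv (α.naturality f₁.op.toLoc) (K.map g.op.toLoc) M₁)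
    (at2_inv_hom _ _) (map_at2_inv_hom _ (α.app _) _) (at2_hom_inv _ _)

theorem homMap_id {X Y : C} (M : F.obj ⟨op X⟩) (f : Y ⟶ X) :
    homMap α (𝟙 ((F.map f.op.toLoc).toFunctor.obj M)) = 𝟙 _ := by
  unfold homMap
  rw [CategoryTheory.Functor.map_id]
  exact (congrArg (fun t => _ ≫ t) (Category.id_comp _)).trans (at2_inv_hom _ _)

theorem comp_conj {D : Type u₁} [Category.{v₁} D] {A₁ A₂ A₃ B₁ B₂ B₃ : D} {n₁ : B₁ ⟶ A₁}
    {n₂ : A₂ ⟶ B₂} {n₂' : B₂ ⟶ A₂} {n₃ : A₃ ⟶ B₃} {φ : A₁ ⟶ A₂} {ψ : A₂ ⟶ A₃}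
    (h : n₂ ≫ n₂' = 𝟙 _) : (n₁ ≫ φ ≫ n₂) ≫ n₂' ≫ ψ ≫ n₃ = n₁ ≫ (φ ≫ ψ) ≫ n₃ := by
  simp only [Category.assoc, reassoc_of% h]

theorem homMap_comp {X₁ X₂ X₃ Y : C} {M₁ : F.obj ⟨op X₁⟩} {M₂ : F.obj ⟨op X₂⟩}
    {M₃ : F.obj ⟨op X₃⟩} {f₁ : Y ⟶ X₁} {f₂ : Y ⟶ X₂} {f₃ : Y ⟶ X₃}
    (φ : (F.map f₁.op.toLoc).toFunctor.obj M₁ ⟶ (F.map f₂.op.toLoc).toFunctor.obj M₂)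
    (ψ : (F.map f₂.op.toLoc).toFunctor.obj M₂ ⟶ (F.map f₃.op.toLoc).toFunctor.obj M₃) :
    homMap α (φ ≫ ψ) = homMap α φ ≫ homMap α ψ := by
  unfold homMap
  rw [Functor.map_comp]
  exact (comp_conj (at2_hom_inv (α.naturality f₂.op.toLoc) M₂)).symm

theorem conj_of_comm {D : Type u₁} [Category.{v₁} D] {A₁ A₂ B₁ B₂ : D} {n₁ : A₁ ⟶ B₁}
    {n₁' : B₁ ⟶ A₁} {n₂ : A₂ ⟶ B₂} {ψ : A₁ ⟶ A₂} {χ : B₁ ⟶ B₂} (h : ψ ≫ n₂ = n₁ ≫ χ)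
    (hn : n₁' ≫ n₁ = 𝟙 _) : n₁' ≫ ψ ≫ n₂ = χ := by
  rw [h, reassoc_of% hn]

theorem conj_of_comm' {D : Type u₁} [Category.{v₁} D] {A₁ A₂ B₁ B₂ : D} {n₁ : A₁ ⟶ B₁}
    {n₂ : A₂ ⟶ B₂} {n₂' : B₂ ⟶ A₂} {ψ : A₁ ⟶ A₂} {χ : B₁ ⟶ B₂} (h : ψ ≫ n₂ = n₁ ≫ χ)
    (hn : n₂ ≫ n₂' = 𝟙 _) : n₁ ≫ χ ≫ n₂' = ψ := by
  rw [← reassoc_of% h, hn, Category.comp_id]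

theorem homMap_map {X Y : C} {M M' : F.obj ⟨op X⟩} (f : Y ⟶ X) (φ : M ⟶ M') :
    homMap α (f₁ := f) (f₂ := f) (M₁ := M) (M₂ := M') ((F.map f.op.toLoc).toFunctor.map φ) =
      (K.map f.op.toLoc).toFunctor.map ((α.app ⟨op X⟩).toFunctor.map φ) := by
  unfold homMap
  exact conj_of_comm (at2_naturality (α.naturality f.op.toLoc).hom φ) (at2_inv_hom _ _)

theorem pullHom_map {X Y : C} {M M' : F.obj ⟨op X⟩} (f : Y ⟶ X) (φ : M ⟶ M') {Y' : C}
    (g : Y' ⟶ Y) (gf : Y' ⟶ X) (h : g ≫ f = gf) :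
    pullHom (M₁ := M) (M₂ := M') (f₁ := f) (f₂ := f) ((F.map f.op.toLoc).toFunctor.map φ) g gf gf h h =
      (F.map gf.op.toLoc).toFunctor.map φ := by
  unfold pullHom
  exact conj_of_comm' (at2_naturality (F.mapComp' f.op.toLoc g.op.toLoc gf.op.toLoc
    (by rw [← h]; rfl)).hom φ) (at2_hom_inv _ _)

theorem pullHom_comp {X₁ X₂ X₃ Y : C} {M₁ : F.obj ⟨op X₁⟩} {M₂ : F.obj ⟨op X₂⟩}
    {M₃ : F.obj ⟨op X₃⟩} {f₁ : Y ⟶ X₁} {f₂ : Y ⟶ X₂} {f₃ : Y ⟶ X₃}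
    (φ : (F.map f₁.op.toLoc).toFunctor.obj M₁ ⟶ (F.map f₂.op.toLoc).toFunctor.obj M₂)
    (ψ : (F.map f₂.op.toLoc).toFunctor.obj M₂ ⟶ (F.map f₃.op.toLoc).toFunctor.obj M₃) {Y' : C}
    (g : Y' ⟶ Y) (gf₁ : Y' ⟶ X₁) (gf₂ : Y' ⟶ X₂) (gf₃ : Y' ⟶ X₃) (h₁ : g ≫ f₁ = gf₁)
    (h₂ : g ≫ f₂ = gf₂) (h₃ : g ≫ f₃ = gf₃) :
    pullHom (φ ≫ ψ) g gf₁ gf₃ h₁ h₃ = pullHom φ g gf₁ gf₂ h₁ h₂ ≫ pullHom ψ g gf₂ gf₃ h₂ h₃ := by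
  unfold pullHom
  rw [Functor.map_comp]
  exact (comp_conj (at2_inv_hom (F.mapComp' f₂.op.toLoc g.op.toLoc gf₂.op.toLoc _) M₂)).symm

theorem mapAut_hom {U : C} (x : F.obj ⟨op U⟩) (T : Over U) (φ : AutOver F x T) :
    (mapAut α x T φ).hom = homMap α φ.hom := rfl

end HomMap

/-! ### Morphisms between pullbacks of objects of a fibre product. -/

section FibreProductHom

variable (α : StrongTrans F K) (β : StrongTrans F' K)

/-- The projection commutes strictly with pullback functors, so the conjugation in `homMap` is by
identities. -/
theorem homMap_fstTrans {X₁ X₂ Y : C} {M₁ : (fibreProduct α β).obj ⟨op X₁⟩}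
    {M₂ : (fibreProduct α β).obj ⟨op X₂⟩} {f₁ : Y ⟶ X₁} {f₂ : Y ⟶ X₂}
    (φ : ((fibreProduct α β).map f₁.op.toLoc).toFunctor.obj M₁ ⟶
      ((fibreProduct α β).map f₂.op.toLoc).toFunctor.obj M₂) :
    homMap (fstTrans α β) φ = Limits.CategoricalPullback.Hom.fst φ :=
  (Category.id_comp _).trans (Category.comp_id _)

theorem homMap_sndTrans {X₁ X₂ Y : C} {M₁ : (fibreProduct α β).obj ⟨op X₁⟩}
    {M₂ : (fibreProduct α β).obj ⟨op X₂⟩} {f₁ : Y ⟶ X₁} {f₂ : Y ⟶ X₂}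
    (φ : ((fibreProduct α β).map f₁.op.toLoc).toFunctor.obj M₁ ⟶
      ((fibreProduct α β).map f₂.op.toLoc).toFunctor.obj M₂) :
    homMap (sndTrans α β) φ = Limits.CategoricalPullback.Hom.snd φ :=
  (Category.id_comp _).trans (Category.comp_id _)

/-- Since taking components is `homMap` of a projection, the general `pullHom_homMap` applies and
the comparison isomorphisms of the fibre product need not be unfolded. -/
theorem fst_pullHom {X₁ X₂ Y : C} {M₁ : (fibreProduct α β).obj ⟨op X₁⟩}
    {M₂ : (fibreProduct α β).obj ⟨op X₂⟩} {f₁ : Y ⟶ X₁} {f₂ : Y ⟶ X₂}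
    (φ : ((fibreProduct α β).map f₁.op.toLoc).toFunctor.obj M₁ ⟶
      ((fibreProduct α β).map f₂.op.toLoc).toFunctor.obj M₂) {Y' : C}
    (g : Y' ⟶ Y) (gf₁ : Y' ⟶ X₁) (gf₂ : Y' ⟶ X₂) (h₁ : g ≫ f₁ = gf₁) (h₂ : g ≫ f₂ = gf₂) :
    Limits.CategoricalPullback.Hom.fst (pullHom φ g gf₁ gf₂ h₁ h₂) =
      pullHom (F := F) (M₁ := M₁.fst) (M₂ := M₂.fst) (Limits.CategoricalPullback.Hom.fst φ)
        g gf₁ gf₂ h₁ h₂ := by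
  rw [← homMap_fstTrans, ← pullHom_homMap, homMap_fstTrans]
  rfl

theorem snd_pullHom {X₁ X₂ Y : C} {M₁ : (fibreProduct α β).obj ⟨op X₁⟩}
    {M₂ : (fibreProduct α β).obj ⟨op X₂⟩} {f₁ : Y ⟶ X₁} {f₂ : Y ⟶ X₂}
    (φ : ((fibreProduct α β).map f₁.op.toLoc).toFunctor.obj M₁ ⟶
      ((fibreProduct α β).map f₂.op.toLoc).toFunctor.obj M₂) {Y' : C}
    (g : Y' ⟶ Y) (gf₁ : Y' ⟶ X₁) (gf₂ : Y' ⟶ X₂) (h₁ : g ≫ f₁ = gf₁) (h₂ : g ≫ f₂ = gf₂) :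
    Limits.CategoricalPullback.Hom.snd (pullHom φ g gf₁ gf₂ h₁ h₂) =
      pullHom (F := F') (M₁ := M₁.snd) (M₂ := M₂.snd) (Limits.CategoricalPullback.Hom.snd φ)
        g gf₁ gf₂ h₁ h₂ := by
  rw [← homMap_sndTrans, ← pullHom_homMap, homMap_sndTrans]
  rfl

/-- The compatibility of the components of a morphism of pullbacks of triples. -/
theorem fibre_w_iff {X₁ X₂ Y : C} {M₁ : (fibreProduct α β).obj ⟨op X₁⟩}
    {M₂ : (fibreProduct α β).obj ⟨op X₂⟩} {f₁ : Y ⟶ X₁} {f₂ : Y ⟶ X₂}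
    (φ : (F.map f₁.op.toLoc).toFunctor.obj M₁.fst ⟶ (F.map f₂.op.toLoc).toFunctor.obj M₂.fst)
    (ψ : (F'.map f₁.op.toLoc).toFunctor.obj M₁.snd ⟶ (F'.map f₂.op.toLoc).toFunctor.obj M₂.snd) :
    (α.app ⟨op Y⟩).toFunctor.map φ ≫ (fibreObj α β f₂.op.toLoc M₂).iso.hom =
      (fibreObj α β f₁.op.toLoc M₁).iso.hom ≫ (β.app ⟨op Y⟩).toFunctor.map ψ ↔
    homMap α φ ≫ (K.map f₂.op.toLoc).toFunctor.map M₂.iso.hom =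
      (K.map f₁.op.toLoc).toFunctor.map M₁.iso.hom ≫ homMap β ψ := by
  -- The structure isomorphism of a pulled-back triple is conjugated by the naturality isomorphisms
  -- of `α` and `β`; moving them to the outer sides turns one square into the other.
  have aux : ∀ {D : Cat.{max u v, max (u + 1) (v + 1)}} {A₁ A₂ B₁ B₂ C₁ C₂ E₁ E₂ : D}
      (a : A₁ ≅ B₁) (b : A₂ ≅ B₂) (c : C₁ ≅ E₁) (d : C₂ ≅ E₂) (m : A₁ ⟶ A₂) (n : C₁ ⟶ C₂)
      (p : B₁ ⟶ E₁) (q : B₂ ⟶ E₂),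
      m ≫ b.hom ≫ q ≫ d.inv = (a.hom ≫ p ≫ c.inv) ≫ n ↔
        (a.inv ≫ m ≫ b.hom) ≫ q = p ≫ c.inv ≫ n ≫ d.hom := by
    intro D A₁ A₂ B₁ B₂ C₁ C₂ E₁ E₂ a b c d m n p q
    rw [← cancel_epi a.inv, ← cancel_mono d.hom]
    simp
  exact aux (iso2 (α.naturality f₁.op.toLoc) M₁.fst) (iso2 (α.naturality f₂.op.toLoc) M₂.fst)
    (iso2 (β.naturality f₁.op.toLoc) M₁.snd) (iso2 (β.naturality f₂.op.toLoc) M₂.snd) _ _ _ _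

/-- A morphism of pullbacks of triples from its components. -/
def fibreHomMk {X₁ X₂ Y : C} {M₁ : (fibreProduct α β).obj ⟨op X₁⟩}
    {M₂ : (fibreProduct α β).obj ⟨op X₂⟩} {f₁ : Y ⟶ X₁} {f₂ : Y ⟶ X₂}
    (φ : (F.map f₁.op.toLoc).toFunctor.obj M₁.fst ⟶ (F.map f₂.op.toLoc).toFunctor.obj M₂.fst)
    (ψ : (F'.map f₁.op.toLoc).toFunctor.obj M₁.snd ⟶ (F'.map f₂.op.toLoc).toFunctor.obj M₂.snd)
    (h : homMap α φ ≫ (K.map f₂.op.toLoc).toFunctor.map M₂.iso.hom =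
      (K.map f₁.op.toLoc).toFunctor.map M₁.iso.hom ≫ homMap β ψ) :
    ((fibreProduct α β).map f₁.op.toLoc).toFunctor.obj M₁ ⟶
      ((fibreProduct α β).map f₂.op.toLoc).toFunctor.obj M₂ :=
  Limits.CategoricalPullback.Hom.mk (x := fibreObj α β f₁.op.toLoc M₁)
    (y := fibreObj α β f₂.op.toLoc M₂) φ ψ ((fibre_w_iff α β φ ψ).2 h)

theorem fibreHom_w {X₁ X₂ Y : C} {M₁ : (fibreProduct α β).obj ⟨op X₁⟩}
    {M₂ : (fibreProduct α β).obj ⟨op X₂⟩} {f₁ : Y ⟶ X₁} {f₂ : Y ⟶ X₂}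
    (φ : ((fibreProduct α β).map f₁.op.toLoc).toFunctor.obj M₁ ⟶
      ((fibreProduct α β).map f₂.op.toLoc).toFunctor.obj M₂) :
    homMap α (M₁ := M₁.fst) (M₂ := M₂.fst) (Limits.CategoricalPullback.Hom.fst φ) ≫
        (K.map f₂.op.toLoc).toFunctor.map M₂.iso.hom =
      (K.map f₁.op.toLoc).toFunctor.map M₁.iso.hom ≫
        homMap β (M₁ := M₁.snd) (M₂ := M₂.snd) (Limits.CategoricalPullback.Hom.snd φ) :=
  (fibre_w_iff α β _ _).1 (Limits.CategoricalPullback.Hom.w φ)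

theorem fibreHom_ext {X₁ X₂ Y : C} {M₁ : (fibreProduct α β).obj ⟨op X₁⟩}
    {M₂ : (fibreProduct α β).obj ⟨op X₂⟩} {f₁ : Y ⟶ X₁} {f₂ : Y ⟶ X₂}
    {φ ψ : ((fibreProduct α β).map f₁.op.toLoc).toFunctor.obj M₁ ⟶
      ((fibreProduct α β).map f₂.op.toLoc).toFunctor.obj M₂}
    (h₁ : Limits.CategoricalPullback.Hom.fst φ = Limits.CategoricalPullback.Hom.fst ψ)
    (h₂ : Limits.CategoricalPullback.Hom.snd φ = Limits.CategoricalPullback.Hom.snd ψ) : φ = ψ :=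
  Limits.CategoricalPullback.hom_ext h₁ h₂

end FibreProductHom

end Fibred

/-! ### Prestacks, and the fibre product of prestacks. -/

namespace Fibred

open Bicategory Pseudofunctor LocallyDiscreteOpToCat Limits

variable {F F' K : Fibred C}

section Prestack

/-- Gluing of morphisms in a prestack. -/
theorem hom_glue [F.IsPrestack J] {U : C} (M N : F.obj ⟨op U⟩) {T : Over U} {R : Sieve T}
    (hR : R ∈ J.over U T)
    (φ : ∀ ⦃T' : Over U⦄ (k : T' ⟶ T), R k →
      ((F.map T'.hom.op.toLoc).toFunctor.obj M ⟶ (F.map T'.hom.op.toLoc).toFunctor.obj N))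
    (hφ : ∀ ⦃T' T'' : Over U⦄ (k : T' ⟶ T) (l : T'' ⟶ T') (hk : R k),
      pullHom (φ k hk) l.left T''.hom T''.hom (Over.w l) (Over.w l) =
        φ (l ≫ k) (R.downward_closed hk l)) :
    ∃ ψ : (F.map T.hom.op.toLoc).toFunctor.obj M ⟶ (F.map T.hom.op.toLoc).toFunctor.obj N,
      ∀ ⦃T' : Over U⦄ (k : T' ⟶ T) (hk : R k),
        pullHom ψ k.left T'.hom T'.hom (Over.w k) (Over.w k) = φ k hk :=
  sec_glue (F.sheafHom J M N) hR φ hφ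

theorem hom_sep [F.IsPrestack J] {U : C} (M N : F.obj ⟨op U⟩) {T : Over U} {R : Sieve T}
    (hR : R ∈ J.over U T)
    {φ ψ : (F.map T.hom.op.toLoc).toFunctor.obj M ⟶ (F.map T.hom.op.toLoc).toFunctor.obj N}
    (h : ∀ ⦃T' : Over U⦄ (k : T' ⟶ T), R k →
        pullHom φ k.left T'.hom T'.hom (Over.w k) (Over.w k) =
          pullHom ψ k.left T'.hom T'.hom (Over.w k) (Over.w k)) : φ = ψ :=
  sec_ext (F.sheafHom J M N) hR h

/-- A fibred category whose morphisms are determined locally and can be glued is a prestack. -/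
theorem isPrestack_of_glue
    (hsep : ∀ {U : C} (M N : F.obj ⟨op U⟩) {T : Over U} {R : Sieve T}, R ∈ J.over U T →
      ∀ φ ψ : (F.map T.hom.op.toLoc).toFunctor.obj M ⟶ (F.map T.hom.op.toLoc).toFunctor.obj N,
      (∀ ⦃T' : Over U⦄ (k : T' ⟶ T), R k →
        pullHom φ k.left T'.hom T'.hom (Over.w k) (Over.w k) =
          pullHom ψ k.left T'.hom T'.hom (Over.w k) (Over.w k)) → φ = ψ)
    (hglue : ∀ {U : C} (M N : F.obj ⟨op U⟩) {T : Over U} {R : Sieve T}, R ∈ J.over U T →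
      ∀ φ : (∀ ⦃T' : Over U⦄ (k : T' ⟶ T), R k →
        ((F.map T'.hom.op.toLoc).toFunctor.obj M ⟶ (F.map T'.hom.op.toLoc).toFunctor.obj N)),
      (∀ ⦃T' T'' : Over U⦄ (k : T' ⟶ T) (l : T'' ⟶ T') (hk : R k),
        pullHom (φ k hk) l.left T''.hom T''.hom (Over.w l) (Over.w l) =
          φ (l ≫ k) (R.downward_closed hk l)) →
      ∃ ψ : (F.map T.hom.op.toLoc).toFunctor.obj M ⟶ (F.map T.hom.op.toLoc).toFunctor.obj N,
        ∀ ⦃T' : Over U⦄ (k : T' ⟶ T) (hk : R k),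
          pullHom ψ k.left T'.hom T'.hom (Over.w k) (Over.w k) = φ k hk) :
    F.IsPrestack J where
  isSheaf {U} M N := by
    rw [isSheaf_iff_isSheaf_of_type]
    intro T R hR x hx
    obtain ⟨t, ht⟩ := hglue M N hR (fun V f hf => x f hf) (fun V W f g hf => by
      have := hx g (𝟙 W) hf (R.downward_closed hf g) (by simp)
      refine Eq.trans this ?_
      exact pullHom_id _)
    refine ⟨t, fun V f hf => ht f hf, fun t' ht' => hsep M N hR _ _ fun V f hf => ?_⟩
    exact (ht' f hf).trans (ht f hf).symm

end Prestack

section FibrePrestack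

variable (α : StrongTrans F K) (β : StrongTrans F' K)

/-- A morphism of triples is a pair of morphisms subject to an equation in `K`. The pair is glued in
`F` and `F'`; the equation holds because it holds locally and morphisms in `K` are separated. -/
theorem isPrestack_fibreProduct [F.IsPrestack J] [F'.IsPrestack J] [K.IsPrestack J] :
    (fibreProduct α β).IsPrestack J := by
  refine isPrestack_of_glue (fun M N T R hR φ ψ h => fibreHom_ext α β ?_ ?_)
    (fun M N T R hR φ hφ => ?_)
  · refine hom_sep (F := F) M.fst N.fst hR fun T' k hk => ?_
    rw [← fst_pullHom, ← fst_pullHom, h k hk]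
  · refine hom_sep (F := F') M.snd N.snd hR fun T' k hk => ?_
    rw [← snd_pullHom, ← snd_pullHom, h k hk]
  · obtain ⟨a, ha⟩ := hom_glue (F := F) M.fst N.fst hR
      (fun T' k hk => CategoricalPullback.Hom.fst (φ k hk)) (fun T' T'' k l hk => by
        rw [← hφ k l hk, fst_pullHom])
    obtain ⟨b, hb⟩ := hom_glue (F := F') M.snd N.snd hR
      (fun T' k hk => CategoricalPullback.Hom.snd (φ k hk)) (fun T' T'' k l hk => by
        rw [← hφ k l hk, snd_pullHom])
    refine ⟨fibreHomMk α β a b (hom_sep (F := K) ((α.app _).toFunctor.obj M.fst)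
      ((β.app _).toFunctor.obj N.snd) hR fun T' k hk => ?_), fun T' k hk => ?_⟩
    -- Pulling back both sides of the equation in `K` yields the same equation for `φ k`, which
    -- holds because `φ k` is a morphism of triples.
    · rw [pullHom_comp _ _ _ _ T'.hom _ _ (Over.w k), pullHom_comp _ _ _ _ T'.hom _ _ (Over.w k),
        pullHom_homMap, pullHom_homMap, ha k hk, hb k hk, pullHom_map, pullHom_map]
      exact fibreHom_w α β (φ k hk)
    · refine fibreHom_ext α β ?_ ?_
      · rw [fst_pullHom]
        exact ha k hk
      · rw [snd_pullHom]
        exact hb k hk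

end FibrePrestack

/-! ### Descent data, and effectivity of descent in a fibre product. -/

section Descent

variable {S : C} {ι : Type w} {X : ι → C} {f : ∀ i, X i ⟶ S}

/-- The image of a descent datum under a morphism of fibred categories. -/
def mapDescent (α : StrongTrans F K) (D : F.DescentData f) : K.DescentData f where
  obj i := (α.app ⟨op (X i)⟩).toFunctor.obj (D.obj i)
  hom _ q _ _ f₁ f₂ h₁ h₂ := homMap α (D.hom q f₁ f₂ h₁ h₂)
  pullHom_hom Y' Y g q q' hq i₁ i₂ f₁ f₂ h₁ h₂ gf₁ gf₂ hg₁ hg₂ := by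
    rw [pullHom_homMap, D.pullHom_hom g q q' hq f₁ f₂ h₁ h₂ gf₁ gf₂ hg₁ hg₂]
  hom_self Y q i g hg := by rw [D.hom_self q g hg, homMap_id]
  hom_comp Y q i₁ i₂ i₃ f₁ f₂ f₃ h₁ h₂ h₃ := by rw [← homMap_comp, D.hom_comp]

/-- The image of an isomorphism of descent data. -/
def mapDescentIso (α : StrongTrans F K) {D D' : F.DescentData f} (e : D ≅ D') :
    mapDescent α D ≅ mapDescent α D' :=
  DescentData.isoMk (fun i => (α.app ⟨op (X i)⟩).toFunctor.mapIso
    ⟨e.hom.hom i, e.inv.hom i, congrArg (fun t => DescentData.Hom.hom t i) e.hom_inv_id,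
      congrArg (fun t => DescentData.Hom.hom t i) e.inv_hom_id⟩) (fun Y q i₁ i₂ f₁ f₂ h₁ h₂ => by
    have h := congrArg (fun t => homMap α t) (e.hom.comm q f₁ f₂ h₁ h₂)
    refine (congrArg (fun t => t ≫ _) (homMap_map α f₁ (e.hom.hom i₁)).symm).trans ?_
    refine Eq.trans ?_ (congrArg (fun t => _ ≫ t) (homMap_map α f₂ (e.hom.hom i₂)))
    exact (homMap_comp α _ _).symm.trans (h.trans (homMap_comp α _ _)))

/-- The transition map of the descent datum of a pullback is an inverse comparison followed by a
comparison. Both coherence relations share the naturality isomorphism `n` at the composite arrow,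
which cancels in the middle. This serves `mapDescentOfObj`. -/
theorem comp_conj_inv {D : Type u₁} [Category.{v₁} D] {A B₁ B₂ E₁ E₂ H₁ H₂ Z : D}
    {n : Z ⟶ A} {n' : A ⟶ Z} {m₁ : A ⟶ B₁} {m₁' : B₁ ⟶ A} {c₁ : Z ⟶ E₁} {c₁' : E₁ ⟶ Z}
    {p₁ : E₁ ⟶ H₁} {p₁' : H₁ ⟶ E₁} {s₁ : H₁ ⟶ B₁} {s₁' : B₁ ⟶ H₁}
    {m₂ : A ⟶ B₂} {c₂ : Z ⟶ E₂} {p₂ : E₂ ⟶ H₂} {s₂ : H₂ ⟶ B₂} {s₂' : B₂ ⟶ H₂}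
    (h₁ : n ≫ m₁ = c₁ ≫ p₁ ≫ s₁) (h₂ : n ≫ m₂ = c₂ ≫ p₂ ≫ s₂)
    (hn : n ≫ n' = 𝟙 _) (hn' : n' ≫ n = 𝟙 _) (hm : m₁ ≫ m₁' = 𝟙 _)
    (hc' : c₁' ≫ c₁ = 𝟙 _) (hp' : p₁' ≫ p₁ = 𝟙 _) (hs' : s₁' ≫ s₁ = 𝟙 _)
    (ht : s₂ ≫ s₂' = 𝟙 _) :
    s₁' ≫ p₁' ≫ (c₁' ≫ c₂) ≫ p₂ = (m₁' ≫ m₂) ≫ s₂' := by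
  have e₁ : m₁' ≫ n' = s₁' ≫ p₁' ≫ c₁' := by
    have : (s₁' ≫ p₁' ≫ c₁') ≫ (n ≫ m₁) = 𝟙 _ := by
      rw [h₁]
      simp only [Category.assoc, reassoc_of% hc', reassoc_of% hp', hs']
    have e : (s₁' ≫ p₁' ≫ c₁') ≫ n = m₁' := by
      rw [← Category.comp_id (_ ≫ n), ← hm, ← Category.assoc, Category.assoc _ n m₁, this,
        Category.id_comp]
    rw [← e, Category.assoc, hn, Category.comp_id]
  have e₂ : m₂ = n' ≫ c₂ ≫ p₂ ≫ s₂ := by rw [← h₂, reassoc_of% hn']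
  rw [e₂]
  simp only [Category.assoc, ht, Category.comp_id]
  rw [reassoc_of% e₁]

/-- Descent data of pullbacks are compatible with morphisms of fibred categories. -/
def mapDescentOfObj (α : StrongTrans F K) (x : F.obj ⟨op S⟩) :
    DescentData.ofObj (F := K) (f := f) ((α.app ⟨op S⟩).toFunctor.obj x) ≅
      mapDescent α (DescentData.ofObj x) :=
  DescentData.isoMk (fun i => (iso2 (α.naturality (f i).op.toLoc) x).symm)
    (fun Y q i₁ i₂ f₁ f₂ h₁ h₂ => by
      have k₁ := trans_comp' α (f i₁).op.toLoc f₁.op.toLoc q.op.toLoc (by rw [← h₁]; rfl) x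
      have k₂ := trans_comp' α (f i₂).op.toLoc f₂.op.toLoc q.op.toLoc (by rw [← h₂]; rfl) x
      change _ ≫ at2 (α.naturality f₁.op.toLoc).inv _ ≫ (α.app ⟨op Y⟩).toFunctor.map
        (at2 (F.mapComp' (f i₁).op.toLoc f₁.op.toLoc q.op.toLoc _).inv x ≫
          at2 (F.mapComp' (f i₂).op.toLoc f₂.op.toLoc q.op.toLoc _).hom x) ≫
            at2 (α.naturality f₂.op.toLoc).hom _ = _
      rw [Functor.map_comp]
      exact comp_conj_inv k₁ k₂ (at2_hom_inv _ _) (at2_inv_hom _ _) (at2_hom_inv _ _)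
        (map_at2_inv_hom _ (α.app _) _) (at2_inv_hom _ _)
        (map_at2_inv_hom _ (K.map f₁.op.toLoc) _) (map_at2_hom_inv _ (K.map f₂.op.toLoc) _))

variable (α : StrongTrans F K) (β : StrongTrans F' K)

theorem fst_mapComp' {a b c : LocallyDiscrete Cᵒᵖ} (f : a ⟶ b) (g : b ⟶ c) (fg : a ⟶ c)
    (h : f ≫ g = fg) (x : (fibreProduct α β).obj a) :
    CategoricalPullback.Hom.fst (at2 ((fibreProduct α β).mapComp' f g fg h).hom x) =
        at2 (F.mapComp' f g fg h).hom x.fst ∧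
      CategoricalPullback.Hom.fst (at2 ((fibreProduct α β).mapComp' f g fg h).inv x) =
        at2 (F.mapComp' f g fg h).inv x.fst := by
  subst h
  simp only [mapComp'_eq_mapComp]
  exact ⟨rfl, rfl⟩

theorem snd_mapComp' {a b c : LocallyDiscrete Cᵒᵖ} (f : a ⟶ b) (g : b ⟶ c) (fg : a ⟶ c)
    (h : f ≫ g = fg) (x : (fibreProduct α β).obj a) :
    CategoricalPullback.Hom.snd (at2 ((fibreProduct α β).mapComp' f g fg h).hom x) =
        at2 (F'.mapComp' f g fg h).hom x.snd ∧
      CategoricalPullback.Hom.snd (at2 ((fibreProduct α β).mapComp' f g fg h).inv x) =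
        at2 (F'.mapComp' f g fg h).inv x.snd := by
  subst h
  simp only [mapComp'_eq_mapComp]
  exact ⟨rfl, rfl⟩

/-- Here `k` is the pullback of the isomorphism obtained by descent in `K`, written as a chain. The
outer terms `n'` and `m` cancel against the naturality isomorphisms built into the pulled-back
triple, and `b'` cancels against the second component of the comparison. -/
theorem comp_cancel_outer {D : Type u₁} [Category.{v₁} D] {A A' E E' H H' : D} {n : A ⟶ A'}
    {n' : A' ⟶ A} {a : A ⟶ E} {d : E ⟶ E'} {b : H ⟶ E'} {b' : E' ⟶ H} {m : H ⟶ H'} {m' : H' ⟶ H}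
    {k : A' ⟶ H'} (hk : k = n' ≫ a ≫ d ≫ b' ≫ m) (hn : n ≫ n' = 𝟙 _) (hm : m ≫ m' = 𝟙 _)
    (hb : b' ≫ b = 𝟙 _) : a ≫ d = (n ≫ k ≫ m') ≫ b := by
  rw [hk]
  simp only [Category.assoc, reassoc_of% hn, reassoc_of% hm, hb, Category.comp_id]

/-- The isomorphism between the images of the two projections of a descent datum. -/
def fibreDescentIso (D : (fibreProduct α β).DescentData f) :
    mapDescent α (mapDescent (fstTrans α β) D) ≅ mapDescent β (mapDescent (sndTrans α β) D) :=
  DescentData.isoMk (fun i => CategoricalPullback.iso (D.obj i)) (fun Y q i₁ i₂ f₁ f₂ h₁ h₂ => by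
    have h := fibreHom_w α β (D.hom q f₁ f₂ h₁ h₂)
    rw [← homMap_fstTrans, ← homMap_sndTrans] at h
    exact h.symm)

/-- The two projections of a descent datum are effective in `F` and `F'`, giving `x` and `y`. The
structure isomorphisms of the datum form an isomorphism between the descent data of `α x` and `β y`,
and full faithfulness in `K` lifts it to the missing third component `α x ≅ β y`. -/
theorem essSurj_fibreProduct
    [(F.toDescentData f).EssSurj] [(F'.toDescentData f).EssSurj] (hK : (K.toDescentData f).FullyFaithful) :
    ((fibreProduct α β).toDescentData f).EssSurj where
  mem_essImage D := by
    let x := (F.toDescentData f).objPreimage (mapDescent (fstTrans α β) D)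
    let e : DescentData.ofObj x ≅ _ :=
      (F.toDescentData f).objObjPreimageIso (mapDescent (fstTrans α β) D)
    let y := (F'.toDescentData f).objPreimage (mapDescent (sndTrans α β) D)
    let e' : DescentData.ofObj y ≅ _ :=
      (F'.toDescentData f).objObjPreimageIso (mapDescent (sndTrans α β) D)
    -- The chain runs from `α x` to the image of the first projection of `D`, crosses over by the
    -- structure isomorphisms of `D`, and returns to `β y`.
    let t : DescentData.ofObj ((α.app ⟨op S⟩).toFunctor.obj x) ≅
        DescentData.ofObj ((β.app ⟨op S⟩).toFunctor.obj y) :=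
      mapDescentOfObj α x ≪≫ mapDescentIso α e ≪≫ fibreDescentIso α β D ≪≫
        (mapDescentIso β e').symm ≪≫ (mapDescentOfObj β y).symm
    let z : (fibreProduct α β).obj ⟨op S⟩ :=
      { fst := x, snd := y, iso := hK.preimageIso t }
    have hz : ∀ i, (K.map (f i).op.toLoc).toFunctor.map (CategoricalPullback.iso z).hom =
        t.hom.hom i := fun i =>
      congrArg (fun s => DescentData.Hom.hom s i) (hK.map_preimage t.hom)
    refine ⟨z, ⟨DescentData.isoMk (fun i => CategoricalPullback.mkIso
      (x := fibreObj α β (f i).op.toLoc z) (y := D.obj i)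
      ⟨e.hom.hom i, e.inv.hom i, congrArg (fun t => DescentData.Hom.hom t i) e.hom_inv_id,
        congrArg (fun t => DescentData.Hom.hom t i) e.inv_hom_id⟩
      ⟨e'.hom.hom i, e'.inv.hom i, congrArg (fun t => DescentData.Hom.hom t i) e'.hom_inv_id,
        congrArg (fun t => DescentData.Hom.hom t i) e'.inv_hom_id⟩ ?_) ?_⟩⟩
    -- The components of `e` and `e'` respect the third components because the lifted isomorphism
    -- restricts to `t` on each member of the family.
    · refine comp_cancel_outer (hz i) (at2_hom_inv _ _) (at2_hom_inv _ _) ?_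
      refine ((β.app _).toFunctor.map_comp _ _).symm.trans ?_
      refine (congrArg (fun t => (β.app _).toFunctor.map t)
        (congrArg (fun t => DescentData.Hom.hom t i) e'.inv_hom_id)).trans ?_
      exact CategoryTheory.Functor.map_id _ _
    · intro Y q i₁ i₂ f₁ f₂ h₁ h₂
      refine fibreHom_ext α β ?_ ?_
      · have h := e.hom.comm q f₁ f₂ h₁ h₂
        refine Eq.trans ?_ (h.trans ?_)
        · exact congrArg (fun t => (F.map f₁.op.toLoc).toFunctor.map (e.hom.hom i₁) ≫ t)
            (homMap_fstTrans α β (D.hom q f₁ f₂ h₁ h₂)).symm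
        · refine congrArg (fun t => t ≫ (F.map f₂.op.toLoc).toFunctor.map (e.hom.hom i₂)) ?_
          exact congrArg₂ (fun s t => s ≫ t) (fst_mapComp' α β _ _ _ _ z).2.symm
            (fst_mapComp' α β _ _ _ _ z).1.symm
      · have h := e'.hom.comm q f₁ f₂ h₁ h₂
        refine Eq.trans ?_ (h.trans ?_)
        · exact congrArg (fun t => (F'.map f₁.op.toLoc).toFunctor.map (e'.hom.hom i₁) ≫ t)
            (homMap_sndTrans α β (D.hom q f₁ f₂ h₁ h₂)).symm
        · refine congrArg (fun t => t ≫ (F'.map f₂.op.toLoc).toFunctor.map (e'.hom.hom i₂)) ?_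
          exact congrArg₂ (fun s t => s ≫ t) (snd_mapComp' α β _ _ _ _ z).2.symm
            (snd_mapComp' α β _ _ _ _ z).1.symm

end Descent

/-- Only the morphisms of `K` have to descend, since `K` contributes an isomorphism and no new
object; hence a prestack suffices there. -/
theorem isStack_fibreProduct (α : StrongTrans F K) (β : StrongTrans F' K) [F.IsStack J]
    [F'.IsStack J] [K.IsPrestack J] : (fibreProduct α β).IsStack J where
  toIsPrestack := isPrestack_fibreProduct α β
  essSurj_of_sieve {S} R hR := by
    have := IsStack.essSurj_of_sieve F R hR
    have := IsStack.essSurj_of_sieve F' R hR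
    refine essSurj_fibreProduct α β ?_
    exact (K.isPrestackFor' R hR).fullyFaithful

end Fibred

/-! ### Sections of torsors indexed by arrows of the base, and values of morphisms. -/

namespace Torsor

open Bicategory Pseudofunctor LocallyDiscreteOpToCat Fibred

variable {G : GroupSheaf J}

section Sections

variable {U : C} (P : Torsor G U)

/-- Restriction of sections along `l : W' ⟶ W`, with sections indexed by arrows to `U`. -/
def rr {W' W : C} {a : W ⟶ U} {a' : W' ⟶ U} (l : W' ⟶ W) (h : l ≫ a = a')
    (p : P.sec (Over.mk a)) : P.sec (Over.mk a') :=
  P.res (Over.homMk l h : Over.mk a' ⟶ Over.mk a) p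

theorem rr_id {W : C} {a : W ⟶ U} (h : 𝟙 W ≫ a = a) (p : P.sec (Over.mk a)) :
    P.rr (𝟙 W) h p = p :=
  rs_id P.sheaf p

theorem rr_rr {W'' W' W : C} {a : W ⟶ U} {a' : W' ⟶ U} {a'' : W'' ⟶ U} (l : W' ⟶ W)
    (h : l ≫ a = a') (l' : W'' ⟶ W') (h' : l' ≫ a' = a'') (p : P.sec (Over.mk a)) :
    P.rr l' h' (P.rr l h p) = P.rr (l' ≫ l) (by rw [Category.assoc, h, h']) p :=
  P.res_res _ _ p

theorem rr_act {W' W : C} {a : W ⟶ U} {a' : W' ⟶ U} (l : W' ⟶ W) (h : l ≫ a = a')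
    (p : P.sec (Over.mk a)) (g : G.sec W) :
    P.rr l h (P.act (T := Over.mk a) p g) = P.act (T := Over.mk a') (P.rr l h p) (G.res l g) :=
  P.rs_act _ _ _

/-- Covering sieves of `Over.mk a` correspond to covering sieves of its source, so the sheaf
condition on `C/U` can be tested with arrows of `C`. -/
theorem rr_sep {W : C} {a : W ⟶ U} {R : Sieve W} (hR : R ∈ J W) {p q : P.sec (Over.mk a)}
    (h : ∀ ⦃W' : C⦄ (l : W' ⟶ W), R l → P.rr l rfl p = P.rr l rfl q) : p = q := by
  refine ButterflyGerbe.sec_ext P.sheaf (R := (Sieve.overEquiv (Over.mk a)).symm R) ?_ ?_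
  · rw [GrothendieckTopology.mem_over_iff]
    simpa using hR
  · intro T k hk
    have e := h k.left ((Sieve.overEquiv_symm_iff R k).1 hk)
    have hk' : k.left ≫ a = T.hom := Over.w k
    change P.res k p = P.res k q
    -- An arbitrary arrow `k` to `Over.mk a` differs from the one determined by `k.left` only in the
    -- name of the structure arrow of its source; a restriction along an identity accounts for it.
    have e' : ∀ p : P.sec (Over.mk a),
        P.rr (a := k.left ≫ a) (𝟙 _) (by rw [hk', Category.id_comp]) (P.rr k.left rfl p) =
        P.res (T' := T) k p := fun p => by
      rw [rr_rr]
      refine congrArg (fun t => P.res t p) ?_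
      ext
      simp
    rw [← e', ← e', e]

theorem rr_glue {W : C} (a : W ⟶ U) {R : Sieve W} (hR : R ∈ J W)
    (s : ∀ ⦃W' : C⦄ (l : W' ⟶ W), R l → P.sec (Over.mk (l ≫ a)))
    (hs : ∀ ⦃W' W'' : C⦄ (l : W' ⟶ W) (k : W'' ⟶ W') (hl : R l),
      P.rr k (Category.assoc _ _ _).symm (s l hl) = s (k ≫ l) (R.downward_closed hl k)) :
    ∃ p : P.sec (Over.mk a), ∀ ⦃W' : C⦄ (l : W' ⟶ W) (hl : R l), P.rr l rfl p = s l hl := by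
  obtain ⟨p, hp⟩ := ButterflyGerbe.sec_glue P.sheaf (X := Over.mk a)
    (R := (Sieve.overEquiv (Over.mk a)).symm R) (by
      rw [GrothendieckTopology.mem_over_iff]
      simpa using hR)
    -- The given family is defined only over arrows of the form `l ≫ a`; restriction along an
    -- identity extends it to arrows with a merely equal structure arrow.
    (fun T k hk => P.rr (a := k.left ≫ a) (a' := T.hom) (𝟙 _)
        (by rw [Category.id_comp]; exact Over.w k)
      (s k.left ((Sieve.overEquiv_symm_iff R k).1 hk)))
    (fun T T' k l hk => by
      change P.rr (a := T.hom) (a' := T'.hom) l.left (Over.w l) _ = _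
      have := hs k.left l.left ((Sieve.overEquiv_symm_iff R k).1 hk)
      refine Eq.trans ?_ (congrArg (fun t => P.rr (𝟙 _) _ t) this)
      rw [rr_rr, rr_rr]
      congr 1
      simp)
  refine ⟨p, fun W' l hl => ?_⟩
  have := hp (Over.homMk l : Over.mk (l ≫ a) ⟶ Over.mk a)
    hl
  exact this.trans (P.rr_id _ _)

end Sections

section Values

variable {X₁ X₂ X₃ Y : C} {M₁ : Torsor G X₁} {M₂ : Torsor G X₂} {M₃ : Torsor G X₃}
  {f₁ : Y ⟶ X₁} {f₂ : Y ⟶ X₂} {f₃ : Y ⟶ X₃}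

/-- The value at `t : W ⟶ Y` of a morphism of pullbacks of torsors to `Y`. -/
def valAt (φ : M₁.pullback f₁ ⟶ M₂.pullback f₂) {W : C} (t : W ⟶ Y)
    (p : M₁.sec (Over.mk (t ≫ f₁))) : M₂.sec (Over.mk (t ≫ f₂)) :=
  ap φ (T := Over.mk t) p

theorem valAt_rr (φ : M₁.pullback f₁ ⟶ M₂.pullback f₂) {W W' : C} (t : W ⟶ Y) (l : W' ⟶ W)
    (p : M₁.sec (Over.mk (t ≫ f₁))) :
    valAt φ (l ≫ t) (M₁.rr l (Category.assoc _ _ _).symm p) =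
      M₂.rr l (Category.assoc _ _ _).symm (valAt φ t p) :=
  ap_res φ (Over.homMk l rfl : Over.mk (l ≫ t) ⟶ Over.mk t) p

/-- The value at `t : W ⟶ Y` of a morphism of pullbacks of torsors to `Y`, with prescribed
compositions to the bases. -/
def vl (φ : M₁.pullback f₁ ⟶ M₂.pullback f₂) {W : C} (t : W ⟶ Y) {a₁ : W ⟶ X₁} {a₂ : W ⟶ X₂}
    (h₁ : t ≫ f₁ = a₁) (h₂ : t ≫ f₂ = a₂) (p : M₁.sec (Over.mk a₁)) : M₂.sec (Over.mk a₂) :=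
  M₂.rr (a := t ≫ f₂) (𝟙 W) (by rw [h₂, Category.id_comp])
    (valAt φ t (M₁.rr (a' := t ≫ f₁) (𝟙 W) (by rw [h₁, Category.id_comp]) p))

theorem vl_rfl (φ : M₁.pullback f₁ ⟶ M₂.pullback f₂) {W : C} (t : W ⟶ Y)
    (p : M₁.sec (Over.mk (t ≫ f₁))) : vl φ t rfl rfl p = valAt φ t p := by
  refine (M₂.rr_id _ _).trans ?_
  exact congrArg (fun x => valAt φ t x) (M₁.rr_id _ p)

theorem vl_hom_ext {φ ψ : M₁.pullback f₁ ⟶ M₂.pullback f₂}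
    (h : ∀ {W : C} (t : W ⟶ Y) (p : M₁.sec (Over.mk (t ≫ f₁))),
      vl φ t rfl rfl p = vl ψ t rfl rfl p) : φ = ψ := by
  refine hom_ext fun T p => ?_
  exact (vl_rfl φ T.hom p).symm.trans ((h T.hom p).trans (vl_rfl ψ T.hom p))

theorem rr_vl (φ : M₁.pullback f₁ ⟶ M₂.pullback f₂) {W W' : C} (t : W ⟶ Y) {a₁ : W ⟶ X₁}
    {a₂ : W ⟶ X₂} (h₁ : t ≫ f₁ = a₁) (h₂ : t ≫ f₂ = a₂) (l : W' ⟶ W) {b₁ : W' ⟶ X₁}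
    {b₂ : W' ⟶ X₂} (k₁ : l ≫ a₁ = b₁) (k₂ : l ≫ a₂ = b₂) (p : M₁.sec (Over.mk a₁)) :
    M₂.rr l k₂ (vl φ t h₁ h₂ p) =
      vl φ (l ≫ t) (by rw [Category.assoc, h₁, k₁]) (by rw [Category.assoc, h₂, k₂])
        (M₁.rr l k₁ p) := by
  subst h₁ h₂ k₁ k₂
  unfold vl
  rw [rr_id, rr_id, rr_rr]
  simp only [Category.id_comp]
  rw [valAt_rr, rr_rr]
  simp only [Category.id_comp]

theorem vl_comp (φ : M₁.pullback f₁ ⟶ M₂.pullback f₂) (ψ : M₂.pullback f₂ ⟶ M₃.pullback f₃)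
    {W : C} (t : W ⟶ Y) {a₁ : W ⟶ X₁} {a₂ : W ⟶ X₂} {a₃ : W ⟶ X₃} (h₁ : t ≫ f₁ = a₁)
    (h₂ : t ≫ f₂ = a₂) (h₃ : t ≫ f₃ = a₃) (p : M₁.sec (Over.mk a₁)) :
    vl (φ ≫ ψ) t h₁ h₃ p = vl ψ t h₂ h₃ (vl φ t h₁ h₂ p) := by
  subst h₁ h₂ h₃
  rw [vl_rfl, vl_rfl, vl_rfl]
  exact ap_comp φ ψ (T := Over.mk t) p

theorem vl_act (φ : M₁.pullback f₁ ⟶ M₂.pullback f₂) {W : C} (t : W ⟶ Y) {a₁ : W ⟶ X₁}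
    {a₂ : W ⟶ X₂} (h₁ : t ≫ f₁ = a₁) (h₂ : t ≫ f₂ = a₂) (p : M₁.sec (Over.mk a₁))
    (g : G.sec W) : vl φ t h₁ h₂ (M₁.act (T := Over.mk a₁) p g) =
      M₂.act (T := Over.mk a₂) (vl φ t h₁ h₂ p) g := by
  subst h₁ h₂
  rw [vl_rfl, vl_rfl]
  exact ap_act φ (T := Over.mk t) p g

theorem vl_id {W : C} (t : W ⟶ Y) {a₁ : W ⟶ X₁} (h₁ h₁' : t ≫ f₁ = a₁)
    (p : M₁.sec (Over.mk a₁)) : vl (𝟙 (M₁.pullback f₁)) t h₁ h₁' p = p := by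
  subst h₁
  rw [vl_rfl]
  rfl

theorem vl_pullbackMap {M M' : Torsor G X₁} (ψ : M ⟶ M') {W : C} (t : W ⟶ Y) {a₁ : W ⟶ X₁}
    (h₁ h₁' : t ≫ f₁ = a₁) (p : M.sec (Over.mk a₁)) :
    vl (pullbackMap ψ f₁) t h₁ h₁' p = ap ψ p := by
  subst h₁
  rw [vl_rfl]
  rfl

theorem ap_mapComp'_hom {U V W : C} (P : Torsor G U) (f : V ⟶ U) (g : W ⟶ V) (gf : W ⟶ U)
    (h : f.op.toLoc ≫ g.op.toLoc = gf.op.toLoc) (h' : g ≫ f = gf) {T : Over W}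
    (p : (P.pullback gf).sec T) :
    ap (at2 ((TORS G).mapComp' f.op.toLoc g.op.toLoc gf.op.toLoc h).hom P) p =
      P.rr (a := T.hom ≫ gf) (a' := (T.hom ≫ g) ≫ f) (𝟙 T.left) (by simp [← h']) p := by
  subst h'
  have e : (TORS G).mapComp' f.op.toLoc g.op.toLoc (g ≫ f).op.toLoc h =
    (TORS G).mapComp f.op.toLoc g.op.toLoc := mapComp'_eq_mapComp _ _ _
  rw [e]
  exact ap_pullbackComp P g f p

theorem ap_mapComp'_inv {U V W : C} (P : Torsor G U) (f : V ⟶ U) (g : W ⟶ V) (gf : W ⟶ U)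
    (h : f.op.toLoc ≫ g.op.toLoc = gf.op.toLoc) (h' : g ≫ f = gf) {T : Over W}
    (p : ((P.pullback f).pullback g).sec T) :
    ap (at2 ((TORS G).mapComp' f.op.toLoc g.op.toLoc gf.op.toLoc h).inv P) p =
      P.rr (a' := T.hom ≫ gf) (a := (T.hom ≫ g) ≫ f) (𝟙 T.left) (by simp [← h']) p := by
  subst h'
  have e : (TORS G).mapComp' f.op.toLoc g.op.toLoc (g ≫ f).op.toLoc h =
    (TORS G).mapComp f.op.toLoc g.op.toLoc := mapComp'_eq_mapComp _ _ _
  rw [e]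
  exact ap_pullbackComp_inv P g f p

/-- Pullback of morphisms between pullbacks of torsors. -/
noncomputable def pl (φ : M₁.pullback f₁ ⟶ M₂.pullback f₂) {Y' : C} (g : Y' ⟶ Y) (gf₁ : Y' ⟶ X₁)
    (gf₂ : Y' ⟶ X₂) (e₁ : g ≫ f₁ = gf₁) (e₂ : g ≫ f₂ = gf₂) :
    M₁.pullback gf₁ ⟶ M₂.pullback gf₂ :=
  pullHom (F := TORS G) (M₁ := M₁) (M₂ := M₂) φ g gf₁ gf₂ e₁ e₂

/-- The comparison isomorphisms inside `pl` act on sections as restrictions along identities, so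
they disappear from the value. With this, identities between pulled-back morphisms of torsors reduce
to identities between values. -/
theorem vl_pl (φ : M₁.pullback f₁ ⟶ M₂.pullback f₂) {Y' : C} (g : Y' ⟶ Y) (gf₁ : Y' ⟶ X₁)
    (gf₂ : Y' ⟶ X₂) (e₁ : g ≫ f₁ = gf₁) (e₂ : g ≫ f₂ = gf₂) {W : C} (t : W ⟶ Y') {a₁ : W ⟶ X₁}
    {a₂ : W ⟶ X₂} (h₁ : t ≫ gf₁ = a₁) (h₂ : t ≫ gf₂ = a₂) (p : M₁.sec (Over.mk a₁)) :
    vl (pl φ g gf₁ gf₂ e₁ e₂) t h₁ h₂ p =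
      vl φ (t ≫ g) (by rw [Category.assoc, e₁, h₁]) (by rw [Category.assoc, e₂, h₂]) p := by
  subst h₁ h₂
  rw [vl_rfl]
  refine (ap_mapComp'_inv M₂ f₂ g gf₂ (by rw [← e₂]; rfl) e₂ _).trans ?_
  unfold vl
  refine congrArg (fun x => M₂.rr _ _ x) (congrArg (fun x => valAt φ (t ≫ g) x) ?_)
  exact ap_mapComp'_hom M₁ f₁ g gf₁ (by rw [← e₁]; rfl) e₁ (T := Over.mk t) p

/-- A morphism of pullbacks of torsors from its values. -/
def ofVl (v : ∀ {W : C} (t : W ⟶ Y), M₁.sec (Over.mk (t ≫ f₁)) → M₂.sec (Over.mk (t ≫ f₂)))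
    (hv : ∀ {W W' : C} (t : W ⟶ Y) (l : W' ⟶ W) (p : M₁.sec (Over.mk (t ≫ f₁))),
      v (l ≫ t) (M₁.rr l (Category.assoc _ _ _).symm p) =
        M₂.rr l (Category.assoc _ _ _).symm (v t p))
    (ha : ∀ {W : C} (t : W ⟶ Y) (p : M₁.sec (Over.mk (t ≫ f₁))) (g : G.sec W),
      v t (M₁.act (T := Over.mk (t ≫ f₁)) p g) = M₂.act (T := Over.mk (t ≫ f₂)) (v t p) g) :
    M₁.pullback f₁ ⟶ M₂.pullback f₂ :=
  mkMor (P := M₁.pullback f₁) (Q := M₂.pullback f₂) (fun {T} p => v T.hom p)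
    (fun {T' T} k p => by
      -- The composite `k.left ≫ T.hom` is replaced by a variable, because it equals `T'.hom` only
      -- propositionally.
      have aux : ∀ (t' : T'.left ⟶ Y) (ht : k.left ≫ T.hom = t')
          (p : M₁.sec (Over.mk (T.hom ≫ f₁))),
          v t' (M₁.rr k.left (by rw [← ht, Category.assoc]) p) =
          M₂.rr k.left (by rw [← ht, Category.assoc]) (v T.hom p) := by
        intro t' ht p
        subst ht
        exact hv T.hom k.left p
      exact aux T'.hom (Over.w k) p)
    (fun {T} p g => ha T.hom p g)

theorem vl_ofVl (v : ∀ {W : C} (t : W ⟶ Y), M₁.sec (Over.mk (t ≫ f₁)) → M₂.sec (Over.mk (t ≫ f₂)))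
    (hv) (ha) {W : C} (t : W ⟶ Y) (p : M₁.sec (Over.mk (t ≫ f₁))) :
    vl (ofVl (M₁ := M₁) (M₂ := M₂) v hv ha) t rfl rfl p = v t p := by
  rw [vl_rfl]
  rfl

end Values

end Torsor

/-! ### Morphisms of torsors form sheaves. -/

/-- A morphism is a compatible family of equivariant maps on sections. Its value on a given section
is a section of the target, which is a sheaf; so values are determined locally and can be glued, and
equivariance is inherited from the local pieces. -/
theorem TORS_isPrestack (G : GroupSheaf J) : (TORS G).IsPrestack J := by
  have cov : ∀ {U : C} {T : Over U} {R : Sieve T}, R ∈ J.over U T → ∀ {W : C} (t : W ⟶ T.left),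
      (Sieve.overEquiv T R).pullback t ∈ J W := fun hR W t =>
    J.pullback_stable t ((GrothendieckTopology.mem_over_iff _ _).1 hR)
  refine Fibred.isPrestack_of_glue ?_ ?_
  · intro U (M : Torsor G U) (N : Torsor G U) T R hR
      (φ : M.pullback T.hom ⟶ N.pullback T.hom) (ψ : M.pullback T.hom ⟶ N.pullback T.hom) h
    refine Torsor.vl_hom_ext fun {W} t p => ?_
    refine N.rr_sep (cov hR t) fun W' l hl => ?_
    rw [Torsor.rr_vl _ _ _ _ _ rfl rfl, Torsor.rr_vl _ _ _ _ _ rfl rfl]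
    -- The two morphisms agree after pullback along the member `l ≫ t` of the sieve; evaluating
    -- these pullbacks at the identity gives the equality of values needed.
    have e : Torsor.pl φ (l ≫ t) _ _ rfl rfl = Torsor.pl ψ (l ≫ t) _ _ rfl rfl :=
      h (Over.homMk (l ≫ t) : Over.mk ((l ≫ t) ≫ T.hom) ⟶ T) ((Sieve.overEquiv_iff R _).1 hl)
    have e' := congrArg (fun χ => Torsor.vl χ (𝟙 W')
      (a₁ := l ≫ t ≫ T.hom) (a₂ := l ≫ t ≫ T.hom) (by simp) (by simp) (M.rr l rfl p)) e
    simpa only [Torsor.vl_pl, Category.id_comp] using e'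
  · intro U (M : Torsor G U) (N : Torsor G U) T R hR
      (φ : ∀ ⦃T' : Over U⦄ (k : T' ⟶ T), R k → (M.pullback T'.hom ⟶ N.pullback T'.hom))
      (hφ : ∀ ⦃T' T'' : Over U⦄ (k : T' ⟶ T) (l : T'' ⟶ T') (hk : R k),
        Torsor.pl (φ k hk) l.left T''.hom T''.hom (Over.w l) (Over.w l) =
          φ (l ≫ k) (R.downward_closed hk l))
    -- The local morphisms are reindexed by arrows of `C` into the source of `T`.
    let φ' : ∀ {W : C} (m : W ⟶ T.left), Sieve.overEquiv T R m →
        (M.pullback (m ≫ T.hom) ⟶ N.pullback (m ≫ T.hom)) := fun m hm =>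
      φ (Over.homMk m : Over.mk (m ≫ T.hom) ⟶ T) ((Sieve.overEquiv_iff R _).1 hm)
    -- Compatibility of the family in terms of values: evaluating at `l` the morphism given over `m`
    -- is evaluating at the identity the one given over `l ≫ m`.
    have hφ' : ∀ {W W' : C} (m : W ⟶ T.left) (hm : Sieve.overEquiv T R m) (l : W' ⟶ W)
        (m' : W' ⟶ T.left) (h : l ≫ m = m') (a : W' ⟶ U)
        (ha : m' ≫ T.hom = a) (p : M.sec (Over.mk a)),
        Torsor.vl (φ' m hm) l (by rw [← ha, ← h, Category.assoc])
            (by rw [← ha, ← h, Category.assoc]) p =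
          Torsor.vl (φ' m' (h ▸ Sieve.downward_closed _ hm l)) (𝟙 W') ((Category.id_comp _).trans ha)
            ((Category.id_comp _).trans ha) p := by
      intro W W' m hm l m' h a ha p
      subst h ha
      have e := hφ (Over.homMk m : Over.mk (m ≫ T.hom) ⟶ T)
        (Over.homMk l : Over.mk ((l ≫ m) ≫ T.hom) ⟶ Over.mk (m ≫ T.hom))
        ((Sieve.overEquiv_iff R _).1 hm)
      have e' := congrArg (fun χ => Torsor.vl χ (𝟙 W') (Category.id_comp _)
        (Category.id_comp _) p) e
      refine Eq.trans ?_ (e'.trans ?_)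
      · refine Eq.trans ?_ (Torsor.vl_pl (φ' m hm) l _ _ _ _ (𝟙 W') _ _ p).symm
        simp only [Category.id_comp]
      · rfl
    -- For a fixed section `p` over `W`, the local values on restrictions of `p` form a matching
    -- family on the pulled-back sieve; its gluing is the value at `p`.
    have ex : ∀ (W : C) (t : W ⟶ T.left) (p : M.sec (Over.mk (t ≫ T.hom))),
        ∃ q : N.sec (Over.mk (t ≫ T.hom)), ∀ ⦃W' : C⦄ (l : W' ⟶ W)
          (hl : (Sieve.overEquiv T R).pullback t l), N.rr l rfl q =
            Torsor.vl (φ' (l ≫ t) hl) (𝟙 W') (by simp) (by simp) (M.rr l rfl p) := by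
      intro W t p
      refine N.rr_glue _ (cov hR t) (fun W' l hl =>
        Torsor.vl (φ' (l ≫ t) hl) (𝟙 W') (by simp) (by simp) (M.rr l rfl p)) ?_
      intro W' W'' l k hl
      rw [Torsor.rr_vl (b₁ := (k ≫ l) ≫ t ≫ T.hom) _ _ _ _ _ (by simp) (by simp), Torsor.rr_rr]
      rw [hφ' (l ≫ t) hl _ ((k ≫ l) ≫ t) (by simp) _ (by simp)]
    choose v hv using ex
    refine ⟨Torsor.ofVl (M₁ := M) (M₂ := N) (f₁ := T.hom) (f₂ := T.hom) (fun {W} t p => v W t p) (fun {W W'} t l p => ?_) (fun {W} t p g => ?_),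
      fun T' k hk => ?_⟩
    · refine N.rr_sep (cov hR (l ≫ t)) fun W'' k hk => ?_
      rw [hv _ _ _ k hk, Torsor.rr_rr, Torsor.rr_rr]
      have e := congrArg (fun q => N.rr (a' := k ≫ (l ≫ t) ≫ T.hom) (𝟙 _) (by simp) q)
        (hv _ t p (k ≫ l) (by simpa using hk))
      rw [Torsor.rr_rr, Torsor.rr_vl (b₁ := k ≫ (l ≫ t) ≫ T.hom) _ _ _ _ _ (by simp) (by simp),
        Torsor.rr_rr] at e
      simp only [Category.id_comp] at e
      refine Eq.trans ?_ e.symm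
      -- The two sides now differ only by the bracketing of the composite into the source of `T`.
      have aux : ∀ (m m' : W'' ⟶ T.left) (h : m = m') (hm) (hm') (a : W'' ⟶ U)
          (ha : m ≫ T.hom = a) (p : M.sec (Over.mk a)),
          Torsor.vl (φ' m hm) (𝟙 _) ((Category.id_comp _).trans ha)
            ((Category.id_comp _).trans ha) p =
          Torsor.vl (φ' m' hm') (𝟙 _) ((Category.id_comp _).trans (h ▸ ha))
            ((Category.id_comp _).trans (h ▸ ha)) p := by
        intro m m' h hm hm' a ha p
        subst h
        rfl
      exact aux _ _ (Category.assoc _ _ _).symm hk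
        (by rw [Category.assoc]; exact hk) _ (by simp) _
    · refine N.rr_sep (cov hR t) fun W' l hl => ?_
      rw [hv _ _ _ l hl, Torsor.rr_act, Torsor.rr_act, hv _ _ _ l hl, Torsor.vl_act]
    -- Over an arrow already in the sieve, the glued morphism takes the prescribed values.
    · have key : ∀ {W W' : C} (m : W ⟶ T.left) (hm : Sieve.overEquiv T R m) (t : W' ⟶ W)
          (a : W' ⟶ U) (ha : (t ≫ m) ≫ T.hom = a) (p : M.sec (Over.mk a)) (h₁) (h₂),
          Torsor.vl (Torsor.ofVl (M₁ := M) (M₂ := N) (f₁ := T.hom) (f₂ := T.hom)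
            (fun {W} t p => v W t p) h₁ h₂) (t ≫ m) ha ha p =
          Torsor.vl (φ' m hm) t (by rw [← ha, Category.assoc]) (by rw [← ha, Category.assoc]) p := by
        intro W W' m hm t a ha p h₁ h₂
        subst ha
        rw [Torsor.vl_ofVl]
        -- As `t ≫ m` lies in the sieve, the pulled-back sieve contains the identity, and the
        -- defining property of the glued value can be read there.
        have e := congrArg (fun q => N.rr (a' := (t ≫ m) ≫ T.hom) (𝟙 _) (by simp) q)
          (hv _ (t ≫ m) p (𝟙 _) (by simpa using Sieve.downward_closed _ hm t))
        rw [Torsor.rr_rr, Torsor.rr_vl (b₁ := (t ≫ m) ≫ T.hom) _ _ _ _ _ (by simp) (by simp),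
          Torsor.rr_rr] at e
        simp only [Category.id_comp, Torsor.rr_id] at e
        rw [e, hφ' m hm t (𝟙 W' ≫ t ≫ m) (by simp) _ (by simp) p]
      obtain ⟨T', a, rfl⟩ := T'.mk_surjective
      change Torsor.pl _ k.left a a (Over.w k) (Over.w k) = φ k hk
      refine Torsor.vl_hom_ext fun {W} t p => ?_
      rw [Torsor.vl_pl]
      obtain ⟨m, hm, rfl⟩ : ∃ (m : T' ⟶ T.left) (hm : m ≫ T.hom = a), k = Over.homMk m hm :=
        ⟨k.left, Over.w k, rfl⟩
      have hm' : m ≫ T.hom = a := hm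
      subst hm'
      exact key m ((Sieve.overEquiv_iff R _).2 hk) t _ (Category.assoc _ _ _) p _ _

/-! ### Gluing a torsor from its sections over the arrows of a covering sieve. -/

theorem isSheaf_of_glue_type {D : Type u₁} [Category.{v₁} D] {K : GrothendieckTopology D}
    (F : Dᵒᵖ ⥤ Type w)
    (hsep : ∀ {U : D} {R : Sieve U}, R ∈ K U → ∀ s t : F.obj (op U),
      (∀ ⦃V : D⦄ (f : V ⟶ U), R f → F.map f.op s = F.map f.op t) → s = t)
    (hglue : ∀ {U : D} {R : Sieve U}, R ∈ K U →
      ∀ s : (∀ ⦃V : D⦄ (f : V ⟶ U), R f → F.obj (op V)),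
      (∀ ⦃V W : D⦄ (f : V ⟶ U) (g : W ⟶ V) (hf : R f),
        F.map g.op (s f hf) = s (g ≫ f) (R.downward_closed hf g)) →
      ∃ t : F.obj (op U), ∀ ⦃V : D⦄ (f : V ⟶ U) (hf : R f), F.map f.op t = s f hf) :
    Presheaf.IsSheaf K F := by
  rw [isSheaf_iff_isSheaf_of_type]
  intro U R hR x hx
  obtain ⟨t, ht⟩ := hglue hR (fun V f hf => x f hf) (fun V W f g hf => by
    have := hx g (𝟙 W) hf (R.downward_closed hf g) (by simp)
    simpa using this)
  refine ⟨t, fun V f hf => ht f hf, fun t' ht' => hsep hR _ _ fun V f hf => ?_⟩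
  exact (ht' f hf).trans (ht f hf).symm

/-- The data of a `G`-torsor on the arrows to `S` belonging to a sieve. -/
structure LocalTorsor (G : GroupSheaf J) {S : C} (R : Sieve S) where
  /-- sections over an arrow of the sieve -/
  sec : ∀ {V : C} (m : V ⟶ S), R m → Type (max u v)
  /-- restriction -/
  res : ∀ {V V' : C} {m : V ⟶ S} {m' : V' ⟶ S} (l : V' ⟶ V) (_ : l ≫ m = m') (hm : R m)
    (hm' : R m'), sec m hm → sec m' hm'
  res_id : ∀ {V : C} {m : V ⟶ S} (h : 𝟙 V ≫ m = m) (hm : R m) (s : sec m hm),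
    res (𝟙 V) h hm hm s = s
  res_res : ∀ {V V' V'' : C} {m : V ⟶ S} {m' : V' ⟶ S} {m'' : V'' ⟶ S} (l : V' ⟶ V)
    (h : l ≫ m = m') (l' : V'' ⟶ V') (h' : l' ≫ m' = m'') (hm : R m) (hm' : R m') (hm'' : R m'')
    (s : sec m hm), res l' h' hm' hm'' (res l h hm hm' s) =
      res (l' ≫ l) (by rw [Category.assoc, h, h']) hm hm'' s
  /-- right action -/
  act : ∀ {V : C} {m : V ⟶ S} (hm : R m), sec m hm → G.sec V → sec m hm
  act_one : ∀ {V : C} {m : V ⟶ S} (hm : R m) (s : sec m hm), act hm s 1 = s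
  act_mul : ∀ {V : C} {m : V ⟶ S} (hm : R m) (s : sec m hm) (g h : G.sec V),
    act hm s (g * h) = act hm (act hm s g) h
  res_act : ∀ {V V' : C} {m : V ⟶ S} {m' : V' ⟶ S} (l : V' ⟶ V) (h : l ≫ m = m') (hm : R m)
    (hm' : R m') (s : sec m hm) (g : G.sec V),
    res l h hm hm' (act hm s g) = act hm' (res l h hm hm' s) (G.res l g)
  simply_transitive : ∀ {V : C} {m : V ⟶ S} (hm : R m) (s t : sec m hm),
    ∃! g : G.sec V, act hm s g = t
  sep : ∀ {V : C} {m : V ⟶ S} (hm : R m) {W : Sieve V}, W ∈ J V → ∀ s t : sec m hm,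
    (∀ ⦃V' : C⦄ (l : V' ⟶ V), W l → res l rfl hm (R.downward_closed hm l) s =
      res l rfl hm (R.downward_closed hm l) t) → s = t
  glue : ∀ {V : C} {m : V ⟶ S} (hm : R m) {W : Sieve V}, W ∈ J V →
    ∀ s : (∀ ⦃V' : C⦄ (l : V' ⟶ V), W l → sec (l ≫ m) (R.downward_closed hm l)),
    (∀ ⦃V' V'' : C⦄ (l : V' ⟶ V) (k : V'' ⟶ V') (hl : W l),
      res k (Category.assoc _ _ _).symm _ (R.downward_closed hm (k ≫ l)) (s l hl) =
        s (k ≫ l) (W.downward_closed hl k)) →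
    ∃ t : sec m hm, ∀ ⦃V' : C⦄ (l : V' ⟶ V) (hl : W l),
      res l rfl hm (R.downward_closed hm l) t = s l hl
  locally_nonempty : ∀ {V : C} {m : V ⟶ S} (hm : R m), ∃ W ∈ J V, ∀ ⦃V' : C⦄ (l : V' ⟶ V), W l →
    Nonempty (sec (l ≫ m) (R.downward_closed hm l))

namespace LocalTorsor

variable {G : GroupSheaf J} {S : C} {R : Sieve S} (A : LocalTorsor G R)

/-- The sections over `T` of the torsor on `S` obtained by gluing. -/
structure GluedSec (T : Over S) where
  /-- the family of sections over the arrows to `T` -/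
  val : ∀ {V : C} (m : V ⟶ S) (hm : R m) (g : V ⟶ T.left), g ≫ T.hom = m → A.sec m hm
  res_val : ∀ {V V' : C} (m : V ⟶ S) (hm : R m) (g : V ⟶ T.left) (hg : g ≫ T.hom = m)
    (m' : V' ⟶ S) (hm' : R m') (l : V' ⟶ V) (g' : V' ⟶ T.left) (h : l ≫ g = g')
    (hm₂ : g' ≫ T.hom = m'),
    A.res l (by rw [← hg, ← hm₂, ← h, Category.assoc]) hm hm' (val m hm g hg) =
      val m' hm' g' hm₂

namespace GluedSec

variable {A}

theorem ext' {T : Over S} {s t : A.GluedSec T}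
    (h : ∀ {V : C} (m : V ⟶ S) (hm : R m) (g : V ⟶ T.left) (hg : g ≫ T.hom = m),
      s.val m hm g hg = t.val m hm g hg) : s = t := by
  obtain ⟨s, hs⟩ := s
  obtain ⟨t, ht⟩ := t
  have : @s = @t := by
    funext V m hm g hg
    exact h m hm g hg
  subst this
  rfl

/-- Restriction of families of sections. -/
def restrict {T' T : Over S} (k : T' ⟶ T) (s : A.GluedSec T) : A.GluedSec T' where
  val m hm g hg := s.val m hm (g ≫ k.left) (by rw [Category.assoc, Over.w, hg])
  res_val m hm g hg m' hm' l g' h hm₂ := s.res_val _ _ _ _ _ _ _ _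
    (by rw [← h, Category.assoc]) _

/-- The right action of `G`. -/
def act {T : Over S} (s : A.GluedSec T) (x : G.sec T.left) : A.GluedSec T where
  val m hm g hg := A.act hm (s.val m hm g hg) (G.res g x)
  res_val m hm g hg m' hm' l g' h hm₂ := by
    rw [A.res_act, s.res_val m hm g hg m' hm' l g' h hm₂, GroupSheaf.res_res, h]

theorem val_congr {T : Over S} (s : A.GluedSec T) {V : C} (m : V ⟶ S) (hm : R m)
    {g g' : V ⟶ T.left} (h : g = g') (hg : g ≫ T.hom = m) :
    s.val m hm g hg = s.val m hm g' (h ▸ hg) := by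
  subst h
  rfl

end GluedSec

theorem act_left_cancel {V : C} {m : V ⟶ S} (hm : R m) {s : A.sec m hm} {g h : G.sec V}
    (e : A.act hm s g = A.act hm s h) : g = h :=
  (A.simply_transitive hm s (A.act hm s h)).unique e rfl

/-- The presheaf of sections of the glued torsor. -/
def gluedPresheaf : (Over S)ᵒᵖ ⥤ Type (max u v) where
  obj T := A.GluedSec T.unop
  map k := TypeCat.ofHom (GluedSec.restrict k.unop)
  map_id T := by
    ext s
    refine GluedSec.ext' fun m hm g hg => ?_
    exact s.val_congr m hm (Category.comp_id g) _
  map_comp k l := by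
    ext s
    refine GluedSec.ext' fun m hm g hg => ?_
    exact s.val_congr m hm (Category.assoc _ _ _).symm _

/-- A section over `T` is a compatible family indexed by the arrows of `R` with a factorization
through `T`. Separation and gluing are therefore done index by index, with the axioms `sep` and
`glue` of the local torsor. -/
theorem isSheaf_gluedPresheaf : Presheaf.IsSheaf (J.over S) A.gluedPresheaf := by
  have cov : ∀ {T : Over S} {W : Sieve T}, W ∈ J.over S T → ∀ {V : C} (t : V ⟶ T.left),
      (Sieve.overEquiv T W).pullback t ∈ J V := fun hR W t =>
    J.pullback_stable t ((GrothendieckTopology.mem_over_iff _ _).1 hR)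
  have memW : ∀ {T : Over S} {W : Sieve T} {V : C} (m : V ⟶ S) (g : V ⟶ T.left)
      (hg : g ≫ T.hom = m), Sieve.overEquiv T W g ↔ W (Over.homMk g hg : Over.mk m ⟶ T) := by
    intro T W V m g hg
    subst hg
    exact Sieve.overEquiv_iff W g
  refine isSheaf_of_glue_type _ ?_ ?_
  · intro T W hW (s : A.GluedSec T) (t : A.GluedSec T) h
    have h' : ∀ ⦃T' : Over S⦄ (k : T' ⟶ T), W k →
      GluedSec.restrict k s = GluedSec.restrict k t := h
    refine GluedSec.ext' fun {V} m hm g hg => A.sep hm (cov hW g) _ _ fun V' l hl => ?_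
    have hlg : (l ≫ g) ≫ T.hom = l ≫ m := by rw [Category.assoc, hg]
    rw [s.res_val m hm g hg (l ≫ m) _ l (l ≫ g) rfl hlg,
      t.res_val m hm g hg (l ≫ m) _ l (l ≫ g) rfl hlg]
    have e := congrArg (fun s => s.val (l ≫ m) (R.downward_closed hm l) (𝟙 V')
      (Category.id_comp _)) (h' (Over.homMk (l ≫ g) hlg : Over.mk (l ≫ m) ⟶ T)
        ((memW _ _ _).1 hl))
    refine (s.val_congr _ _ (Category.id_comp _).symm _).trans (Eq.trans e ?_)
    exact t.val_congr _ _ (Category.id_comp _) _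
  · intro T W hW (s : ∀ ⦃T' : Over S⦄ (k : T' ⟶ T), W k → A.GluedSec T')
      (hs : ∀ ⦃T' T'' : Over S⦄ (k : T' ⟶ T) (l : T'' ⟶ T') (hk : W k),
        GluedSec.restrict l (s k hk) = s (l ≫ k) (W.downward_closed hk l))
    -- At a factorization `g` belonging to `W`, the glued family must take the value of the
    -- corresponding local section at the identity.
    let z : ∀ {V : C} (m : V ⟶ S) (_ : R m) (g : V ⟶ T.left) (_ : g ≫ T.hom = m)
        (_ : Sieve.overEquiv T W g), A.sec m ‹_› := fun {V} m hm g hg h =>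
      (s (Over.homMk g hg : Over.mk m ⟶ T) ((memW _ _ _).1 h)).val m hm (𝟙 V)
        (Category.id_comp _)
    -- Compatibility of the local sections shows that every value of `s k` is one of the `z`,
    -- computed at the composite `g ≫ k.left`.
    have key : ∀ {T' : Over S} (k : T' ⟶ T) (hk : W k) {V : C} (m : V ⟶ S) (hm : R m)
        (g : V ⟶ T'.left) (hg : g ≫ T'.hom = m) (g' : V ⟶ T.left) (e : g ≫ k.left = g')
        (hg' : g' ≫ T.hom = m) (h), (s k hk).val m hm g hg = z m hm g' hg' h := by
      intro T' k hk V m hm g hg g' e hg' h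
      have h₁ := congrArg (fun s => s.val m hm (𝟙 V) (Category.id_comp _))
        (hs k (Over.homMk g hg : Over.mk m ⟶ T') hk)
      have h₂ : (Over.homMk g hg : Over.mk m ⟶ T') ≫ k = Over.homMk g' hg' := by
        ext
        exact e
      have h₃ : ∀ (k' : Over.mk m ⟶ T) (hk' : W k') (_ : k' = Over.homMk g' hg'),
          (s k' hk').val m hm (𝟙 V) (Category.id_comp _) = z m hm g' hg' h := by
        intro k' hk' e
        subst e
        rfl
      refine Eq.trans ?_ (h₁.trans (h₃ _ _ h₂))
      exact (s k hk).val_congr m hm (Category.id_comp _).symm _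
    have resz : ∀ {V V' : C} (m : V ⟶ S) (hm : R m) (g : V ⟶ T.left) (hg : g ≫ T.hom = m) (h)
        (l : V' ⟶ V) (m' : V' ⟶ S) (hm' : R m') (hl : l ≫ m = m') (g' : V' ⟶ T.left)
        (hg' : l ≫ g = g') (hm₂ : g' ≫ T.hom = m') (h'),
        A.res l hl hm hm' (z m hm g hg h) = z m' hm' g' hm₂ h' := by
      intro V V' m hm g hg h l m' hm' hl g' hg' hm₂ h'
      rw [← key (Over.homMk g hg : Over.mk m ⟶ T) ((memW _ _ _).1 h) m' hm' l hl g' hg' hm₂ h']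
      exact GluedSec.res_val (T := Over.mk m) (s (Over.homMk g hg : Over.mk m ⟶ T) ((memW _ _ _).1 h))
        m hm (𝟙 V) (Category.id_comp _) m' hm' l l (Category.comp_id l) hl
    -- For a factorization `g` outside `W`, the values `z` at the arrows `l ≫ g` in `W` are glued
    -- inside the local torsor. The arrow `m'` and the factorization `g'` are kept as variables,
    -- which avoids transports later.
    have ex : ∀ (V : C) (m : V ⟶ S) (hm : R m) (g : V ⟶ T.left) (hg : g ≫ T.hom = m),
        ∃ t : A.sec m hm, ∀ (V' : C) (l : V' ⟶ V) (m' : V' ⟶ S) (hm' : R m') (hl : l ≫ m = m')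
          (g' : V' ⟶ T.left) (_ : l ≫ g = g') (hm₂ : g' ≫ T.hom = m') (h),
          A.res l hl hm hm' t = z m' hm' g' hm₂ h := by
      intro V m hm g hg
      obtain ⟨t, ht⟩ := A.glue hm (cov hW g) (fun V' l hl => z (l ≫ m) (R.downward_closed hm l)
        (l ≫ g) (by rw [Category.assoc, hg]) hl) (fun V' V'' l k hl =>
          resz _ _ _ _ hl _ _ _ _ _ (Category.assoc _ _ _).symm _ (Sieve.downward_closed _ hl k))
      refine ⟨t, fun V' l m' hm' hl g' hg' hm₂ h => ?_⟩
      subst hl hg'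
      exact ht l h
    choose t ht using ex
    refine ⟨(⟨fun {V} m hm g hg => t V m hm g hg, ?_⟩ : A.GluedSec T), fun T' k hk => ?_⟩
    · intro V V' m hm g hg m' hm' l g' h hm₂
      refine A.sep hm' (cov hW g') _ _ fun V'' k hk => ?_
      rw [A.res_res]
      rw [ht V m hm g hg V'' (k ≫ l) (k ≫ m') (R.downward_closed hm' k) _ (k ≫ g')
        (by rw [← h, Category.assoc]) (by rw [Category.assoc, hm₂]) hk]
      rw [ht V' m' hm' g' hm₂ V'' k (k ≫ m') (R.downward_closed hm' k) rfl (k ≫ g')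
        rfl (by rw [Category.assoc, hm₂]) hk]
    · refine GluedSec.ext' fun {V} m hm g hg => ?_
      change t V m hm (g ≫ k.left) _ = (s k hk).val m hm g hg
      have hgk : (g ≫ k.left) ≫ T.hom = m := by rw [Category.assoc, Over.w, hg]
      -- Since `k` lies in `W`, so does its composite with `g`; the glued value at this index is
      -- then already prescribed, and can be read along the identity.
      have hmem : Sieve.overEquiv T W (g ≫ k.left) := by
        rw [memW m _ hgk]
        have : (Over.homMk (g ≫ k.left) hgk : Over.mk m ⟶ T) =
          (Over.homMk g hg : Over.mk m ⟶ T') ≫ k := by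
          ext
          rfl
        rw [this]
        exact W.downward_closed hk _
      rw [key k hk m hm g hg _ rfl hgk hmem,
        ← ht V m hm (g ≫ k.left) hgk V (𝟙 V) m hm (Category.id_comp _) _ (Category.id_comp _) hgk
          hmem, A.res_id]

/-- The torsor on `S` obtained by gluing. -/
def glued (hR : R ∈ J S) : Torsor G S where
  sheaf := ⟨A.gluedPresheaf, A.isSheaf_gluedPresheaf⟩
  act {T} s g := GluedSec.act (T := T) s g
  act_one {T} s := GluedSec.ext' fun m hm g hg => by
    change A.act hm _ (G.res g 1) = _
    rw [map_one, A.act_one]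
  act_mul {T} s x y := GluedSec.ext' fun m hm g hg => by
    change A.act hm _ (G.res g (x * y)) = A.act hm (A.act hm _ (G.res g x)) (G.res g y)
    rw [map_mul, A.act_mul]
  rs_act {T' T} k s x := GluedSec.ext' fun m hm g hg => by
    change A.act hm _ (G.res (g ≫ k.left) x) = A.act hm _ (G.res g (G.res k.left x))
    rw [GroupSheaf.res_res]
    rfl
  simply_transitive {T} s t := by
    change A.GluedSec T at s t
    have ex : ∀ (V : C) (m : V ⟶ S) (hm : R m) (g : V ⟶ T.left) (hg : g ≫ T.hom = m),
        ∃ x : G.sec V, A.act hm (s.val m hm g hg) x = t.val m hm g hg :=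
      fun V m hm g hg => (A.simply_transitive hm _ _).exists
    choose x hx using ex
    -- Each index in `R` over `T` has a unique group element carrying `s` to `t`. Uniqueness makes
    -- these elements compatible, and they glue because the pullback of `R` to `T` covers.
    obtain ⟨y, hy⟩ := G.sec_glue (J.pullback_stable T.hom hR)
      (fun V g hg => x V (g ≫ T.hom) hg g rfl) (fun V V' g l hg => by
        have hg' : R (g ≫ T.hom) := hg
        have hlg : R ((l ≫ g) ≫ T.hom) := by
          rw [Category.assoc]
          exact R.downward_closed hg l
        refine A.act_left_cancel (m := (l ≫ g) ≫ T.hom) hlg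
          (s := s.val _ hlg (l ≫ g) rfl) ?_
        rw [hx]
        have e := congrArg (A.res l (Category.assoc _ _ _).symm hg' hlg)
          (hx V (g ≫ T.hom) hg' g rfl)
        rw [A.res_act, s.res_val _ _ _ _ _ hlg _ (l ≫ g) rfl rfl,
          t.res_val _ _ _ _ _ hlg _ (l ≫ g) rfl rfl] at e
        exact e)
    have hy' : ∀ (V : C) (m : V ⟶ S) (hm : R m) (g : V ⟶ T.left) (hg : g ≫ T.hom = m),
        G.res g y = x V m hm g hg := by
      intro V m hm g hg
      subst hg
      exact hy g hm
    refine ⟨y, GluedSec.ext' fun {V} m hm g hg => ?_, fun y' (h : GluedSec.act s y' = t) => ?_⟩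
    · change A.act hm _ (G.res g y) = _
      rw [hy' V m hm g hg, hx]
    · refine G.sec_ext (J.pullback_stable T.hom hR) fun V g (hg : R (g ≫ T.hom)) => ?_
      rw [hy' V _ hg g rfl]
      refine A.act_left_cancel hg (s := s.val _ hg g rfl) ?_
      rw [hx]
      exact congrArg (fun s => s.val _ hg g rfl) h
  locally_nonempty := by
    -- The sieve of those members of `R` that carry a section covers by transitivity, each member of
    -- `R` being locally of this kind.
    let R' : Sieve S :=
      { arrows := fun V f => ∃ hf : R f, Nonempty (A.sec f hf)
        downward_closed := by
          rintro V V' f ⟨hf, ⟨s⟩⟩ l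
          exact ⟨R.downward_closed hf l, ⟨A.res l rfl _ _ s⟩⟩ }
    refine ⟨R', J.transitive hR R' fun V f hf => ?_, fun V f hf => ?_⟩
    · obtain ⟨W, hW, h⟩ := A.locally_nonempty hf
      exact J.superset_covering (fun V' l hl => ⟨R.downward_closed hf l, h l hl⟩) hW
    · obtain ⟨hf, ⟨s⟩⟩ := hf
      -- A section over the arrow `f` itself spreads to a whole compatible family by restriction
      -- along the factorizations through `f`.
      exact ⟨(⟨fun {V} m hm g hg => A.res g hg hf hm s, fun {V V'} m hm g hg m' hm' l g' h hm₂ => by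
        subst h
        exact A.res_res _ _ _ _ _ _ _ _⟩ : A.GluedSec (Over.mk f))⟩

end LocalTorsor

/-! ### Descent data of torsors. -/

namespace Torsor

open Bicategory Pseudofunctor LocallyDiscreteOpToCat Fibred

variable {G : GroupSheaf J}

section Descent

variable {S : C} {ι : Type w} {X : ι → C} {f : ∀ i, X i ⟶ S} (D : (TORS G).DescentData f)

/-- The torsors of a descent datum. -/
abbrev descObj (i : ι) : Torsor G (X i) := D.obj i

/-- The transition isomorphisms of a descent datum of torsors. -/
def descHom {Y : C} (q : Y ⟶ S) {i₁ i₂ : ι} (f₁ : Y ⟶ X i₁) (f₂ : Y ⟶ X i₂)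
    (h₁ : f₁ ≫ f i₁ = q) (h₂ : f₂ ≫ f i₂ = q) :
    (descObj D i₁).pullback f₁ ⟶ (descObj D i₂).pullback f₂ := D.hom q f₁ f₂ h₁ h₂

/-- The transition maps of a descent datum of torsors, on sections. -/
def tr {Y : C} (q : Y ⟶ S) {i₁ i₂ : ι} (f₁ : Y ⟶ X i₁) (f₂ : Y ⟶ X i₂)
    (h₁ : f₁ ≫ f i₁ = q) (h₂ : f₂ ≫ f i₂ = q) (p : (descObj D i₁).sec (Over.mk f₁)) :
    (descObj D i₂).sec (Over.mk f₂) :=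
  vl (descHom D q f₁ f₂ h₁ h₂) (𝟙 Y) (Category.id_comp _) (Category.id_comp _) p

/-- Since transition maps are compatible with pullback, a value of one of them depends only on the
composite arrows; hence `tr`, the value at an identity, records all the information. -/
theorem vl_descHom {Y Y' : C} (q : Y ⟶ S) {i₁ i₂ : ι} (f₁ : Y ⟶ X i₁) (f₂ : Y ⟶ X i₂)
    (h₁ : f₁ ≫ f i₁ = q) (h₂ : f₂ ≫ f i₂ = q) (t : Y' ⟶ Y) {q' : Y' ⟶ S} {a₁ : Y' ⟶ X i₁}
    {a₂ : Y' ⟶ X i₂} (hq : t ≫ q = q') (e₁ : t ≫ f₁ = a₁) (e₂ : t ≫ f₂ = a₂)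
    (p : (descObj D i₁).sec (Over.mk a₁)) :
    vl (descHom D q f₁ f₂ h₁ h₂) t e₁ e₂ p =
      tr D q' a₁ a₂ (by rw [← e₁, Category.assoc, h₁, hq])
        (by rw [← e₂, Category.assoc, h₂, hq]) p := by
  have e : pl (descHom D q f₁ f₂ h₁ h₂) t a₁ a₂ e₁ e₂ =
      descHom D q' a₁ a₂ (by rw [← e₁, Category.assoc, h₁, hq])
        (by rw [← e₂, Category.assoc, h₂, hq]) :=
    D.pullHom_hom t q q' hq f₁ f₂ h₁ h₂ a₁ a₂ e₁ e₂
  unfold tr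
  rw [← e, vl_pl]
  congr 1
  exact (Category.id_comp t).symm

theorem tr_self {Y : C} (q : Y ⟶ S) {i : ι} (g : Y ⟶ X i) (h h' : g ≫ f i = q)
    (p : (descObj D i).sec (Over.mk g)) : tr D q g g h h' p = p := by
  have e : descHom D q g g h h' = 𝟙 _ := D.hom_self q g h
  unfold tr
  rw [e, vl_id]

theorem tr_tr {Y : C} (q : Y ⟶ S) {i₁ i₂ i₃ : ι} (f₁ : Y ⟶ X i₁) (f₂ : Y ⟶ X i₂)
    (f₃ : Y ⟶ X i₃) (h₁ : f₁ ≫ f i₁ = q) (h₂ : f₂ ≫ f i₂ = q) (h₂' : f₂ ≫ f i₂ = q)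
    (h₃ : f₃ ≫ f i₃ = q) (p : (descObj D i₁).sec (Over.mk f₁)) :
    tr D q f₂ f₃ h₂' h₃ (tr D q f₁ f₂ h₁ h₂ p) = tr D q f₁ f₃ h₁ h₃ p := by
  have e : descHom D q f₁ f₂ h₁ h₂ ≫ descHom D q f₂ f₃ h₂ h₃ = descHom D q f₁ f₃ h₁ h₃ :=
    D.hom_comp q f₁ f₂ f₃ h₁ h₂ h₃
  unfold tr
  rw [← e]
  exact (vl_comp _ _ _ _ _ _ p).symm

theorem tr_act {Y : C} (q : Y ⟶ S) {i₁ i₂ : ι} (f₁ : Y ⟶ X i₁) (f₂ : Y ⟶ X i₂)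
    (h₁ : f₁ ≫ f i₁ = q) (h₂ : f₂ ≫ f i₂ = q) (p : (descObj D i₁).sec (Over.mk f₁))
    (g : G.sec Y) :
    tr D q f₁ f₂ h₁ h₂ ((descObj D i₁).act (T := Over.mk f₁) p g) =
      (descObj D i₂).act (T := Over.mk f₂) (tr D q f₁ f₂ h₁ h₂ p) g :=
  vl_act _ _ _ _ p g

theorem rr_tr {Y Y' : C} (q : Y ⟶ S) {i₁ i₂ : ι} (f₁ : Y ⟶ X i₁) (f₂ : Y ⟶ X i₂)
    (h₁ : f₁ ≫ f i₁ = q) (h₂ : f₂ ≫ f i₂ = q) (l : Y' ⟶ Y) {q' : Y' ⟶ S} {a₁ : Y' ⟶ X i₁}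
    {a₂ : Y' ⟶ X i₂} (hq : l ≫ q = q') (e₁ : l ≫ f₁ = a₁) (e₂ : l ≫ f₂ = a₂)
    (p : (descObj D i₁).sec (Over.mk f₁)) :
    (descObj D i₂).rr l e₂ (tr D q f₁ f₂ h₁ h₂ p) =
      tr D q' a₁ a₂ (by rw [← e₁, Category.assoc, h₁, hq])
        (by rw [← e₂, Category.assoc, h₂, hq]) ((descObj D i₁).rr l e₁ p) := by
  unfold tr
  rw [rr_vl _ _ _ _ _ e₁ e₂, vl_descHom D q f₁ f₂ h₁ h₂ (l ≫ 𝟙 Y) (by rw [Category.comp_id, hq])]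
  rfl

end Descent

section SieveDescent

variable {S : C} {R : Sieve S}
  (D : (TORS G).DescentData (fun i : R.arrows.category => i.obj.hom))

/-- The torsor on the source of an arrow of the sieve. -/
abbrev descAt {V : C} (m : V ⟶ S) (hm : R m) : Torsor G V :=
  descObj D (Presieve.categoryMk R.arrows m hm)

/-- The transition maps, for a descent datum relative to a sieve. -/
def trs {Y V₁ V₂ : C} (q : Y ⟶ S) {m₁ : V₁ ⟶ S} {m₂ : V₂ ⟶ S} (hm₁ : R m₁) (hm₂ : R m₂)
    (f₁ : Y ⟶ V₁) (f₂ : Y ⟶ V₂) (h₁ : f₁ ≫ m₁ = q) (h₂ : f₂ ≫ m₂ = q)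
    (p : (descAt D m₁ hm₁).sec (Over.mk f₁)) : (descAt D m₂ hm₂).sec (Over.mk f₂) :=
  tr D (i₁ := Presieve.categoryMk R.arrows m₁ hm₁) (i₂ := Presieve.categoryMk R.arrows m₂ hm₂)
    q f₁ f₂ h₁ h₂ p

theorem trs_self {Y V : C} (q : Y ⟶ S) {m : V ⟶ S} (hm : R m) (g : Y ⟶ V) (h h' : g ≫ m = q)
    (p : (descAt D m hm).sec (Over.mk g)) : trs D q hm hm g g h h' p = p :=
  tr_self D (i := Presieve.categoryMk R.arrows m hm) q g h h' p

theorem trs_trs {Y V₁ V₂ V₃ : C} (q : Y ⟶ S) {m₁ : V₁ ⟶ S} {m₂ : V₂ ⟶ S} {m₃ : V₃ ⟶ S}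
    (hm₁ : R m₁) (hm₂ : R m₂) (hm₃ : R m₃) (f₁ : Y ⟶ V₁) (f₂ : Y ⟶ V₂) (f₃ : Y ⟶ V₃)
    (h₁ : f₁ ≫ m₁ = q) (h₂ h₂' : f₂ ≫ m₂ = q) (h₃ : f₃ ≫ m₃ = q)
    (p : (descAt D m₁ hm₁).sec (Over.mk f₁)) :
    trs D q hm₂ hm₃ f₂ f₃ h₂' h₃ (trs D q hm₁ hm₂ f₁ f₂ h₁ h₂ p) =
      trs D q hm₁ hm₃ f₁ f₃ h₁ h₃ p :=
  tr_tr D (i₁ := Presieve.categoryMk R.arrows m₁ hm₁) (i₂ := Presieve.categoryMk R.arrows m₂ hm₂)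
    (i₃ := Presieve.categoryMk R.arrows m₃ hm₃) q f₁ f₂ f₃ h₁ h₂ h₂' h₃ p

theorem trs_act {Y V₁ V₂ : C} (q : Y ⟶ S) {m₁ : V₁ ⟶ S} {m₂ : V₂ ⟶ S} (hm₁ : R m₁) (hm₂ : R m₂)
    (f₁ : Y ⟶ V₁) (f₂ : Y ⟶ V₂) (h₁ : f₁ ≫ m₁ = q) (h₂ : f₂ ≫ m₂ = q)
    (p : (descAt D m₁ hm₁).sec (Over.mk f₁)) (g : G.sec Y) :
    trs D q hm₁ hm₂ f₁ f₂ h₁ h₂ ((descAt D m₁ hm₁).act (T := Over.mk f₁) p g) =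
      (descAt D m₂ hm₂).act (T := Over.mk f₂) (trs D q hm₁ hm₂ f₁ f₂ h₁ h₂ p) g :=
  tr_act D (i₁ := Presieve.categoryMk R.arrows m₁ hm₁) (i₂ := Presieve.categoryMk R.arrows m₂ hm₂)
    q f₁ f₂ h₁ h₂ p g

theorem rr_trs {Y Y' V₁ V₂ : C} (q : Y ⟶ S) {m₁ : V₁ ⟶ S} {m₂ : V₂ ⟶ S} (hm₁ : R m₁)
    (hm₂ : R m₂) (f₁ : Y ⟶ V₁) (f₂ : Y ⟶ V₂) (h₁ : f₁ ≫ m₁ = q) (h₂ : f₂ ≫ m₂ = q)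
    (l : Y' ⟶ Y) {q' : Y' ⟶ S} {a₁ : Y' ⟶ V₁} {a₂ : Y' ⟶ V₂} (hq : l ≫ q = q')
    (e₁ : l ≫ f₁ = a₁) (e₂ : l ≫ f₂ = a₂) (p : (descAt D m₁ hm₁).sec (Over.mk f₁)) :
    (descAt D m₂ hm₂).rr l e₂ (trs D q hm₁ hm₂ f₁ f₂ h₁ h₂ p) =
      trs D q' hm₁ hm₂ a₁ a₂ (by rw [← e₁, Category.assoc, h₁, hq])
        (by rw [← e₂, Category.assoc, h₂, hq]) ((descAt D m₁ hm₁).rr l e₁ p) :=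
  rr_tr D (i₁ := Presieve.categoryMk R.arrows m₁ hm₁) (i₂ := Presieve.categoryMk R.arrows m₂ hm₂)
    q f₁ f₂ h₁ h₂ l hq e₁ e₂ p

/-- The transition in the opposite direction is a left inverse by the cocycle condition. -/
theorem trs_injective {Y V₁ V₂ : C} (q : Y ⟶ S) {m₁ : V₁ ⟶ S} {m₂ : V₂ ⟶ S} (hm₁ : R m₁)
    (hm₂ : R m₂) (f₁ : Y ⟶ V₁) (f₂ : Y ⟶ V₂) (h₁ : f₁ ≫ m₁ = q) (h₂ : f₂ ≫ m₂ = q) :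
    Function.Injective (trs D q hm₁ hm₂ f₁ f₂ h₁ h₂) := fun p p' h => by
  have e := congrArg (trs D q hm₂ hm₁ f₂ f₁ h₂ h₁) h
  rwa [trs_trs, trs_trs, trs_self, trs_self] at e

/-- The sections over the arrows of the sieve of the torsor defined by a descent datum. -/
def descLocal : LocalTorsor G R where
  sec {V} m hm := (descAt D m hm).sec (Over.mk (𝟙 V))
  -- The torsor attached to `m` contributes its section over the identity. Restricting along `l`
  -- first leads to a section over `l` of that same torsor; the transition map then moves it to the
  -- torsor attached to `m'`, over the identity.
  res {V V' m m'} l h hm hm' p := trs D m' hm hm' l (𝟙 V') h (Category.id_comp _)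
    ((descAt D m hm).rr l (Category.comp_id l) p)
  res_id h hm p := by
    rw [trs_self, rr_id]
  res_res {V V' V'' m m' m''} l h l' h' hm hm' hm'' p := by
    rw [rr_trs D m' hm hm' l (𝟙 V') h (Category.id_comp _) l' (q' := m'') h' rfl
      (Category.comp_id l'), trs_trs, rr_rr]
  act {V m} hm p g := (descAt D m hm).act (T := Over.mk (𝟙 V)) p g
  act_one {V m} hm p := (descAt D m hm).act_one (T := Over.mk (𝟙 V)) p
  act_mul {V m} hm p g h := (descAt D m hm).act_mul (T := Over.mk (𝟙 V)) p g h
  res_act {V V' m m'} l h hm hm' p g := by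
    rw [rr_act, trs_act]
  simply_transitive {V m} hm p q := (descAt D m hm).simply_transitive (T := Over.mk (𝟙 V)) p q
  sep {V m} hm W hW p q h := by
    refine (descAt D m hm).rr_sep hW fun V' l hl => ?_
    -- Injectivity of the transitions brings the comparison back to the single torsor attached to
    -- `m`, which is a sheaf.
    have e := trs_injective D _ _ _ _ _ _ _ (h l hl)
    have e' := congrArg ((descAt D m hm).rr (𝟙 V') (a' := l ≫ 𝟙 V) (by simp)) e
    rw [rr_rr, rr_rr] at e'
    simpa only [Category.id_comp] using e'
  glue {V m} hm W hW s hs := by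
    have mem : ∀ {V' : C} (l : V' ⟶ V), R (l ≫ m) := fun l => R.downward_closed hm l
    -- The given sections live in different torsors; transitions carry them all into the torsor
    -- attached to `m`, where they can be glued.
    obtain ⟨p, hp⟩ := (descAt D m hm).rr_glue (𝟙 V) hW
      (fun V' l hl => trs D (l ≫ m) (mem l) hm (𝟙 V') (l ≫ 𝟙 V) (Category.id_comp _)
        (by rw [Category.comp_id]) (s l hl)) (fun V' V'' l k hl => by
        rw [rr_trs D (l ≫ m) (mem l) hm (𝟙 V') (l ≫ 𝟙 V) _ _ k (q' := (k ≫ l) ≫ m)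
          (Category.assoc _ _ _).symm (Category.comp_id k) (Category.assoc _ _ _).symm,
          ← hs l k hl, trs_trs])
    refine ⟨p, fun V' l hl => ?_⟩
    have e := congrArg (trs D (l ≫ m) hm (mem l) (l ≫ 𝟙 V) (𝟙 V') (by rw [Category.comp_id])
      (Category.id_comp _)) (hp l hl)
    rw [trs_trs, trs_self] at e
    refine Eq.trans ?_ e
    have aux : ∀ (a : V' ⟶ V) (ha : l ≫ 𝟙 V = a) (h), trs D (l ≫ m) hm (mem l) a (𝟙 V') h
        (Category.id_comp _) ((descAt D m hm).rr l ha p) =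
        trs D (l ≫ m) hm (mem l) (l ≫ 𝟙 V) (𝟙 V') (by rw [Category.comp_id])
        (Category.id_comp _) ((descAt D m hm).rr l rfl p) := by
      intro a ha h
      subst ha
      rfl
    exact aux _ _ _
  locally_nonempty {V m} hm := by
    obtain ⟨W, hW, h⟩ := (descAt D m hm).locally_nonempty
    refine ⟨W, hW, fun V' l hl => ?_⟩
    obtain ⟨p⟩ := h l hl
    exact ⟨trs D (l ≫ m) hm (R.downward_closed hm l) l (𝟙 V') rfl (Category.id_comp _) p⟩

end SieveDescent

end Torsor

namespace Torsor

open Bicategory Pseudofunctor LocallyDiscreteOpToCat Fibred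

variable {G : GroupSheaf J} {S : C} {R : Sieve S}
  (D : (TORS G).DescentData (fun i : R.arrows.category => i.obj.hom))

theorem rr_congr {U : C} (P : Torsor G U) {W W' : C} {a : W ⟶ U} {a' : W' ⟶ U} {l l' : W' ⟶ W}
    (e : l = l') (h : l ≫ a = a') (h' : l' ≫ a = a') (p : P.sec (Over.mk a)) :
    P.rr l h p = P.rr l' h' p := by
  subst e
  rfl

/-- The value of a glued section may be indexed by propositionally equal arrows; this removes the
dependence on the chosen names. -/
theorem trs_val {T : Over S} (s : (descLocal D).GluedSec T) {Y V : C} (q : Y ⟶ S) (m : V ⟶ S)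
    (hm : R m) (f : Y ⟶ V) (h : f ≫ m = q) (m₁ m₂ : Y ⟶ S) (e₁ : m₁ = q) (e₂ : m₂ = q)
    (hm₁ : R m₁) (hm₂ : R m₂) (g₁ g₂ : Y ⟶ T.left) (hg : g₁ = g₂) (h₁ : g₁ ≫ T.hom = m₁)
    (h₂ : g₂ ≫ T.hom = m₂) :
    trs D q hm₁ hm (𝟙 Y) f ((Category.id_comp _).trans e₁) h (s.val m₁ hm₁ g₁ h₁) =
      trs D q hm₂ hm (𝟙 Y) f ((Category.id_comp _).trans e₂) h (s.val m₂ hm₂ g₂ h₂) := by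
  subst e₁ e₂ hg
  rfl

/-- The comparison of the glued torsor with the torsors of a descent datum. -/
def gluedMap (hR : R ∈ J S) {V : C} (m : V ⟶ S) (hm : R m) :
    ((descLocal D).glued hR).pullback m ⟶ descAt D m hm :=
  mkMor (P := ((descLocal D).glued hR).pullback m) (Q := descAt D m hm)
    -- The family `s` is read at the composite of `T` with `m`, and the transition map transports
    -- this value to the torsor attached to `m`.
    (fun {T} (s : (descLocal D).GluedSec ((Over.map m).obj T)) =>
      trs D (T.hom ≫ m) (R.downward_closed hm T.hom) hm (𝟙 T.left) T.hom (Category.id_comp _) rfl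
        (s.val (T.hom ≫ m) (R.downward_closed hm T.hom) (𝟙 T.left) (Category.id_comp _)))
    (fun {T' T} k (s : (descLocal D).GluedSec ((Over.map m).obj T)) => by
      have hk : k.left ≫ T.hom = T'.hom := Over.w k
      have hk' : k.left ≫ T.hom ≫ m = T'.hom ≫ m := by rw [← Category.assoc, hk]
      refine Eq.trans ?_ (rr_trs D (T.hom ≫ m) (R.downward_closed hm T.hom) hm (𝟙 T.left) T.hom
        (Category.id_comp _) rfl k.left hk' rfl hk _).symm
      -- Compatibility of the family along `k.left` expresses the value over `T'` through the one
      -- over `T`; the cocycle condition then merges the two transitions that occur.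
      have e := s.res_val (T.hom ≫ m) (R.downward_closed hm T.hom) (𝟙 T.left)
        (Category.id_comp _) (T'.hom ≫ m) (R.downward_closed hm T'.hom) k.left k.left
        (Category.comp_id _) hk'
      refine (congrArg (trs D (T'.hom ≫ m) (R.downward_closed hm T'.hom) hm (𝟙 T'.left) T'.hom
        (Category.id_comp _) rfl) ((s.val_congr _ _ (Category.id_comp k.left) _).trans
          e.symm)).trans ?_
      refine (trs_trs D (T'.hom ≫ m) _ _ _ _ _ _ _ _ _ _ _).trans ?_
      have aux : ∀ (a : T'.left ⟶ T.left) (ha : k.left ≫ 𝟙 T.left = a) (h) (p),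
          trs D (T'.hom ≫ m) (R.downward_closed hm T.hom) hm a T'.hom h rfl
            ((descAt D (T.hom ≫ m) (R.downward_closed hm T.hom)).rr k.left ha p) =
          trs D (T'.hom ≫ m) (R.downward_closed hm T.hom) hm (k.left ≫ 𝟙 T.left) T'.hom
            (by rw [Category.comp_id, hk']) rfl
            ((descAt D (T.hom ≫ m) (R.downward_closed hm T.hom)).rr k.left rfl p) := by
        intro a ha h p
        subst ha
        rfl
      exact aux _ _ _ _)
    (fun {T} (s : (descLocal D).GluedSec ((Over.map m).obj T)) g => by
      refine Eq.trans ?_ (trs_act D (T.hom ≫ m) (R.downward_closed hm T.hom) hm (𝟙 T.left) T.hom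
        (Category.id_comp _) rfl _ g)
      refine congrArg (trs D (T.hom ≫ m) (R.downward_closed hm T.hom) hm (𝟙 T.left) T.hom
        (Category.id_comp _) rfl) ?_
      exact congrArg (fun x => (descLocal D).act _ _ x) (G.res_id g))

/-- Here `c` stands for the canonical identification of the two pullbacks of the glued torsor, known
only through its effect `hc` on sections. Both composites send a family `s` to its value at one and
the same arrow, transported to the torsor attached to `m₂`; the left side does so in two
transitions, which the cocycle condition merges. -/
theorem gluedMap_comm (hR : R ∈ J S) {Y V₁ V₂ : C} (q : Y ⟶ S) {m₁ : V₁ ⟶ S} {m₂ : V₂ ⟶ S}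
    (hm₁ : R m₁) (hm₂ : R m₂) (f₁ : Y ⟶ V₁) (f₂ : Y ⟶ V₂) (h₁ : f₁ ≫ m₁ = q) (h₂ : f₂ ≫ m₂ = q)
    (c : (((descLocal D).glued hR).pullback m₁).pullback f₁ ⟶
      (((descLocal D).glued hR).pullback m₂).pullback f₂)
    (hc : ∀ {T : Over Y} (s : ((((descLocal D).glued hR).pullback m₁).pullback f₁).sec T),
      ap c s = ((descLocal D).glued hR).rr (a := (T.hom ≫ f₁) ≫ m₁) (a' := (T.hom ≫ f₂) ≫ m₂)
        (𝟙 T.left) (by simp [h₁, h₂]) s) :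
    pullbackMap (gluedMap D hR m₁ hm₁) f₁ ≫
        descHom D (i₁ := Presieve.categoryMk R.arrows m₁ hm₁)
          (i₂ := Presieve.categoryMk R.arrows m₂ hm₂) q f₁ f₂ h₁ h₂ =
      c ≫ pullbackMap (gluedMap D hR m₂ hm₂) f₂ := by
  refine hom_ext fun T s => ?_
  refine Eq.trans ?_
    (congrArg (fun x => ap (pullbackMap (gluedMap D hR m₂ hm₂) f₂) x) (hc s)).symm
  change (descLocal D).GluedSec (Over.mk ((T.hom ≫ f₁) ≫ m₁)) at s
  have hq₁ : (T.hom ≫ f₁) ≫ m₁ = T.hom ≫ q := by rw [Category.assoc, h₁]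
  have hq₂ : (T.hom ≫ f₂) ≫ m₂ = T.hom ≫ q := by rw [Category.assoc, h₂]
  have hR₁ := R.downward_closed hm₁ (T.hom ≫ f₁)
  have hR₂ := R.downward_closed hm₂ (T.hom ≫ f₂)
  refine ((vl_rfl _ T.hom _).symm.trans (vl_descHom D (i₁ := Presieve.categoryMk R.arrows m₁ hm₁)
    (i₂ := Presieve.categoryMk R.arrows m₂ hm₂) q f₁ f₂ h₁ h₂ T.hom rfl rfl rfl _)).trans ?_
  change trs D (T.hom ≫ q) hm₁ hm₂ (T.hom ≫ f₁) (T.hom ≫ f₂) hq₁ hq₂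
    (trs D ((T.hom ≫ f₁) ≫ m₁) hR₁ hm₁ (𝟙 T.left) (T.hom ≫ f₁) _ _ (s.val _ hR₁ (𝟙 _) _)) =
    trs D ((T.hom ≫ f₂) ≫ m₂) hR₂ hm₂ (𝟙 T.left) (T.hom ≫ f₂) _ _
      (s.val _ hR₂ (𝟙 _ ≫ 𝟙 _) (by simp [h₁, h₂]))
  -- The base arrow is left free, since the two transitions to be merged are written over two equal
  -- but differently bracketed composites.
  have aux₁ : ∀ (q' : T.left ⟶ S) (hq : (T.hom ≫ f₁) ≫ m₁ = q') (hq' : (T.hom ≫ f₂) ≫ m₂ = q'),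
      trs D q' hm₁ hm₂ (T.hom ≫ f₁) (T.hom ≫ f₂) hq hq'
        (trs D ((T.hom ≫ f₁) ≫ m₁) hR₁ hm₁ (𝟙 T.left) (T.hom ≫ f₁) (Category.id_comp _) rfl
          (s.val _ hR₁ (𝟙 _) (Category.id_comp _))) =
      trs D q' hR₁ hm₂ (𝟙 T.left) (T.hom ≫ f₂) ((Category.id_comp _).trans hq) hq'
          (s.val _ hR₁ (𝟙 _) (Category.id_comp _)) := by
    intro q' hq hq'
    subst hq
    exact trs_trs D _ _ _ _ _ _ _ _ _ _ _ _
  have aux₀ : ∀ (q' : T.left ⟶ S) (e : T.hom ≫ q = q') (x),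
      trs D (T.hom ≫ q) hm₁ hm₂ (T.hom ≫ f₁) (T.hom ≫ f₂) hq₁ hq₂ x =
        trs D q' hm₁ hm₂ (T.hom ≫ f₁) (T.hom ≫ f₂) (hq₁.trans e) (hq₂.trans e) x := by
    intro q' e x
    subst e
    rfl
  refine (aux₀ _ hq₂.symm _).trans ?_
  refine (aux₁ _ (hq₁.trans hq₂.symm) rfl).trans ?_
  exact trs_val D s _ m₂ hm₂ _ _ _ _ (hq₁.trans hq₂.symm) rfl _ _ _ _ (Category.comp_id _).symm _ _

end Torsor

-- A descent datum relative to a covering sieve is effective: the torsor glued from it restricts to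
-- the given ones. The comparison maps are automatically invertible, every morphism of torsors being
-- so, and only their compatibility with the transition maps has to be checked.
open Pseudofunctor Fibred in
theorem TORS_isStack (G : GroupSheaf J) : (TORS G).IsStack J where
  toIsPrestack := TORS_isPrestack G
  essSurj_of_sieve {S} R hR :=
    { mem_essImage := fun D => by
        refine ⟨(Torsor.descLocal D).glued hR, ⟨DescentData.isoMk (fun i =>
          @asIso _ _ _ _ (Torsor.gluedMap D hR i.obj.hom i.property) (Torsor.isIso_hom _)) ?_⟩⟩
        intro Y q i₁ i₂ f₁ f₂ h₁ h₂
        refine Torsor.gluedMap_comm D hR q i₁.property i₂.property f₁ f₂ h₁ h₂ _ ?_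
        intro T s
        -- The transition map of the datum of pullbacks is an inverse comparison followed by a
        -- comparison; both are restrictions along identities, as `gluedMap_comm` requires.
        have e₁ := Torsor.ap_mapComp'_inv ((Torsor.descLocal D).glued hR) i₁.obj.hom f₁ q
          (by rw [← h₁]; rfl) h₁ (T := T) s
        have e₂ := Torsor.ap_mapComp'_hom ((Torsor.descLocal D).glued hR) i₂.obj.hom f₂ q
          (by rw [← h₂]; rfl) h₂ (T := T)
        refine (e₂ _).trans ((congrArg _ e₁).trans ((Torsor.rr_rr _ _ _ _ _ _).trans ?_))
        exact Torsor.rr_congr ((Torsor.descLocal D).glued hR) (a := (T.hom ≫ f₁) ≫ i₁.obj.hom)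
          (a' := (T.hom ≫ f₂) ≫ i₂.obj.hom) (Category.comp_id (𝟙 T.left)) _
          (by simp [h₁, h₂]) s }

/-! ### Torsors with a section over the base. -/

namespace Torsor

variable {G : GroupSheaf J} {U : C}

/-- The restriction to `T` of a section over `U`. -/
def glob (P : Torsor G U) (p : P.sec (Over.mk (𝟙 U))) (T : Over U) : P.sec T :=
  P.res (Over.homMk T.hom : T ⟶ Over.mk (𝟙 U)) p

theorem res_glob (P : Torsor G U) (p : P.sec (Over.mk (𝟙 U))) {T' T : Over U} (k : T' ⟶ T) :
    P.res k (P.glob p T) = P.glob p T' := by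
  refine (P.res_res _ _ _).trans ?_
  refine congrArg (fun l => P.res l p) ?_
  ext
  exact Over.w k

theorem glob_self (P : Torsor G U) (p : P.sec (Over.mk (𝟙 U))) :
    P.glob p (Over.mk (𝟙 U)) = p := by
  refine Eq.trans ?_ (rs_id P.sheaf p)
  exact congrArg (fun l => P.res l p) (by ext; rfl)

/-- The morphism of torsors which sends a section `p` over the base to a section `q`. -/
noncomputable def homOfSec (P Q : Torsor G U) (p : P.sec (Over.mk (𝟙 U)))
    (q : Q.sec (Over.mk (𝟙 U))) : P ⟶ Q :=
  mkMor (fun {T} s => Q.act (Q.glob q T) (P.diff (P.glob p T) s))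
    (fun {T' T} k s => by
      refine Eq.trans ?_ (Q.rs_act k _ _).symm
      refine congrArg₂ Q.act (Q.res_glob q k).symm ?_
      rw [res_diff, res_glob])
    (fun {T} s g => by
      rw [← Q.act_mul]
      refine congrArg _ (P.act_left_cancel (p := P.glob p T) ?_)
      rw [P.act_diff, P.act_mul, P.act_diff])

theorem ap_homOfSec (P Q : Torsor G U) (p : P.sec (Over.mk (𝟙 U)))
    (q : Q.sec (Over.mk (𝟙 U))) : ap (homOfSec P Q p q) p = q := by
  have e : P.diff p p = 1 := P.act_left_cancel (p := p) (by rw [P.act_diff, P.act_one])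
  change Q.act (Q.glob q _) (P.diff (P.glob p _) p) = q
  rw [glob_self, glob_self, e, Q.act_one]

/-- One section over the base generates all others under restriction and the action. -/
theorem hom_ext_of_sec {P Q : Torsor G U} {φ ψ : P ⟶ Q} (p : P.sec (Over.mk (𝟙 U)))
    (h : ap φ p = ap ψ p) : φ = ψ := by
  refine hom_ext fun T s => ?_
  rw [← P.act_diff (P.glob p T) s, ap_act, ap_act]
  refine congrArg (fun x => Q.act x _) ?_
  exact (ap_res φ _ p).trans ((congrArg _ h).trans (ap_res ψ _ p).symm)

/-- The trivial torsor. -/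
noncomputable def trivial (G : GroupSheaf J) (U : C) : Torsor G U where
  sheaf := G.on U
  act {T} (x : G.sec T.left) g := (x * g : G.sec T.left)
  act_one {T} (x : G.sec T.left) := mul_one x
  act_mul {T} (x : G.sec T.left) g h := (mul_assoc x g h).symm
  rs_act {T' T} k (x : G.sec T.left) g := map_mul (G.res k.left) x g
  simply_transitive {T} (x : G.sec T.left) (y : G.sec T.left) :=
    ⟨x⁻¹ * y, mul_inv_cancel_left x y, fun z hz => by
      have hz' : x * z = y := hz
      rw [← hz', inv_mul_cancel_left]⟩
  locally_nonempty := ⟨⊤, J.top_mem U, fun V _ _ => ⟨(1 : G.sec V)⟩⟩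

/-- The section over the base of the pullback of a torsor defined by a section. -/
def pullSec (P : Torsor G U) {V : C} (f : V ⟶ U) (p : P.sec (Over.mk f)) :
    (P.pullback f).sec (Over.mk (𝟙 V)) :=
  P.rr (a := f) (a' := 𝟙 V ≫ f) (𝟙 V) rfl p

end Torsor

/-! ### The fibre product of the butterfly is a gerbe. -/

namespace Fibred

open Bicategory Pseudofunctor LocallyDiscreteOpToCat Limits

/-- Two objects are locally isomorphic. -/
def LocIso (J : GrothendieckTopology C) (F : Fibred C) {U : C} (x y : F.obj ⟨op U⟩) : Prop :=
  ∃ R ∈ J U, ∀ ⦃V : C⦄ (f : V ⟶ U), R f →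
    Nonempty ((F.map f.op.toLoc).toFunctor.obj x ≅ (F.map f.op.toLoc).toFunctor.obj y)

theorem LocIso.of_iso {F : Fibred C} {U : C} {x y : F.obj ⟨op U⟩} (e : x ≅ y) : LocIso J F x y :=
  ⟨⊤, J.top_mem U, fun _ f _ => ⟨(F.map f.op.toLoc).toFunctor.mapIso e⟩⟩

/-- Being isomorphic after pullback is stable under further pullback, so the arrows with this
property form a sieve, and transitivity of the topology makes it covering. This permits localizing
several times in succession. -/
theorem LocIso.of_cover {F : Fibred C} {U : C} {x y : F.obj ⟨op U⟩} {R : Sieve U} (hR : R ∈ J U)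
    (h : ∀ ⦃V : C⦄ (f : V ⟶ U), R f → LocIso J F ((F.map f.op.toLoc).toFunctor.obj x)
      ((F.map f.op.toLoc).toFunctor.obj y)) : LocIso J F x y := by
  let R' : Sieve U :=
    { arrows := fun V f => Nonempty ((F.map f.op.toLoc).toFunctor.obj x ≅
        (F.map f.op.toLoc).toFunctor.obj y)
      downward_closed := fun {V W f} ⟨e⟩ g => ⟨iso2 (F.mapComp f.op.toLoc g.op.toLoc) x ≪≫
        (F.map g.op.toLoc).toFunctor.mapIso e ≪≫ (iso2 (F.mapComp f.op.toLoc g.op.toLoc) y).symm⟩ }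
  refine ⟨R', J.transitive hR R' fun V f hf => ?_, fun V f hf => hf⟩
  obtain ⟨W, hW, hW'⟩ := h f hf
  refine J.superset_covering (fun V' g hg => ?_) hW
  obtain ⟨e⟩ := hW' g hg
  exact ⟨iso2 (F.mapComp f.op.toLoc g.op.toLoc) x ≪≫ e ≪≫
    (iso2 (F.mapComp f.op.toLoc g.op.toLoc) y).symm⟩

variable {F F' K : Fibred C} (α : StrongTrans F K) (β : StrongTrans F' K)

theorem isGroupoid_fibreProduct (U : C) [IsGroupoid (F.obj ⟨op U⟩)] [IsGroupoid (F'.obj ⟨op U⟩)] :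
    IsGroupoid ((fibreProduct α β).obj ⟨op U⟩) where
  all_isIso {x y} m := by
    let m' : CategoricalPullback.Hom (F := (α.app ⟨op U⟩).toFunctor)
      (G := (β.app ⟨op U⟩).toFunctor) x y := m
    have := IsGroupoid.all_isIso m'.fst
    have := IsGroupoid.all_isIso m'.snd
    let i : x ≅ y := CategoricalPullback.mkIso (asIso m'.fst) (asIso m'.snd) m'.w
    have e : i.hom = m := CategoricalPullback.hom_ext rfl rfl
    rw [← e]
    infer_instance


end Fibred

namespace Fibred

open Bicategory Pseudofunctor LocallyDiscreteOpToCat Limits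

variable {F F' K : Fibred C} (α : StrongTrans F K) (β : StrongTrans F' K)

theorem conj_map_comp {D D' : Type u₁} [Category.{v₁} D] [Category.{v₁} D'] (T : D ⥤ D')
    {A₁ A₂ B₁ B₂ : D} {E₁ E₂ X₁ X₂ : D'} {b₁ : X₁ ⟶ T.obj B₁} {i₁ : B₁ ⟶ A₁} {a₁ : T.obj A₁ ⟶ E₁}
    {a₂ : E₂ ⟶ T.obj A₂} {a₂' : T.obj A₂ ⟶ E₂} {u : E₁ ⟶ E₂} {u' : A₁ ⟶ A₂} {i₂ : A₂ ⟶ B₂}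
    {b₂ : T.obj B₂ ⟶ X₂} (h : a₁ ≫ u = T.map u' ≫ a₂') (ha : a₂' ≫ a₂ = 𝟙 _) :
    ((b₁ ≫ T.map i₁) ≫ a₁) ≫ u ≫ a₂ ≫ T.map i₂ ≫ b₂ =
      b₁ ≫ T.map (i₁ ≫ u' ≫ i₂) ≫ b₂ := by
  simp only [Category.assoc, Functor.map_comp]
  rw [reassoc_of% h, reassoc_of% ha]

/-- The morphism `β y ⟶ β y'` induced by `φ : x ⟶ x'`, for objects `(x, y)` and `(x', y')` of the
fibre product. -/
def cmp {U : C} (x y : (fibreProduct α β).obj ⟨op U⟩)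
    (φ : CategoricalPullback.fst x ⟶ CategoricalPullback.fst y) :
    (β.app ⟨op U⟩).toFunctor.obj (CategoricalPullback.snd x) ⟶
      (β.app ⟨op U⟩).toFunctor.obj (CategoricalPullback.snd y) :=
  (CategoricalPullback.iso x).inv ≫ (α.app ⟨op U⟩).toFunctor.map φ ≫
    (CategoricalPullback.iso y).hom

/-- In a pulled-back triple the structure isomorphism is conjugated by the naturality isomorphisms
of `α` and `β`. Those of `α` cancel by naturality, and only those of `β` survive. -/
theorem cmp_map {U V : C} (f : V ⟶ U) (x y : (fibreProduct α β).obj ⟨op U⟩)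
    (φ : CategoricalPullback.fst x ⟶ CategoricalPullback.fst y) :
    cmp α β (((fibreProduct α β).map f.op.toLoc).toFunctor.obj x)
        (((fibreProduct α β).map f.op.toLoc).toFunctor.obj y)
        ((F.map f.op.toLoc).toFunctor.map φ) =
      at2 (β.naturality f.op.toLoc).hom (CategoricalPullback.snd x) ≫
        (K.map f.op.toLoc).toFunctor.map (cmp α β x y φ) ≫
          at2 (β.naturality f.op.toLoc).inv (CategoricalPullback.snd y) := by
  refine conj_map_comp (K.map f.op.toLoc).toFunctor
    (b₁ := at2 (β.naturality f.op.toLoc).hom (CategoricalPullback.snd x))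
    (b₂ := at2 (β.naturality f.op.toLoc).inv (CategoricalPullback.snd y))
    (at2_naturality (α.naturality f.op.toLoc).inv φ).symm (at2_inv_hom _ _)

end Fibred

namespace Torsor

variable {G H : GroupSheaf J} {U V : C}

/-- An element of the image of `φ` can be moved across the contracted product: `p' ∧ φ e = p' e ∧
1`. The statement is kept on the pullback so that it combines with `cmp_map` to feed `iso_of_cmp`.
-/
theorem ap_conj_extendPullback (φ : G ⟶ H) (P P' : Torsor G U)
    (c : P.extend φ ⟶ P'.extend φ) (f : V ⟶ U) (T : Over V) (p : P.sec ((Over.map f).obj T))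
    (p' : P'.sec ((Over.map f).obj T)) (e : G.sec T.left)
    (h : ap c (P.unit φ p) =
      (P'.extend φ).act (T := (Over.map f).obj T) (P'.unit φ p') (homApp φ T.left e)) :
    ap ((extendPullbackIso φ f P).hom ≫ pullbackMap c f ≫ (extendPullbackIso φ f P').inv)
      ((P.pullback f).unit φ (T := T) p) =
      (P'.pullback f).unit φ (T := T) ((P'.pullback f).act (T := T) p' e) := by
  refine (congrArg (fun z => ap (extendPullbackIso φ f P').inv (ap (pullbackMap c f) z))
    (ap_extendPullbackIso_unit φ f P (T := T) p)).trans ?_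
  have h' : ap (pullbackMap c f) (T := T) (P.unit φ (T := (Over.map f).obj T) p) =
      P'.unit φ (T := (Over.map f).obj T) (P'.act (T := (Over.map f).obj T) p' e) :=
    h.trans (P'.unit_act φ (T := (Over.map f).obj T) p' e).symm
  refine (congrArg (fun z => ap (extendPullbackIso φ f P').inv z) h').trans ?_
  have e' := ap_extendPullbackIso_unit φ f P' (T := T) ((P'.pullback f).act (T := T) p' e)
  refine (congrArg (fun z => ap (extendPullbackIso φ f P').inv z) e'.symm).trans ?_
  exact ap_inv_hom _ _

end Torsor

namespace Butterfly

open Bicategory Pseudofunctor LocallyDiscreteOpToCat Limits Fibred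

variable {H G : CrossedModule J} (B : Butterfly H G)
variable {Q : Fibred C} (ν : StrongTrans Q (TORS H.G₀))

/-- The hypothesis says that the comparison of the extended torsors sends `p ∧ 1` to `p' e ∧ 1`. It
is therefore `π_*` of the morphism of `E`-torsors that sends `p` to `p' e`, and this morphism
together with `φ` is an isomorphism of triples. -/
theorem iso_of_cmp {U : C} (x y : (B.pullbackGerbe ν).obj ⟨op U⟩)
    (φ : CategoricalPullback.fst x ≅ CategoricalPullback.fst y)
    (p : Torsor.sec (U := U) (CategoricalPullback.snd x) (Over.mk (𝟙 U)))
    (p' : Torsor.sec (U := U) (CategoricalPullback.snd y) (Over.mk (𝟙 U))) (e : B.E.sec U)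
    (h : Torsor.ap (P := Torsor.extend B.π (CategoricalPullback.snd x))
      (Q := Torsor.extend B.π (CategoricalPullback.snd y)) (cmp ν (extension B.π) x y φ.hom)
        (Torsor.unit B.π (U := U) (CategoricalPullback.snd x) p) =
      Torsor.unit B.π (U := U) (CategoricalPullback.snd y)
        (Torsor.act (T := Over.mk (𝟙 U)) (CategoricalPullback.snd y) p' e)) :
    Nonempty (x ≅ y) := by
  let P : Torsor B.E U := CategoricalPullback.snd x
  let P' : Torsor B.E U := CategoricalPullback.snd y
  let χ : P ⟶ P' := Torsor.homOfSec P P' p (P'.act (T := Over.mk (𝟙 U)) p' e)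
  have hχ : cmp ν (extension B.π) x y φ.hom = Torsor.extendMap B.π χ := by
    refine Torsor.hom_ext_of_sec (P := P.extend B.π) (Q := P'.extend B.π) (P.unit B.π p) ?_
    refine h.trans (Eq.trans ?_ (Torsor.ap_extendMap_unit B.π χ p).symm)
    rw [Torsor.ap_homOfSec]
  refine ⟨CategoricalPullback.mkIso φ (@asIso _ _ _ _ χ (Torsor.isIso_hom χ)) ?_⟩
  refine Eq.trans ?_ (congrArg (fun t => (CategoricalPullback.iso x).hom ≫ t) hχ)
  exact (Iso.hom_inv_id_assoc _ _).symm

/-- The comparison of the extended torsors sends `p ∧ 1` to `p' ∧ h` for some section `h` of `H₀`.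
Local surjectivity of `π` writes `h` as `π e` on a covering, where `iso_of_cmp` applies. -/
theorem locIso_of_sec {U : C} (x y : (B.pullbackGerbe ν).obj ⟨op U⟩)
    (φ : CategoricalPullback.fst x ≅ CategoricalPullback.fst y)
    (p : Torsor.sec (U := U) (CategoricalPullback.snd x) (Over.mk (𝟙 U)))
    (p' : Torsor.sec (U := U) (CategoricalPullback.snd y) (Over.mk (𝟙 U))) :
    LocIso J (B.pullbackGerbe ν) x y := by
  let P : Torsor B.E U := CategoricalPullback.snd x
  let P' : Torsor B.E U := CategoricalPullback.snd y
  let c : P.extend B.π ⟶ P'.extend B.π := cmp ν (extension B.π) x y φ.hom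
  obtain ⟨h, hh⟩ := P'.exists_act_unit B.π p' (Torsor.ap c (P.unit B.π p))
  obtain ⟨R, hR, hR'⟩ := B.π_surjective h
  refine LocIso.of_cover hR fun V f hf => ?_
  obtain ⟨e, he⟩ := hR' f hf
  obtain ⟨i⟩ := B.iso_of_cmp ν (((B.pullbackGerbe ν).map f.op.toLoc).toFunctor.obj x)
    (((B.pullbackGerbe ν).map f.op.toLoc).toFunctor.obj y)
    ((Q.map f.op.toLoc).toFunctor.mapIso φ) (P.glob p ((Over.map f).obj (Over.mk (𝟙 V))))
    (P'.glob p' ((Over.map f).obj (Over.mk (𝟙 V)))) e (by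
      refine (congrArg (fun t => Torsor.ap (P := (P.pullback f).extend B.π)
        (Q := (P'.pullback f).extend B.π) t _) (cmp_map ν (extension B.π) f x y φ.hom)).trans ?_
      refine Torsor.ap_conj_extendPullback B.π P P' c f (Over.mk (𝟙 V)) _ _ e ?_
      -- The restricted sections live over `𝟙 V ≫ f`, whereas `e` was chosen to lift the restriction
      -- of `h` along `f`.
      have hs : 𝟙 V ≫ f = f := Category.id_comp f
      have e₁ := congrArg ((P'.extend B.π).res (Over.homMk (𝟙 V ≫ f) :
        Over.mk (𝟙 V ≫ f) ⟶ Over.mk (𝟙 U))) hh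
      refine Eq.trans ?_ (e₁.trans ?_)
      · refine Eq.trans ?_ (Torsor.ap_res c _ _)
        exact congrArg (fun z => Torsor.ap c z) (P.res_unit B.π _ _).symm
      · refine ((P'.extend B.π).rs_act _ _ _).trans ?_
        refine congrArg₂ (P'.extend B.π).act (P'.res_unit B.π _ _) ?_
        refine Eq.trans ?_ he.symm
        exact congrArg (fun g => H.G₀.res g h) hs)
  exact LocIso.of_iso i

/-- Three successive localizations reduce to `locIso_of_sec`: one makes the objects of `Q`
isomorphic, and two more, done together, give sections of both torsors. -/
theorem locIso_of_isGerbe (hQ : IsGerbe J Q) {U : C} (x y : (B.pullbackGerbe ν).obj ⟨op U⟩) :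
    LocIso J (B.pullbackGerbe ν) x y := by
  obtain ⟨R, hR, hR'⟩ := hQ.locally_connected U (CategoricalPullback.fst x)
    (CategoricalPullback.fst y)
  refine LocIso.of_cover hR fun V f hf => ?_
  obtain ⟨φ⟩ := hR' f hf
  let P : Torsor B.E V := Torsor.pullback (U := U) (CategoricalPullback.snd x) f
  let P' : Torsor B.E V := Torsor.pullback (U := U) (CategoricalPullback.snd y) f
  obtain ⟨R₁, hR₁, h₁⟩ := P.locally_nonempty
  obtain ⟨R₂, hR₂, h₂⟩ := P'.locally_nonempty
  refine LocIso.of_cover (J.intersection_covering hR₁ hR₂) fun W g hg => ?_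
  obtain ⟨p⟩ := h₁ g hg.1
  obtain ⟨p'⟩ := h₂ g hg.2
  exact B.locIso_of_sec ν _ _ ((Q.map g.op.toLoc).toFunctor.mapIso φ) (P.pullSec g p)
    (P'.pullSec g p')

theorem locally_nonempty_of_isGerbe (hQ : IsGerbe J Q) (U : C) :
    ∃ R ∈ J U, ∀ ⦃V : C⦄ (f : V ⟶ U), R f → Nonempty ((B.pullbackGerbe ν).obj ⟨op V⟩) := by
  let R : Sieve U :=
    { arrows := fun V _ => Nonempty ((B.pullbackGerbe ν).obj ⟨op V⟩)
      downward_closed := fun ⟨x⟩ g => ⟨((B.pullbackGerbe ν).map g.op.toLoc).toFunctor.obj x⟩ }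
  obtain ⟨R₀, hR₀, h⟩ := hQ.locally_nonempty U
  refine ⟨R, J.transitive hR₀ R fun V f hf => ?_, fun V f hf => hf⟩
  obtain ⟨x⟩ := h f hf
  obtain ⟨R₁, hR₁, h₁⟩ := (torsorOf ν x).locally_nonempty
  refine J.superset_covering (fun W g hg => ?_) hR₁
  obtain ⟨p⟩ := h₁ g hg
  let x' : Q.obj ⟨op W⟩ := (Q.map g.op.toLoc).toFunctor.obj x
  let P : Torsor B.E W := Torsor.trivial B.E W
  -- The local section of `ν x` trivializes it, so matching that section with `1 ∧ 1` identifies it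
  -- with the extension of the trivial `E`-torsor.
  let t : torsorOf ν x' ⟶ P.extend B.π := Torsor.homOfSec _ _
    (Torsor.ap (torsorPullback ν g x) ((torsorOf ν x).pullSec g p))
    (P.unit B.π (T := Over.mk (𝟙 W)) (1 : B.E.sec W))
  exact ⟨({ fst := x', snd := P, iso := @asIso _ _ _ _ t (Torsor.isIso_hom t) } :
    fibreCat ν (extension B.π) ⟨op W⟩)⟩

theorem isGerbe_pullbackGerbe (hQ : IsGerbe J Q) : IsGerbe J (B.pullbackGerbe ν) where
  isStack := by
    have := hQ.isStack
    have := TORS_isStack B.E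
    have := TORS_isPrestack H.G₀
    exact isStack_fibreProduct ν (extension B.π)
  isGroupoid U := by
    have := hQ.isGroupoid U
    have : IsGroupoid ((TORS B.E).obj ⟨op U⟩) := ⟨fun φ => Torsor.isIso_hom (U := U) φ⟩
    exact isGroupoid_fibreProduct ν (extension B.π) U
  locally_nonempty U := B.locally_nonempty_of_isGerbe ν hQ U
  locally_connected _ x y := B.locIso_of_isGerbe ν hQ x y

end Butterfly

/-! ### The isomorphism `θ` and the projections of the contracted products. -/

theorem groupSheaf_hom_ext {G H : GroupSheaf J} {φ ψ : G ⟶ H}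
    (h : ∀ (U : C) (x : G.sec U), homApp φ U x = homApp ψ U x) : φ = ψ := by
  ext U x
  exact h U.unop x

theorem isIso_of_bijective {G H : GroupSheaf J} (φ : G ⟶ H)
    (h : ∀ U : C, Function.Bijective (homApp φ U)) : IsIso φ := by
  let e := fun U : C => MulEquiv.ofBijective (homApp φ U) (h U)
  have he : ∀ (U : C) (y : H.sec U), homApp φ U ((e U).symm y) = y := fun U y =>
    (e U).apply_symm_apply y
  let ψ : H ⟶ G := mkHom (fun U => (e U).symm.toMonoidHom) (fun {V U} f y => (h V).1 (by
    refine (he V _).trans ?_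
    refine Eq.trans ?_ (homApp_res φ f _).symm
    exact congrArg (H.res f) (he U y).symm))
  refine ⟨ψ, groupSheaf_hom_ext fun U x => (e U).symm_apply_apply x,
    groupSheaf_hom_ext fun U y => he U y⟩

namespace Torsor

variable {G X Y : GroupSheaf J} {U : C}

theorem coord_rs_cmap (P : Torsor G U) (a : LeftAction G X) (b : LeftAction G Y) (u : X ⟶ Y)
    (hu : ∀ {V : C} (g : G.sec V) (x : X.sec V),
      homApp u V (a.smul g x) = b.smul g (homApp u V x)) {T' T : Over U} (k : T' ⟶ T)
    (z : P.csec a T) (p : P.sec T') : P.coord b (rs (P.contr b) k (P.cmap a b u hu z)) p =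
      homApp u T'.left (P.coord a (rs (P.contr a) k z) p) :=
  P.coord_rs_ofCoord _ _ _ _ k p

theorem coord_rs_assoc {H : GroupSheaf J} (φ : G ⟶ H) (P : Torsor G U) (a : GroupAction H X)
    {T' T : Over U} (k : T' ⟶ T) (z : (P.extend φ).csec a.toLeftAction T) (p : P.sec T') :
    P.coord (a.comap φ).toLeftAction (rs (P.contr (a.comap φ).toLeftAction) k (P.assoc φ a z)) p =
      (P.extend φ).coord a.toLeftAction (rs ((P.extend φ).contr a.toLeftAction) k z)
        (P.unit φ p) :=
  P.coord_rs_ofCoord _ _ _ _ k p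

end Torsor

namespace Butterfly

variable {H G : CrossedModule J} (B : Butterfly H G)

/-- Injectivity is that of `ι`. If `∂ h = π e`, then `(κ h)⁻¹ e` lies in the kernel of `π`, hence in
the image of `ι`; as the kernel is given by exactness on sections, no localization is needed. -/
theorem θ_bijective (U : C) : Function.Bijective (homApp B.θ U) := by
  constructor
  · intro x y h
    have h₁ : x.1 = y.1 := congrArg (fun z => z.1.1) h
    have h₂ : homApp B.κ U x.1 * homApp B.ι U x.2 = homApp B.κ U y.1 * homApp B.ι U y.2 :=
      congrArg (fun z => z.1.2) h
    rw [h₁] at h₂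
    exact Prod.ext h₁ (B.ι_injective U (mul_left_cancel h₂))
  · rintro ⟨⟨h, e⟩, hx⟩
    have hx' : homApp H.del U h = homApp B.π U e := hx
    obtain ⟨g, hg⟩ := (B.exact ((homApp B.κ U h)⁻¹ * e)).1 (by
      rw [map_mul, map_inv, B.π_κ, hx', inv_mul_cancel])
    refine ⟨(h, g), Subtype.ext (Prod.ext rfl ?_)⟩
    change homApp B.κ U h * homApp B.ι U g = e
    rw [hg, mul_inv_cancel_left]

theorem isIso_θ : IsIso B.θ := isIso_of_bijective _ B.θ_bijective

variable {U : C} (P : Torsor B.E U) {T : Over U}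

theorem coord_rs_cprH {T' : Over U} (k : T' ⟶ T) (z : P.csec B.actionK.toLeftAction T)
    (p : P.sec T') : P.coord (H.leftAction.comap B.π).toLeftAction (rs (P.contr (H.leftAction.comap B.π).toLeftAction) k (B.cprH P z)) p =
      homApp B.prH T'.left (P.coord B.actionK.toLeftAction (rs (P.contr B.actionK.toLeftAction) k z) p) :=
  P.coord_rs_cmap _ _ _ (fun _ _ => rfl) k z p

theorem coord_rs_cprE {T' : Over U} (k : T' ⟶ T) (z : P.csec B.actionK.toLeftAction T)
    (p : P.sec T') : P.coord (conjAction B.E).toLeftAction (rs (P.contr (conjAction B.E).toLeftAction) k (B.cprE P z)) p =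
      homApp B.prE T'.left (P.coord B.actionK.toLeftAction (rs (P.contr B.actionK.toLeftAction) k z) p) :=
  P.coord_rs_cmap _ _ _ (fun _ _ => rfl) k z p

theorem coord_rs_cdelH {T' : Over U} (k : T' ⟶ T) (z : P.csec (H.leftAction.comap B.π).toLeftAction T)
    (p : P.sec T') : P.coord ((conjAction H.G₀).comap B.π).toLeftAction (rs (P.contr ((conjAction H.G₀).comap B.π).toLeftAction) k (B.cdelH P z)) p =
      homApp H.del T'.left (P.coord (H.leftAction.comap B.π).toLeftAction (rs (P.contr (H.leftAction.comap B.π).toLeftAction) k z) p) :=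
  P.coord_rs_cmap _ _ _ (fun e x => H.del_leftAction (homApp B.π _ e) x) k z p

theorem coord_rs_cπ {T' : Over U} (k : T' ⟶ T) (z : P.csec (conjAction B.E).toLeftAction T)
    (p : P.sec T') : P.coord ((conjAction H.G₀).comap B.π).toLeftAction (rs (P.contr ((conjAction H.G₀).comap B.π).toLeftAction) k (B.cπ P z)) p =
      homApp B.π T'.left (P.coord (conjAction B.E).toLeftAction (rs (P.contr (conjAction B.E).toLeftAction) k z) p) :=
  P.coord_rs_cmap _ _ _ (fun e x => by simp [conjAction, GroupAction.comap]) k z p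

theorem coord_rs_cfst {T' : Over U} (k : T' ⟶ T) (z : P.csec B.crossedModule.leftAction.toLeftAction T)
    (p : P.sec T') : P.coord (H.leftAction.comap B.π).toLeftAction (rs (P.contr (H.leftAction.comap B.π).toLeftAction) k (B.cfst P z)) p =
      homApp B.fstHom T'.left (P.coord B.crossedModule.leftAction.toLeftAction (rs (P.contr B.crossedModule.leftAction.toLeftAction) k z) p) :=
  P.coord_rs_cmap _ _ _ (fun {V} e x => by
    change H.act x.1 (homApp B.π V e⁻¹) = H.act x.1 (homApp B.π V e)⁻¹
    rw [map_inv]) k z p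

theorem coord_rs_csnd {T' : Over U} (k : T' ⟶ T) (z : P.csec B.crossedModule.leftAction.toLeftAction T)
    (p : P.sec T') : P.coord (G.leftAction.comap B.j).toLeftAction (rs (P.contr (G.leftAction.comap B.j).toLeftAction) k (B.csnd P z)) p =
      homApp B.sndHom T'.left (P.coord B.crossedModule.leftAction.toLeftAction (rs (P.contr B.crossedModule.leftAction.toLeftAction) k z) p) :=
  P.coord_rs_cmap _ _ _ (fun {V} e x => by
    change G.act x.2 (homApp B.j V e⁻¹) = G.act x.2 (homApp B.j V e)⁻¹
    rw [map_inv]) k z p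

/-- Projections act on coordinates by taking components, and a section is determined by its
coordinates at all local sections of `P`. -/
theorem ext_cpr {z z' : P.csec B.actionK.toLeftAction T} (h₁ : B.cprH P z = B.cprH P z')
    (h₂ : B.cprE P z = B.cprE P z') : z = z' := by
  refine P.csec_ext _ fun T' k p => Subtype.ext (Prod.ext ?_ ?_)
  · have e := congrArg (fun y => P.coord _ (rs (P.contr _) k y) p) h₁
    exact (B.coord_rs_cprH P k z p).symm.trans
      (e.trans (B.coord_rs_cprH P k z' p))
  · have e := congrArg (fun y => P.coord _ (rs (P.contr _) k y) p) h₂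
    exact (B.coord_rs_cprE P k z p).symm.trans
      (e.trans (B.coord_rs_cprE P k z' p))

theorem cdelH_cprH (z : P.csec B.actionK.toLeftAction T) :
    B.cdelH P (B.cprH P z) = B.cπ P (B.cprE P z) := by
  refine P.csec_ext _ fun T' k p => ?_
  refine (B.coord_rs_cdelH P k _ p).trans
    (Eq.trans ?_ (B.coord_rs_cπ P k _ p).symm)
  refine (congrArg _ (B.coord_rs_cprH P k z p)).trans
    (Eq.trans ?_ (congrArg _ (B.coord_rs_cprE P k z p)).symm)
  exact (P.coord _ (rs (P.contr _) k z) p).2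

/-- The pair of coordinates of `y₁` and `y₂` lies in the fibre product at every local section of
`P`, by `h`. The pairing is natural and equivariant because the action on the fibre product is
componentwise, so it defines a section. -/
theorem exists_cpr (y₁ : P.csec (H.leftAction.comap B.π).toLeftAction T)
    (y₂ : P.csec (conjAction B.E).toLeftAction T) (h : B.cdelH P y₁ = B.cπ P y₂) :
    ∃ z : P.csec B.actionK.toLeftAction T, B.cprH P z = y₁ ∧ B.cprE P z = y₂ := by
  have h' : ∀ ⦃T' : Over U⦄ (k : T' ⟶ T) (p : P.sec T'),
      homApp H.del T'.left (P.coord _ (rs (P.contr _) k y₁) p) =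
        homApp B.π T'.left (P.coord _ (rs (P.contr _) k y₂) p) := fun T' k p =>
    (B.coord_rs_cdelH P k y₁ p).symm.trans
      ((congrArg (fun y => P.coord _ (rs (P.contr _) k y) p) h).trans
        (B.coord_rs_cπ P k y₂ p))
  obtain ⟨z, hz⟩ := P.exists_csec B.actionK.toLeftAction (T := T)
    (fun T' k p => ⟨(P.coord _ (rs (P.contr _) k y₁) p, P.coord _ (rs (P.contr _) k y₂) p),
      h' k p⟩)
    (fun T' T'' k l p => Subtype.ext (Prod.ext
      ((P.coord_rs _ l _ p).symm.trans (by rw [rs_rs]))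
      ((P.coord_rs _ l _ p).symm.trans (by rw [rs_rs]))))
    (fun T' k p e => Subtype.ext (Prod.ext
      ((P.coord_act _ _ p e).trans rfl) ((P.coord_act _ _ p e).trans rfl)))
  refine ⟨z, P.csec_ext _ fun T' k p => ?_, P.csec_ext _ fun T' k p => ?_⟩
  · exact (B.coord_rs_cprH P k z p).trans (congrArg (fun x => x.1.1) (hz k p))
  · exact (B.coord_rs_cprE P k z p).trans (congrArg (fun x => x.1.2) (hz k p))

theorem range_cpr : Set.range (fun z : P.csec B.actionK.toLeftAction T =>
      (B.cprH P z, B.cprE P z)) = {y | B.cdelH P y.1 = B.cπ P y.2} := by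
  ext ⟨y₁, y₂⟩
  constructor
  · rintro ⟨z, hz⟩
    have h₁ : B.cprH P z = y₁ := congrArg Prod.fst hz
    have h₂ : B.cprE P z = y₂ := congrArg Prod.snd hz
    rw [← h₁, ← h₂]
    exact B.cdelH_cprH P z
  · intro h
    obtain ⟨z, h₁, h₂⟩ := B.exists_cpr P y₁ y₂ h
    exact ⟨z, Prod.ext h₁ h₂⟩

/-- The argument is that of the fibre product without a compatibility condition: coordinates in the
product are pairs of coordinates. -/
theorem bijective_cfst_csnd : Function.Bijective
    (fun z : P.csec B.crossedModule.leftAction.toLeftAction T => (B.cfst P z, B.csnd P z)) := by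
  constructor
  · intro z z' h
    refine P.csec_ext _ fun T' k p => Prod.ext ?_ ?_
    · have e := congrArg (fun y => P.coord _ (rs (P.contr _) k y.1) p) h
      exact (B.coord_rs_cfst P k z p).symm.trans
        (e.trans (B.coord_rs_cfst P k z' p))
    · have e := congrArg (fun y => P.coord _ (rs (P.contr _) k y.2) p) h
      exact (B.coord_rs_csnd P k z p).symm.trans
        (e.trans (B.coord_rs_csnd P k z' p))
  · rintro ⟨y₁, y₂⟩
    obtain ⟨z, hz⟩ := P.exists_csec B.crossedModule.leftAction.toLeftAction (T := T)
      (fun T' k p => (P.coord _ (rs (P.contr _) k y₁) p, P.coord _ (rs (P.contr _) k y₂) p))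
      (fun T' T'' k l p => Prod.ext
        ((P.coord_rs _ l _ p).symm.trans (by rw [rs_rs]))
        ((P.coord_rs _ l _ p).symm.trans (by rw [rs_rs])))
      (fun T' k p e => Prod.ext
        ((P.coord_act _ _ p e).trans (by
          -- The left action of `E_•` inverts in `E` before applying `π`, while the action on `H₁`
          -- alone inverts in `H₀` afterwards.
          change H.act _ (homApp B.π _ e⁻¹)⁻¹ = H.act _ (homApp B.π _ e⁻¹⁻¹)
          rw [← map_inv]))
        ((P.coord_act _ _ p e).trans (by
          change G.act _ (homApp B.j _ e⁻¹)⁻¹ = G.act _ (homApp B.j _ e⁻¹⁻¹)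
          rw [← map_inv])))
    refine ⟨z, Prod.ext (P.csec_ext _ fun T' k p => ?_) (P.csec_ext _ fun T' k p => ?_)⟩
    · exact (B.coord_rs_cfst P k z p).trans (congrArg (fun x => x.1) (hz k p))
    · exact (B.coord_rs_csnd P k z p).trans (congrArg (fun x => x.2) (hz k p))

end Butterfly

/-! ### Coordinates along arrows, and endomorphisms of a torsor as sections of `P ∧ G`. -/

namespace Torsor

variable {G H X Y : GroupSheaf J} {U : C}

/-- The coordinate of the restriction of `z` to `a : W ⟶ U` with respect to `p`. -/
noncomputable def cd (P : Torsor G U) (a : LeftAction G X) {T : Over U} (z : P.csec a T) {W : C}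
    (t : W ⟶ T.left) {b : W ⟶ U} (h : t ≫ T.hom = b) (p : P.sec (Over.mk b)) : X.sec W :=
  P.coord a (rs (P.contr a) (Over.homMk t h : Over.mk b ⟶ T) z) p

theorem cd_ext (P : Torsor G U) (a : LeftAction G X) {T : Over U} {z z' : P.csec a T}
    (h : ∀ {W : C} (t : W ⟶ T.left) {b : W ⟶ U} (h : t ≫ T.hom = b) (p : P.sec (Over.mk b)),
      P.cd a z t h p = P.cd a z' t h p) : z = z' := by
  refine P.csec_ext a fun T' k p => ?_
  exact h k.left (Over.w k) p

theorem cd_rr (P : Torsor G U) (a : LeftAction G X) {T : Over U} (z : P.csec a T) {W W' : C}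
    (t : W ⟶ T.left) {b : W ⟶ U} (h : t ≫ T.hom = b) (p : P.sec (Over.mk b)) (l : W' ⟶ W)
    {t' : W' ⟶ T.left} {b' : W' ⟶ U} (e : l ≫ b = b') (ht : l ≫ t = t') :
    P.cd a z t' (by rw [← ht, Category.assoc, h, e]) (P.rr l e p) = X.res l (P.cd a z t h p) := by
  subst ht
  refine Eq.trans ?_ (P.coord_rs a (Over.homMk l e : Over.mk b' ⟶ Over.mk b) _ p)
  rw [rs_rs]
  rfl

theorem cd_act (P : Torsor G U) (a : LeftAction G X) {T : Over U} (z : P.csec a T) {W : C}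
    (t : W ⟶ T.left) {b : W ⟶ U} (h : t ≫ T.hom = b) (p : P.sec (Over.mk b)) (g : G.sec W) :
    P.cd a z t h (P.act (T := Over.mk b) p g) = a.smul g⁻¹ (P.cd a z t h p) :=
  P.coord_act a (T := Over.mk b) _ p g

theorem cd_rs (P : Torsor G U) (a : LeftAction G X) {T T' : Over U} (k : T' ⟶ T)
    (z : P.csec a T) {W : C} (t : W ⟶ T'.left) {b : W ⟶ U} (h : t ≫ T'.hom = b)
    (p : P.sec (Over.mk b)) : P.cd a (rs (P.contr a) k z) t h p =
      P.cd a z (t ≫ k.left) (by rw [Category.assoc, Over.w, h]) p := by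
  unfold cd
  rw [rs_rs]
  rfl

theorem cd_mul (P : Torsor G U) (a : GroupAction G X) {T : Over U}
    (z w : P.csec a.toLeftAction T) {W : C} (t : W ⟶ T.left) {b : W ⟶ U} (h : t ≫ T.hom = b)
    (p : P.sec (Over.mk b)) : P.cd a.toLeftAction (z * w) t h p =
      P.cd a.toLeftAction z t h p * P.cd a.toLeftAction w t h p := by
  unfold cd
  rw [rs_mul, coord_mul]

theorem cd_mapTorsor {P P' : Torsor G U} (φ : P ⟶ P') (a : LeftAction G X) {T : Over U}
    (z : P.csec a T) {W : C} (t : W ⟶ T.left) {b : W ⟶ U} (h : t ≫ T.hom = b)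
    (p : P.sec (Over.mk b)) :
    P'.cd a (mapTorsor φ a z) t h (ap φ p) = P.cd a z t h p :=
  coord_rs_mapTorsor φ a _ z p

theorem cd_mapTorsor' {P P' : Torsor G U} (φ : P ⟶ P') (a : LeftAction G X) {T : Over U}
    (z : P.csec a T) {W : C} (t : W ⟶ T.left) {b : W ⟶ U} (h : t ≫ T.hom = b)
    (p : P'.sec (Over.mk b)) :
    P'.cd a (mapTorsor φ a z) t h p = P.cd a z t h (ap (inv φ) p) := by
  rw [← cd_mapTorsor φ, ← ap_comp, IsIso.inv_hom_id, ap_id]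

theorem cd_cmap (P : Torsor G U) (a : LeftAction G X) (b : LeftAction G Y) (u : X ⟶ Y)
    (hu : ∀ {V : C} (g : G.sec V) (x : X.sec V),
      homApp u V (a.smul g x) = b.smul g (homApp u V x)) {T : Over U}
    (z : P.csec a T) {W : C} (t : W ⟶ T.left) {c : W ⟶ U} (h : t ≫ T.hom = c)
    (p : P.sec (Over.mk c)) :
    P.cd b (P.cmap a b u hu z) t h p = homApp u W (P.cd a z t h p) :=
  P.coord_rs_cmap a b u hu _ z p

theorem cd_assoc (φ : G ⟶ H) (P : Torsor G U) (a : GroupAction H X) {T : Over U}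
    (z : (P.extend φ).csec a.toLeftAction T) {W : C} (t : W ⟶ T.left) {c : W ⟶ U}
    (h : t ≫ T.hom = c) (p : P.sec (Over.mk c)) :
    P.cd (a.comap φ).toLeftAction (P.assoc φ a z) t h p =
      (P.extend φ).cd a.toLeftAction z t h (P.unit φ p) :=
  P.coord_rs_assoc φ a _ z p

theorem cd_baseChange (P : Torsor G U) (a : LeftAction G X) {V : C} (f : V ⟶ U) {T : Over V}
    (z : P.csec a ((Over.map f).obj T)) {W : C} (t : W ⟶ T.left) {b : W ⟶ V}
    (h : t ≫ T.hom = b) (p : P.sec (Over.mk (b ≫ f))) :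
    (P.pullback f).cd a (P.baseChange a f z) t h p =
      P.cd a z (T := (Over.map f).obj T) t (b := b ≫ f)
        (by rw [← h, Category.assoc]; rfl) p :=
  P.coord_rs_baseChange a f (Over.homMk t h : Over.mk b ⟶ T) z p

/-- The section `z` of `P ∧ᴳ G` corresponds to the endomorphism `α` of `P`. -/
def IsAd (P : Torsor G U) {T : Over U} (z : P.csec (conjAction G).toLeftAction T)
    (α : P.pullback T.hom ⟶ P.pullback T.hom) : Prop :=
  ∀ ⦃W : C⦄ (t : W ⟶ T.left) ⦃b : W ⟶ U⦄ (h : t ≫ T.hom = b) (p : P.sec (Over.mk b)),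
    vl α t h h p = P.act (T := Over.mk b) p (P.cd (conjAction G).toLeftAction z t h p)

theorem isAd_autToAd (P : Torsor G U) {T : Over U} (α : Aut (P.pullback T.hom)) :
    P.IsAd (P.autToAd T α) α.hom := by
  intro W t b h p
  have e : P.cd (conjAction G).toLeftAction (P.autToAd T α) t h p =
      (P.pullback T.hom).diff (T := Over.mk t)
        (P.shift (Over.homMk t h : Over.mk b ⟶ T) p)
        (ap α.hom (P.shift (Over.homMk t h : Over.mk b ⟶ T) p)) :=
    P.coord_rs_ofCoord _ _ _ _ (Over.homMk t h : Over.mk b ⟶ T) p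
  rw [e]
  have e' := (P.pullback T.hom).act_diff (T := Over.mk t)
    (P.shift (Over.homMk t h : Over.mk b ⟶ T) p)
    (ap α.hom (P.shift (Over.homMk t h : Over.mk b ⟶ T) p))
  -- The coordinate was defined with `p` relabelled as a section over `t ≫ T.hom`; a restriction
  -- along an identity undoes the relabelling.
  have e'' := congrArg (P.rr (a := t ≫ T.hom) (a' := b) (𝟙 W) (by rw [h, Category.id_comp])) e'
  refine Eq.trans e''.symm ?_
  refine (P.rr_act (a := t ≫ T.hom) (𝟙 W) _ _ _).trans ?_
  refine congrArg₂ (P.act (T := Over.mk b)) ?_ (G.res_id _)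
  refine (P.rr_rr (a := b) (a' := t ≫ T.hom) (𝟙 W) _ (𝟙 W) _ p).trans ?_
  refine (P.rr_congr (Category.comp_id _) _ (Category.id_comp _) p).trans ?_
  exact P.rr_id _ p

/-- The action on `P` is free, so the endomorphism determines the coordinates. Together with
`IsAd.hom_unique` and `exists_isAd`, this makes `IsAd` the graph of a bijection, and equalities of
sections can be proved by exhibiting a common endomorphism. -/
theorem IsAd.unique {P : Torsor G U} {T : Over U} {z z' : P.csec (conjAction G).toLeftAction T}
    {α : P.pullback T.hom ⟶ P.pullback T.hom} (h : P.IsAd z α) (h' : P.IsAd z' α) : z = z' :=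
  P.cd_ext _ fun {_} t {b} e p => P.act_left_cancel (T := Over.mk b) (p := p)
    ((h t e p).symm.trans (h' t e p))

theorem IsAd.hom_unique {P : Torsor G U} {T : Over U}
    {z : P.csec (conjAction G).toLeftAction T}
    {α β : P.pullback T.hom ⟶ P.pullback T.hom} (h : P.IsAd z α) (h' : P.IsAd z β) : α = β :=
  vl_hom_ext fun t p => (h t rfl p).trans (h' t rfl p).symm

theorem conj_smul (g x : G.sec U) : g * (conjAction G).smul g⁻¹ x = x * g := by
  simp [conjAction, mul_assoc]

/-- The endomorphism is `p ↦ p z_p`, where `z_p` is the coordinate at `p`. It is equivariant because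
the coordinate at `p g` is `g⁻¹ z_p g`. -/
theorem exists_isAd (P : Torsor G U) {T : Over U} (z : P.csec (conjAction G).toLeftAction T) :
    ∃ α : P.pullback T.hom ⟶ P.pullback T.hom, P.IsAd z α := by
  refine ⟨ofVl (M₁ := P) (M₂ := P) (f₁ := T.hom) (f₂ := T.hom) (fun {W} t p =>
    P.act (T := Over.mk (t ≫ T.hom)) p (P.cd (conjAction G).toLeftAction z t rfl p))
    (fun {W W'} t l p => ?_) (fun {W} t p g => ?_), fun {W} t b h p => ?_⟩
  · rw [P.cd_rr _ z t rfl p l _ rfl, rr_act]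
  · rw [cd_act, ← P.act_mul, ← P.act_mul]
    exact congrArg _ (conj_smul g _)
  · subst h
    exact vl_ofVl _ _ _ _ _

/-- The composite applies `β` first: `p ↦ p w_p ↦ α(p) w_p = p z_p w_p`. This agrees with the
product in `Aut`, where `α * β` means `β` followed by `α`. -/
theorem IsAd.mul {P : Torsor G U} {T : Over U} {z w : P.csec (conjAction G).toLeftAction T}
    {α β : P.pullback T.hom ⟶ P.pullback T.hom} (h : P.IsAd z α) (h' : P.IsAd w β) :
    P.IsAd (z * w) (β ≫ α) := by
  intro W t b e p
  rw [vl_comp β α t e e e, h' t e p, vl_act, h t e p, cd_mul]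
  exact (P.act_mul (T := Over.mk b) p _ _).symm

theorem IsAd.rs {P : Torsor G U} {T T' : Over U} {z : P.csec (conjAction G).toLeftAction T}
    {α : P.pullback T.hom ⟶ P.pullback T.hom} (h : P.IsAd z α) (k : T' ⟶ T) :
    P.IsAd (ButterflyGerbe.rs _ k z) (pl α k.left T'.hom T'.hom (Over.w k) (Over.w k)) := by
  intro W t b e p
  rw [vl_pl, h, cd_rs]

theorem vl_naturality {P P' : Torsor G U} (φ : P ⟶ P') {Y : C} {f : Y ⟶ U}
    {α : P.pullback f ⟶ P.pullback f} {α' : P'.pullback f ⟶ P'.pullback f}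
    (e : α ≫ pullbackMap φ f = pullbackMap φ f ≫ α') {W : C} (t : W ⟶ Y) {b : W ⟶ U}
    (h : t ≫ f = b) (p : P.sec (Over.mk b)) :
    vl α' t h h (ap φ p) = ap φ (vl α t h h p) := by
  have e' := congrArg (fun χ => vl χ t h h p) e
  simp only [vl_comp _ _ t h h h, vl_pullbackMap] at e'
  exact e'.symm

/-- Every local section of `P'` is the image of one of `P`, and at such a section both the
coordinate and the conjugated endomorphism are transported unchanged. -/
theorem IsAd.mapTorsor {P P' : Torsor G U} (φ : P ⟶ P') {T : Over U}
    {z : P.csec (conjAction G).toLeftAction T} {α : P.pullback T.hom ⟶ P.pullback T.hom}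
    {α' : P'.pullback T.hom ⟶ P'.pullback T.hom} (hz : P.IsAd z α)
    (e : α ≫ pullbackMap φ T.hom = pullbackMap φ T.hom ≫ α') :
    P'.IsAd (Torsor.mapTorsor φ _ z) α' := by
  intro W t b h p
  obtain ⟨p, rfl⟩ := (ap_bijective φ (Over.mk b)).2 p
  change vl α' t h h (ap φ p) = P'.act (T := Over.mk b) (ap φ p) _
  rw [vl_naturality φ e, hz t h p, ap_act, ← cd_mapTorsor φ]

end Torsor

/-! ### Compatibilities between the operations on contracted products. -/

namespace Torsor

variable {G H X Y : GroupSheaf J} {U : C}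

theorem mapTorsor_comp {P P' P'' : Torsor G U} (φ : P ⟶ P') (ψ : P' ⟶ P'') (a : LeftAction G X)
    {T : Over U} (z : P.csec a T) :
    mapTorsor (φ ≫ ψ) a z = mapTorsor ψ a (mapTorsor φ a z) := by
  refine P''.cd_ext a fun {W} t {b} h p => ?_
  rw [cd_mapTorsor', cd_mapTorsor', cd_mapTorsor', IsIso.inv_comp, ap_comp]

theorem mapTorsor_id (P : Torsor G U) (a : LeftAction G X) {T : Over U} (z : P.csec a T) :
    mapTorsor (𝟙 P) a z = z := by
  refine P.cd_ext a fun {W} t {b} h p => ?_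
  rw [cd_mapTorsor', IsIso.inv_id, ap_id]

theorem mapTorsor_bijective {P P' : Torsor G U} (φ : P ⟶ P') (a : LeftAction G X) (T : Over U) :
    Function.Bijective (mapTorsor (T := T) φ a) := by
  refine Function.bijective_iff_has_inverse.2 ⟨mapTorsor (inv φ) a, fun z => ?_, fun z => ?_⟩
  · rw [← mapTorsor_comp, IsIso.hom_inv_id, mapTorsor_id]
  · rw [← mapTorsor_comp, IsIso.inv_hom_id, mapTorsor_id]

theorem mapTorsor_mul {P P' : Torsor G U} (φ : P ⟶ P') (a : GroupAction G X) {T : Over U}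
    (z w : P.csec a.toLeftAction T) : mapTorsor φ a.toLeftAction (z * w) =
      mapTorsor φ a.toLeftAction z * mapTorsor φ a.toLeftAction w := by
  refine P'.cd_ext _ fun {W} t {b} h p => ?_
  simp only [cd_mapTorsor', cd_mul]

theorem cmap_mapTorsor {P P' : Torsor G U} (φ : P ⟶ P') (a : LeftAction G X)
    (b : LeftAction G Y) (u : X ⟶ Y) (hu : ∀ {V : C} (g : G.sec V) (x : X.sec V),
      homApp u V (a.smul g x) = b.smul g (homApp u V x)) {T : Over U} (z : P.csec a T) :
    P'.cmap a b u hu (mapTorsor φ a z) = mapTorsor φ b (P.cmap a b u hu z) := by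
  refine P'.cd_ext _ fun {W} t {c} h p => ?_
  rw [cd_cmap, cd_mapTorsor', cd_mapTorsor', cd_cmap]

theorem cmap_mul (P : Torsor G U) (a : GroupAction G X)
    (b : GroupAction G Y) (u : X ⟶ Y) (hu : ∀ {V : C} (g : G.sec V) (x : X.sec V),
      homApp u V (a.smul g x) = b.smul g (homApp u V x)) {T : Over U}
    (z w : P.csec a.toLeftAction T) :
    P.cmap a.toLeftAction b.toLeftAction u hu (z * w) =
      P.cmap a.toLeftAction b.toLeftAction u hu z *
        P.cmap a.toLeftAction b.toLeftAction u hu w := by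
  refine P.cd_ext _ fun {W} t {c} h p => ?_
  simp only [cd_cmap, cd_mul, map_mul]

theorem rs_cmap (P : Torsor G U) (a : LeftAction G X)
    (b : LeftAction G Y) (u : X ⟶ Y) (hu : ∀ {V : C} (g : G.sec V) (x : X.sec V),
      homApp u V (a.smul g x) = b.smul g (homApp u V x)) {T T' : Over U} (k : T' ⟶ T)
    (z : P.csec a T) :
    P.cmap a b u hu (rs (P.contr a) k z) = rs (P.contr b) k (P.cmap a b u hu z) := by
  refine P.cd_ext _ fun {W} t {c} h p => ?_
  simp only [cd_cmap, cd_rs]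

theorem cmap_baseChange (P : Torsor G U) (a : LeftAction G X)
    (b : LeftAction G Y) (u : X ⟶ Y) (hu : ∀ {V : C} (g : G.sec V) (x : X.sec V),
      homApp u V (a.smul g x) = b.smul g (homApp u V x)) {V : C} (f : V ⟶ U) {T : Over V}
    (z : P.csec a ((Over.map f).obj T)) :
    (P.pullback f).cmap a b u hu (P.baseChange a f z) = P.baseChange b f (P.cmap a b u hu z) := by
  refine (P.pullback f).cd_ext _ fun {W} t {c} h p => ?_
  rw [cd_cmap]
  refine (congrArg _ (P.cd_baseChange a f z t h p)).trans
    (Eq.trans ?_ (P.cd_baseChange b f _ t h p).symm)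
  exact (P.cd_cmap a b u hu (T := (Over.map f).obj T) z t _ p).symm

/-- Preimages under `u` can be chosen coordinate by coordinate; injectivity of `u` forces the
choices to be natural and equivariant. -/
theorem cmap_bijective (P : Torsor G U) (a : LeftAction G X)
    (b : LeftAction G Y) (u : X ⟶ Y) (hu : ∀ {V : C} (g : G.sec V) (x : X.sec V),
      homApp u V (a.smul g x) = b.smul g (homApp u V x))
    (h : ∀ V, Function.Bijective (homApp u V)) (T : Over U) :
    Function.Bijective (P.cmap (T := T) a b u hu) := by
  constructor
  · intro z z' e
    refine P.cd_ext _ fun {W} t {c} hc p => (h _).1 ?_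
    rw [← P.cd_cmap a b u hu, e, P.cd_cmap a b u hu]
  · intro y
    choose v hv using fun V => (h V).2
    obtain ⟨z, hz⟩ := P.exists_csec a (T := T)
      (fun T' k p => v _ (P.coord b (rs (P.contr b) k y) p))
      (fun T' T'' k l p => (h _).1 (by
        rw [homApp_res, hv, hv, ← coord_rs, rs_rs]))
      (fun T' k p g => (h _).1 (by
        rw [hu, hv, hv, coord_act]))
    refine ⟨z, P.csec_ext b fun T' k p => ?_⟩
    rw [coord_rs_cmap, hz, hv]

theorem mapTorsor_pullbackMap_baseChange {P P' : Torsor G U} (φ : P ⟶ P') (a : LeftAction G X)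
    {V : C} (f : V ⟶ U) {T : Over V} (z : P.csec a ((Over.map f).obj T)) :
    mapTorsor (pullbackMap φ f) a (P.baseChange a f z) = P'.baseChange a f (mapTorsor φ a z) := by
  refine (P'.pullback f).cd_ext _ fun {W} t {b} h p => ?_
  obtain ⟨p, rfl⟩ := (ap_bijective (pullbackMap φ f) (Over.mk b)).2 p
  refine (cd_mapTorsor (pullbackMap φ f) a _ t h p).trans ?_
  refine (P.cd_baseChange a f z t h p).trans (Eq.trans ?_ (P'.cd_baseChange a f _ t h _).symm)
  exact (cd_mapTorsor φ a (T := (Over.map f).obj T) z t _ p).symm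

section Extend

variable (φ : G ⟶ H) (P : Torsor G U) (a : GroupAction H X)

/-- The coordinates of `assoc z` at `p` are those of `z` at `p ∧ 1`, and sections of the form `p ∧
1` exist locally. -/
theorem assoc_injective (T : Over U) : Function.Injective (P.assoc (T := T) φ a) := by
  intro z z' h
  refine P.sec_ext ((P.extend φ).contr a.toLeftAction) fun T' k p => ?_
  refine (P.extend φ).csec_ext_of _ (P.unit φ p) ?_
  rw [← coord_rs_assoc, h, coord_rs_assoc]

/-- A preimage is locally `(p ∧ 1) ∧ y_p`. Replacing `p` by `p g` multiplies `p ∧ 1` by `φ g` and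
acts on the coordinate by `(φ g)⁻¹`, so the expression does not depend on `p` and descends. -/
theorem assoc_surjective (T : Over U) : Function.Surjective (P.assoc (T := T) φ a) := by
  intro y
  obtain ⟨z, hz⟩ := P.descend ((P.extend φ).contr a.toLeftAction) T
    (fun T' k p => (P.extend φ).wedge a.toLeftAction (P.unit φ p)
      (P.coord (a.comap φ).toLeftAction (rs _ k y) p))
    (fun T' T'' k l p => by rw [rs_wedge, res_unit, ← coord_rs, rs_rs])
    (fun T' k p g => by
      rw [unit_act, wedge_act, coord_act]
      refine congrArg _ ?_
      change a.smul (homApp φ _ g) (a.smul (homApp φ _ g⁻¹) _) = _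
      rw [map_inv, a.smul_inv_smul])
  refine ⟨z, P.csec_ext _ fun T' k p => ?_⟩
  rw [coord_rs_assoc, hz k p, coord_wedge]

theorem assoc_mul {T : Over U} (z w : (P.extend φ).csec a.toLeftAction T) :
    P.assoc φ a (z * w) = P.assoc φ a z * P.assoc φ a w := by
  refine P.cd_ext _ fun {W} t {b} h p => ?_
  simp only [cd_assoc, cd_mul]

theorem rs_assoc {T T' : Over U} (k : T' ⟶ T) (z : (P.extend φ).csec a.toLeftAction T) :
    P.assoc φ a (rs _ k z) = rs _ k (P.assoc φ a z) := by
  refine P.cd_ext _ fun {W} t {b} h p => ?_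
  simp only [cd_assoc, cd_rs]

theorem cmap_assoc (a' : GroupAction H Y) (u : X ⟶ Y)
    (hu : ∀ {V : C} (g : H.sec V) (x : X.sec V),
      homApp u V (a.smul g x) = a'.smul g (homApp u V x))
    (hu' : ∀ {V : C} (g : G.sec V) (x : X.sec V),
      homApp u V ((a.comap φ).smul g x) = (a'.comap φ).smul g (homApp u V x)) {T : Over U}
    (z : (P.extend φ).csec a.toLeftAction T) :
    P.cmap (a.comap φ).toLeftAction (a'.comap φ).toLeftAction u hu' (P.assoc φ a z) =
      P.assoc φ a' ((P.extend φ).cmap a.toLeftAction a'.toLeftAction u hu z) := by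
  refine P.cd_ext _ fun {W} t {b} h p => ?_
  rw [cd_cmap, cd_assoc, cd_assoc, cd_cmap]

theorem assoc_mapTorsor {P P' : Torsor G U} (ψ : P ⟶ P') {T : Over U}
    (z : (P.extend φ).csec a.toLeftAction T) :
    P'.assoc φ a (mapTorsor (extendMap φ ψ) a.toLeftAction z) =
      mapTorsor ψ _ (P.assoc φ a z) := by
  refine P'.cd_ext _ fun {W} t {b} h p => ?_
  obtain ⟨p, rfl⟩ := (ap_bijective ψ (Over.mk b)).2 p
  change P'.cd _ _ t h (ap ψ p) = P'.cd _ _ t h (ap ψ p)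
  rw [cd_mapTorsor, cd_assoc, cd_assoc, ← ap_extendMap_unit, cd_mapTorsor]

/-- Both sides have the same coordinates, since the comparison of `φ_*` with pullback matches `p ∧
1` with `p ∧ 1`. -/
theorem assoc_baseChange {V : C} (f : V ⟶ U) {T : Over V}
    (z : (P.extend φ).csec a.toLeftAction ((Over.map f).obj T)) :
    (P.pullback f).assoc φ a (mapTorsor (P.extendPullback φ f) a.toLeftAction
      ((P.extend φ).baseChange a.toLeftAction f z)) =
      P.baseChange (a.comap φ).toLeftAction f (P.assoc φ a z) := by
  refine (P.pullback f).cd_ext _ fun {W} t {b} h p => ?_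
  rw [cd_assoc]
  refine Eq.trans ?_ (P.cd_baseChange _ f _ t h p).symm
  refine Eq.trans ?_ (P.cd_assoc φ a (T := (Over.map f).obj T) z t _ p).symm
  have e := P.ap_extendPullback_unit φ f (T := Over.mk b) p
  refine (congrArg (fun q => ((P.pullback f).extend φ).cd a.toLeftAction
    (mapTorsor (P.extendPullback φ f) a.toLeftAction
      ((P.extend φ).baseChange a.toLeftAction f z)) t h q) e.symm).trans ?_
  refine (cd_mapTorsor (P.extendPullback φ f) a.toLeftAction
    ((P.extend φ).baseChange a.toLeftAction f z) t h (P.unit φ p)).trans ?_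
  exact (P.extend φ).cd_baseChange a.toLeftAction f z t h _

/-- The endomorphism of `φ_* P` induced by an endomorphism of `P`. -/
noncomputable def extHom {P : Torsor G U} {V : C} {f : V ⟶ U} (α : P.pullback f ⟶ P.pullback f) :
    (P.extend φ).pullback f ⟶ (P.extend φ).pullback f :=
  (extendPullbackIso φ f P).inv ≫ extendMap φ α ≫ (extendPullbackIso φ f P).hom

theorem vl_extHom {P : Torsor G U} {V : C} {f : V ⟶ U} (α : P.pullback f ⟶ P.pullback f) {W : C}
    (t : W ⟶ V) {b : W ⟶ U} (h : t ≫ f = b) (p : P.sec (Over.mk b)) :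
    vl (extHom φ α) t h h (P.unit φ p) = P.unit φ (vl α t h h p) := by
  subst h
  rw [vl_rfl, vl_rfl]
  have e₁ : ap (extendPullbackIso φ f P).inv (T := Over.mk t)
      (P.unit φ (T := (Over.map f).obj (Over.mk t)) p) = (P.pullback f).unit φ (T := Over.mk t) p :=
    P.ap_extendPullback_unit φ f (T := Over.mk t) p
  refine (congrArg (fun z => ap (extendPullbackIso φ f P).hom (T := Over.mk t)
    (ap (extendMap φ α) (T := Over.mk t) z)) e₁).trans ?_
  refine (congrArg (fun z => ap (extendPullbackIso φ f P).hom (T := Over.mk t) z)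
    (ap_extendMap_unit φ α (T := Over.mk t) p)).trans ?_
  exact ap_extendPullbackIso_unit φ f P (T := Over.mk t) _

/-- If `α p = p g`, then the induced endomorphism sends `p ∧ 1` to `p g ∧ 1 = (p ∧ 1) φ(g)`, so its
coordinate at `p ∧ 1` is `φ g`. -/
theorem IsAd.assoc_extHom {P : Torsor G U} {T : Over U}
    {z : P.csec (conjAction G).toLeftAction T} {α : P.pullback T.hom ⟶ P.pullback T.hom}
    (hz : P.IsAd z α) {z' : (P.extend φ).csec (conjAction H).toLeftAction T}
    (hz' : (P.extend φ).IsAd z' (extHom φ α))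
    (hu : ∀ {V : C} (g : G.sec V) (x : G.sec V), homApp φ V ((conjAction G).smul g x) =
      ((conjAction H).comap φ).smul g (homApp φ V x)) :
    P.assoc φ (conjAction H) z' =
      P.cmap (conjAction G).toLeftAction ((conjAction H).comap φ).toLeftAction φ hu z := by
  refine P.cd_ext _ fun {W} t {b} h p => ?_
  rw [cd_assoc, cd_cmap]
  refine (P.extend φ).act_left_cancel (T := Over.mk b) (p := P.unit φ p) ?_
  rw [← hz' t h, vl_extHom, hz t h]
  exact P.unit_act φ (T := Over.mk b) p _

/-- An equation between endomorphisms of `φ_* P` becomes an equation in `P ∧ H`. The converse uses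
the injectivity of `assoc` and the fact that a section determines its endomorphism. -/
theorem extHom_eq_iff {P : Torsor G U} {T : Over U}
    {z : P.csec (conjAction G).toLeftAction T} {α : P.pullback T.hom ⟶ P.pullback T.hom}
    (hz : P.IsAd z α) {z' : (P.extend φ).csec (conjAction H).toLeftAction T}
    {α' : (P.extend φ).pullback T.hom ⟶ (P.extend φ).pullback T.hom}
    (hz' : (P.extend φ).IsAd z' α')
    (hu : ∀ {V : C} (g : G.sec V) (x : G.sec V), homApp φ V ((conjAction G).smul g x) =
      ((conjAction H).comap φ).smul g (homApp φ V x)) :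
    α' = extHom φ α ↔ P.assoc φ (conjAction H) z' =
      P.cmap (conjAction G).toLeftAction ((conjAction H).comap φ).toLeftAction φ hu z := by
  constructor
  · rintro rfl
    exact hz.assoc_extHom φ hz' hu
  · intro h
    -- The induced endomorphism is automatically invertible, hence has a section of its own, to be
    -- compared with `z'`.
    have hw := (P.extend φ).isAd_autToAd (T := T)
      (@asIso _ _ _ _ (extHom φ α) (isIso_hom _))
    have e := hz.assoc_extHom φ hw hu
    rw [← h] at e
    have e' := P.assoc_injective φ _ T e
    refine hz'.hom_unique (β := extHom φ α) ?_
    rw [← e']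
    exact hw

end Extend

theorem IsAd.baseChange {P : Torsor G U} {V : C} (f : V ⟶ U) {T : Over V}
    {z : P.csec (conjAction G).toLeftAction ((Over.map f).obj T)}
    {α : P.pullback (T.hom ≫ f) ⟶ P.pullback (T.hom ≫ f)}
    (hz : P.IsAd (T := (Over.map f).obj T) z α) :
    (P.pullback f).IsAd (T := T) (Torsor.baseChange P (conjAction G).toLeftAction f z)
      ((P.pullbackComp T.hom f).inv ≫ α ≫ (P.pullbackComp T.hom f).hom) := by
  intro W t b h p
  subst h
  rw [vl_rfl]
  refine Eq.trans ?_ ((hz t (b := (t ≫ T.hom) ≫ f) (Category.assoc _ _ _).symm p).trans ?_)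
  · exact congrArg (fun x => ap (P.pullbackComp T.hom f).hom (T := Over.mk t)
      (ap α (T := Over.mk t) x)) (P.ap_pullbackComp_inv T.hom f (T := Over.mk t) p)
  · exact congrArg (fun g => P.act (T := Over.mk ((t ≫ T.hom) ≫ f)) p g)
      (P.cd_baseChange _ f z t rfl p).symm

end Torsor

/-! ### Automorphisms of a triple as sections of a contracted product. -/

/-- Presheaves of groups are isomorphic if their groups of sections are naturally so. -/
noncomputable def isoOfBijective {D : Type u₁} [Category.{v₁} D] {A A' : Dᵒᵖ ⥤ GrpCat.{w}}
    (e : ∀ T : D, A.obj (op T) →* A'.obj (op T))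
    (nat : ∀ {T' T : D} (k : T' ⟶ T) (x : A.obj (op T)),
      e T' (A.map k.op x) = A'.map k.op (e T x))
    (bij : ∀ T, Function.Bijective (e T)) : A ≅ A' :=
  NatIso.ofComponents (fun T => (MulEquiv.ofBijective (e T.unop) (bij T.unop)).toGrpIso)
    (fun {T T'} k => by
      ext x
      exact nat k.unop x)

section AdApp

open Bicategory Pseudofunctor Fibred

variable {F : Fibred C} {U : C} {x : F.obj ⟨op U⟩} {G X : GroupSheaf J} {P : Torsor G U}
  {a : GroupAction G X} (i : autPresheaf F x ≅ P.twist a)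

theorem adApp_bijective (T : Over U) :
    Function.Bijective (fun α : AutOver F x T => adApp i α) :=
  (ConcreteCategory.isIso_iff_bijective (i.hom.app (op T))).1 inferInstance

theorem adApp_mul {T : Over U} (α β : AutOver F x T) :
    adApp i (α * β) = adApp i α * adApp i β :=
  map_mul (i.hom.app (op T)).hom α β

theorem adApp_resAut {T' T : Over U} (k : T' ⟶ T) (α : AutOver F x T) :
    adApp i (resAut F x k α) = rs _ k (adApp i α) :=
  ConcreteCategory.congr_hom (i.hom.naturality k.op) α

end AdApp

namespace Fibred

open Bicategory Pseudofunctor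

theorem mapAut_resAut {F K : Fibred C} (μ : StrongTrans F K) {U : C} (x : F.obj ⟨op U⟩) {T T' : Over U}
    (l : T' ⟶ T) (α : AutOver F x T) :
    mapAut μ x T' (resAut F x l α) = resAut K _ l (mapAut μ x T α) := by
  refine Iso.ext ?_
  rw [mapAut_hom, resAut_hom, resAut_hom, mapAut_hom]
  exact (pullHom_homMap μ α.hom l.left T'.hom T'.hom (Over.w l) (Over.w l)).symm

end Fibred

namespace Butterfly

open Bicategory Pseudofunctor Fibred

variable {H G : CrossedModule J} (B : Butterfly H G)

/-- Transport `β` along `s` to an endomorphism of `π_* P`. Its section, read in `P ∧ H₀`, is the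
left-hand side, while `id ∧ π` of `w` is the section of `π_* γ`. Hence equality in `P ∧ H₀` is
precisely the square that makes `(β, γ)` compatible with `s`. -/
theorem cdelH_assoc_eq_iff {U : C} {N : Torsor H.G₀ U} {P : Torsor B.E U}
    (s : N ⟶ P.extend B.π) {T : Over U} {y : N.csec H.leftAction.toLeftAction T}
    {w : P.csec (conjAction B.E).toLeftAction T} {β : N.pullback T.hom ⟶ N.pullback T.hom}
    (hβ : N.IsAd (H.cdel N y) β) {γ : P.pullback T.hom ⟶ P.pullback T.hom} (hγ : P.IsAd w γ) :
    B.cdelH P (P.assoc B.π H.leftAction (Torsor.mapTorsor s H.leftAction.toLeftAction y)) =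
        B.cπ P w ↔
      β ≫ Torsor.pullbackMap s T.hom = Torsor.pullbackMap s T.hom ≫ Torsor.extHom B.π γ := by
  have := Torsor.isIso_hom (Torsor.pullbackMap s T.hom)
  have hβ' := @Torsor.IsAd.mapTorsor _ _ _ _ _ _ _ s T _ β
    (inv (Torsor.pullbackMap s T.hom) ≫ β ≫ Torsor.pullbackMap s T.hom) hβ
    (IsIso.hom_inv_id_assoc _ _).symm
  have e := Torsor.extHom_eq_iff B.π hγ hβ'
    (fun e x => by simp [conjAction, GroupAction.comap])
  rw [IsIso.inv_comp_eq] at e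
  refine Iff.trans (Eq.congr ?_ rfl) e.symm
  refine (P.cmap_assoc B.π H.leftAction (conjAction H.G₀) H.del
    (fun a g => H.del_leftAction a g) (fun e x => H.del_leftAction (homApp B.π _ e) x) _).trans ?_
  exact congrArg (P.assoc B.π (conjAction H.G₀))
    (Torsor.cmap_mapTorsor s _ _ H.del (fun a g => H.del_leftAction a g) y)

variable {Q : Fibred C} {ν : StrongTrans Q (TORS H.G₀)} (k : Binding H ν) {U : C}
  (q : (B.pullbackGerbe ν).obj ⟨op U⟩) {T : Over U}

/-- This is the compatibility axiom of the binding of `Q`, rephrased so that `cdelH_assoc_eq_iff`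
applies. -/
theorem isAd_cdel (x : Q.obj ⟨op U⟩) (α : AutOver Q x T) :
    (torsorOf ν x).IsAd (H.cdel (torsorOf ν x) (adApp (k.iso x) α)) (homMap ν α.hom) := by
  have h := Torsor.isAd_autToAd (torsorOf ν x) (T := T) (mapAut ν x T α)
  rw [k.compat] at h
  exact h

theorem isAd_compE (α : AutOver (B.pullbackGerbe ν) q T) :
    (torsorOf (B.toTORS ν) q).IsAd (B.compE ν q α) (homMap (B.toTORS ν) α.hom) :=
  Torsor.isAd_autToAd (P := torsorOf (B.toTORS ν) q) (T := T) (mapAut (B.toTORS ν) q T α)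

theorem cdelH_compH (α : AutOver (B.pullbackGerbe ν) q T) :
    B.cdelH _ (B.compH k q α) = B.cπ _ (B.compE ν q α) := by
  refine (B.cdelH_assoc_eq_iff (B.structureMap ν q)
    (isAd_cdel k (B.objX ν q) (mapAut (B.toQ ν) q T α)) (B.isAd_compE q α)).2 ?_
  have h := fibreHom_w ν (extension B.π) (M₁ := q) (M₂ := q) (f₁ := T.hom) (f₂ := T.hom) α.hom
  rw [← homMap_fstTrans, ← homMap_sndTrans] at h
  exact h

theorem compH_mul (α β : AutOver (B.pullbackGerbe ν) q T) :
    B.compH k q (α * β) = B.compH k q α * B.compH k q β := by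
  unfold compH
  rw [map_mul, adApp_mul, Torsor.mapTorsor_mul, Torsor.assoc_mul]

theorem compE_mul (α β : AutOver (B.pullbackGerbe ν) q T) :
    B.compE ν q (α * β) = B.compE ν q α * B.compE ν q β := by
  refine (B.isAd_compE q (α * β)).unique ?_
  exact (congrArg (Torsor.IsAd _ _) (homMap_comp (B.toTORS ν) (M₁ := q) (M₂ := q) (M₃ := q)
    (f₁ := T.hom) (f₂ := T.hom) (f₃ := T.hom) β.hom α.hom)).mpr
      ((B.isAd_compE q α).mul (B.isAd_compE q β))

theorem compH_resAut {T' : Over U} (l : T' ⟶ T) (α : AutOver (B.pullbackGerbe ν) q T) :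
    B.compH k q (resAut _ q l α) = rs _ l (B.compH k q α) := by
  unfold compH
  rw [mapAut_resAut, adApp_resAut]
  refine (congrArg _ (Torsor.rs_mapTorsor _ _ l _)).trans ?_
  exact Torsor.rs_assoc B.π _ H.leftAction l _

theorem compE_resAut {T' : Over U} (l : T' ⟶ T) (α : AutOver (B.pullbackGerbe ν) q T) :
    B.compE ν q (resAut _ q l α) = rs _ l (B.compE ν q α) := by
  refine (B.isAd_compE q (resAut _ q l α)).unique ?_
  have h := (B.isAd_compE q α).rs l
  have e : homMap (B.toTORS ν) (resAut _ q l α).hom = Torsor.pl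
      (M₁ := torsorOf (B.toTORS ν) q) (M₂ := torsorOf (B.toTORS ν) q)
      (homMap (B.toTORS ν) α.hom) l.left T'.hom T'.hom (Over.w l) (Over.w l) := by
    rw [resAut_hom]
    exact (pullHom_homMap (B.toTORS ν) α.hom l.left T'.hom T'.hom (Over.w l) (Over.w l)).symm
  rw [e]
  exact h

/-- Every map in the chain defining `compH` is injective, a section of `P ∧ E` determines its
endomorphism, and a morphism of triples is determined by its two components. -/
theorem comp_injective {α β : AutOver (B.pullbackGerbe ν) q T}
    (h₁ : B.compH k q α = B.compH k q β) (h₂ : B.compE ν q α = B.compE ν q β) : α = β := by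
  have e₁ : mapAut (B.toQ ν) q T α = mapAut (B.toQ ν) q T β :=
    (adApp_bijective (k.iso _) T).1 ((Torsor.mapTorsor_bijective (B.structureMap ν q) _ T).1
      (Torsor.assoc_injective B.π _ H.leftAction T h₁))
  have e₂ : homMap (B.toTORS ν) α.hom = homMap (B.toTORS ν) β.hom := by
    refine (B.isAd_compE q α).hom_unique ?_
    rw [h₂]
    exact B.isAd_compE q β
  have e₁' : homMap (B.toQ ν) α.hom = homMap (B.toQ ν) β.hom := congrArg Iso.hom e₁
  rw [homMap_fstTrans, homMap_fstTrans] at e₁'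
  rw [homMap_sndTrans, homMap_sndTrans] at e₂
  exact Iso.ext (fibreHom_ext ν (extension B.π) (M₁ := q) (M₂ := q) (f₁ := T.hom) (f₂ := T.hom)
    e₁' e₂)

/-- Each component lifts separately: `y₁` through the bijections defining `compH`, and `y₂` through
`exists_isAd`. The hypothesis says, by `cdelH_assoc_eq_iff`, that the two lifts together form a
morphism of triples. -/
theorem exists_comp (hQ : IsGerbe J Q)
    (y₁ : (torsorOf (B.toTORS ν) q).csec (H.leftAction.comap B.π).toLeftAction T)
    (y₂ : (torsorOf (B.toTORS ν) q).csec (conjAction B.E).toLeftAction T)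
    (h : B.cdelH _ y₁ = B.cπ _ y₂) :
    ∃ α : AutOver (B.pullbackGerbe ν) q T, B.compH k q α = y₁ ∧ B.compE ν q α = y₂ := by
  obtain ⟨y, rfl⟩ := Torsor.assoc_surjective B.π _ H.leftAction T y₁
  obtain ⟨y, rfl⟩ := (Torsor.mapTorsor_bijective (B.structureMap ν q) _ T).2 y
  obtain ⟨φ, rfl⟩ := (adApp_bijective (k.iso (B.objX ν q)) T).2 y
  obtain ⟨γ, hγ⟩ := Torsor.exists_isAd _ y₂
  have hw := (B.cdelH_assoc_eq_iff (B.structureMap ν q) (isAd_cdel k (B.objX ν q) φ) hγ).1 h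
  let m := fibreHomMk ν (extension B.π) (M₁ := q) (M₂ := q) (f₁ := T.hom) (f₂ := T.hom)
    φ.hom γ hw
  -- The endomorphism is invertible because the fibres of the fibre product are groupoids.
  have := (B.isGerbe_pullbackGerbe ν hQ).isGroupoid T.left
  have : IsIso m := IsGroupoid.all_isIso m
  refine ⟨asIso m, ?_, ?_⟩
  · have e : mapAut (B.toQ ν) q T (asIso m) = φ :=
      Iso.ext ((mapAut_hom _ _ _ _).trans (homMap_fstTrans ν (extension B.π) (M₁ := q) (M₂ := q) m))
    unfold compH
    rw [e]
  · refine (B.isAd_compE q (asIso m)).unique ?_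
    have e : homMap (B.toTORS ν) (M₁ := q) (M₂ := q) m = γ :=
      homMap_sndTrans ν (extension B.π) (M₁ := q) (M₂ := q) m
    refine Eq.mp ?_ hγ
    exact congrArg (Torsor.IsAd _ y₂) e.symm

/-- The section of `P ∧ᴱ (H₁ ×_{H₀} E)` attached to an automorphism of `(x, f, P)`. -/
noncomputable def comp (α : AutOver (B.pullbackGerbe ν) q T) :
    (torsorOf (B.toTORS ν) q).csec B.actionK.toLeftAction T :=
  (B.exists_cpr _ _ _ (B.cdelH_compH k q α)).choose

theorem cprH_comp (α : AutOver (B.pullbackGerbe ν) q T) :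
    B.cprH _ (B.comp k q α) = B.compH k q α :=
  (B.exists_cpr _ _ _ (B.cdelH_compH k q α)).choose_spec.1

theorem cprE_comp (α : AutOver (B.pullbackGerbe ν) q T) :
    B.cprE _ (B.comp k q α) = B.compE ν q α :=
  (B.exists_cpr _ _ _ (B.cdelH_compH k q α)).choose_spec.2

theorem cprH_mul (P : Torsor B.E U) (z w : P.csec B.actionK.toLeftAction T) :
    B.cprH P (z * w) = B.cprH P z * B.cprH P w :=
  P.cmap_mul B.actionK (H.leftAction.comap B.π) B.prH (fun _ _ => rfl) z w

theorem cprE_mul (P : Torsor B.E U) (z w : P.csec B.actionK.toLeftAction T) :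
    B.cprE P (z * w) = B.cprE P z * B.cprE P w :=
  P.cmap_mul B.actionK (conjAction B.E) B.prE (fun _ _ => rfl) z w

theorem rs_cprH (P : Torsor B.E U) {T' : Over U} (l : T' ⟶ T)
    (z : P.csec B.actionK.toLeftAction T) : B.cprH P (rs _ l z) = rs _ l (B.cprH P z) :=
  P.rs_cmap _ _ B.prH (fun _ _ => rfl) l z

theorem rs_cprE (P : Torsor B.E U) {T' : Over U} (l : T' ⟶ T)
    (z : P.csec B.actionK.toLeftAction T) : B.cprE P (rs _ l z) = rs _ l (B.cprE P z) :=
  P.rs_cmap _ _ B.prE (fun _ _ => rfl) l z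

theorem comp_mul (α β : AutOver (B.pullbackGerbe ν) q T) :
    B.comp k q (α * β) = B.comp k q α * B.comp k q β := by
  refine B.ext_cpr _ ?_ ?_
  · rw [cprH_mul, cprH_comp, cprH_comp, cprH_comp, compH_mul]
  · rw [cprE_mul, cprE_comp, cprE_comp, cprE_comp, compE_mul]

theorem comp_resAut {T' : Over U} (l : T' ⟶ T) (α : AutOver (B.pullbackGerbe ν) q T) :
    B.comp k q (resAut _ q l α) = rs _ l (B.comp k q α) := by
  refine B.ext_cpr _ ?_ ?_
  · rw [rs_cprH, cprH_comp, cprH_comp, compH_resAut]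
  · rw [rs_cprE, cprE_comp, cprE_comp, compE_resAut]

theorem comp_bijective (hQ : IsGerbe J Q) : Function.Bijective (B.comp k q (T := T)) := by
  refine ⟨fun α β h => B.comp_injective k q ?_ ?_, fun z => ?_⟩
  · rw [← cprH_comp, ← cprH_comp, h]
  · rw [← cprE_comp B k, ← cprE_comp B k, h]
  · obtain ⟨α, h₁, h₂⟩ := B.exists_comp k q hQ _ _ (B.cdelH_cprH _ z)
    refine ⟨α, B.ext_cpr _ ?_ ?_⟩
    · rw [cprH_comp, h₁]
    · rw [cprE_comp, h₂]

/-- The isomorphism `Aut(x, f, P) ≅ P ∧ᴱ (H₁ ×_{H₀} E)`. -/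
noncomputable def autIso (hQ : IsGerbe J Q) :
    autPresheaf (B.pullbackGerbe ν) q ≅ (torsorOf (B.toTORS ν) q).twist B.actionK :=
  isoOfBijective (fun T => MonoidHom.mk' (B.comp k q (T := T)) (B.comp_mul k q))
    (fun l α => B.comp_resAut k q l α) (fun _ => B.comp_bijective k q hQ)

theorem cθ_bijective (P : Torsor B.E U) : Function.Bijective (B.cθ P (T := T)) :=
  P.cmap_bijective _ _ B.θ (fun e x => B.θ_smul e x) B.θ_bijective T

/-- The isomorphism `P ∧ᴱ (H₁ × G₁) ≅ P ∧ᴱ (H₁ ×_{H₀} E)` induced by `θ`. -/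
noncomputable def twistIso (P : Torsor B.E U) :
    P.twist B.crossedModule.leftAction ≅ P.twist B.actionK :=
  isoOfBijective (fun T => MonoidHom.mk' (B.cθ P (T := T))
      (P.cmap_mul B.crossedModule.leftAction B.actionK B.θ (fun e x => B.θ_smul e x)))
    (fun l z => P.rs_cmap _ _ B.θ (fun e x => B.θ_smul e x) l z) (fun _ => B.cθ_bijective P)

/-- The isomorphism `Aut(x, f, P) ≅ P ∧ᴱ (H₁ × G₁)`. -/
noncomputable def autIso' (hQ : IsGerbe J Q) : autPresheaf (B.pullbackGerbe ν) q ≅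
    (torsorOf (B.toTORS ν) q).twist B.crossedModule.leftAction :=
  B.autIso k q hQ ≪≫ (B.twistIso _).symm

theorem cθ_autIso' (hQ : IsGerbe J Q) (α : AutOver (B.pullbackGerbe ν) q T) :
    B.cθ _ (adApp (B.autIso' k q hQ) α) = B.comp k q α :=
  ConcreteCategory.congr_hom ((B.twistIso (torsorOf (B.toTORS ν) q)).inv_hom_id_app (op T))
    (B.comp k q α)

end Butterfly

/-! ### Functoriality of the identifications and the resulting binding. -/

namespace Fibred

open Bicategory Pseudofunctor

variable {F K : Fibred C} {U : C}

theorem comp_homMap_conjAut (μ : StrongTrans F K) {x y : F.obj ⟨op U⟩} (e : x ≅ y) (T : Over U)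
    (α : AutOver F x T) :
    homMap μ α.hom ≫ (K.map T.hom.op.toLoc).toFunctor.map ((μ.app ⟨op U⟩).toFunctor.map e.hom) =
      (K.map T.hom.op.toLoc).toFunctor.map ((μ.app ⟨op U⟩).toFunctor.map e.hom) ≫
        homMap μ (conjAut F e T α).hom := by
  rw [← homMap_map, ← homMap_comp, ← homMap_comp]
  refine congrArg (homMap μ) ?_
  exact (Iso.hom_inv_id_assoc ((F.map T.hom.op.toLoc).toFunctor.mapIso e) _).symm

theorem mapAut_conjAut (μ : StrongTrans F K) {x y : F.obj ⟨op U⟩} (e : x ≅ y) (T : Over U)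
    (α : AutOver F x T) :
    mapAut μ y T (conjAut F e T α) =
      conjAut K ((μ.app ⟨op U⟩).toFunctor.mapIso e) T (mapAut μ x T α) := by
  refine Iso.ext ?_
  refine (cancel_epi ((K.map T.hom.op.toLoc).toFunctor.map
    ((μ.app ⟨op U⟩).toFunctor.map e.hom))).1 ?_
  refine (comp_homMap_conjAut μ e T α).symm.trans ?_
  exact (Iso.hom_inv_id_assoc ((K.map T.hom.op.toLoc).toFunctor.mapIso
    ((μ.app ⟨op U⟩).toFunctor.mapIso e)) _).symm

end Fibred

namespace Butterfly

open Bicategory Pseudofunctor Fibred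

variable {H G : CrossedModule J} (B : Butterfly H G)
variable {Q : Fibred C} {ν : StrongTrans Q (TORS H.G₀)} (k : Binding H ν) {U : C}

section Natural

variable {q q' : (B.pullbackGerbe ν).obj ⟨op U⟩} (e : q ≅ q') {T : Over U}
  (α : AutOver (B.pullbackGerbe ν) q T)

theorem torsorMap_structureMap :
    torsorMap ν (((B.toQ ν).app ⟨op U⟩).toFunctor.map e.hom) ≫ B.structureMap ν q' =
      B.structureMap ν q ≫ Torsor.extendMap B.π (torsorMap (B.toTORS ν) e.hom) :=
  Limits.CategoricalPullback.Hom.w e.hom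

/-- The binding of `Q` is natural, and the first component of `e` commutes with the structure maps
up to `π_*` of the second; associativity carries the latter over to `P ∧ H₁`. -/
theorem compH_conjAut : B.compH k q' (conjAut _ e T α) =
    Torsor.mapTorsor (torsorMap (B.toTORS ν) e.hom) _ (B.compH k q α) := by
  unfold compH
  rw [mapAut_conjAut, k.natural]
  refine Eq.trans ?_ (Torsor.assoc_mapTorsor B.π H.leftAction (torsorMap (B.toTORS ν) e.hom) _)
  refine congrArg _ ?_
  refine (Torsor.mapTorsor_comp _ _ _ _).symm.trans
    (Eq.trans ?_ (Torsor.mapTorsor_comp _ _ _ _))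
  exact congrArg (fun φ => Torsor.mapTorsor φ H.leftAction.toLeftAction _)
    (B.torsorMap_structureMap e)

theorem compE_conjAut : B.compE ν q' (conjAut _ e T α) =
    Torsor.mapTorsor (torsorMap (B.toTORS ν) e.hom) _ (B.compE ν q α) :=
  (B.isAd_compE q' (conjAut _ e T α)).unique
    ((B.isAd_compE q α).mapTorsor (torsorMap (B.toTORS ν) e.hom)
      (comp_homMap_conjAut (B.toTORS ν) e T α))

theorem cprH_mapTorsor {P P' : Torsor B.E U} (φ : P ⟶ P')
    (z : P.csec B.actionK.toLeftAction T) :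
    B.cprH P' (Torsor.mapTorsor φ _ z) = Torsor.mapTorsor φ _ (B.cprH P z) :=
  Torsor.cmap_mapTorsor φ _ _ B.prH (fun _ _ => rfl) z

theorem cprE_mapTorsor {P P' : Torsor B.E U} (φ : P ⟶ P')
    (z : P.csec B.actionK.toLeftAction T) :
    B.cprE P' (Torsor.mapTorsor φ _ z) = Torsor.mapTorsor φ _ (B.cprE P z) :=
  Torsor.cmap_mapTorsor φ _ _ B.prE (fun _ _ => rfl) z

theorem cθ_mapTorsor {P P' : Torsor B.E U} (φ : P ⟶ P')
    (z : P.csec B.crossedModule.leftAction.toLeftAction T) :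
    B.cθ P' (Torsor.mapTorsor φ _ z) = Torsor.mapTorsor φ _ (B.cθ P z) :=
  Torsor.cmap_mapTorsor φ _ _ B.θ (fun e x => B.θ_smul e x) z

theorem comp_conjAut : B.comp k q' (conjAut _ e T α) =
    Torsor.mapTorsor (torsorMap (B.toTORS ν) e.hom) _ (B.comp k q α) := by
  refine B.ext_cpr _ ?_ ?_
  · rw [cprH_mapTorsor, cprH_comp, cprH_comp, compH_conjAut]
  · rw [cprE_mapTorsor, cprE_comp, cprE_comp, compE_conjAut]

end Natural

section BaseChange

variable {V : C} (f : V ⟶ U) (q : (B.pullbackGerbe ν).obj ⟨op U⟩) {T : Over V}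
  (α : AutOver (B.pullbackGerbe ν) q ((Over.map f).obj T))

theorem mapAut_toQ_baseChangeAut :
    mapAut (B.toQ ν) (((B.pullbackGerbe ν).map f.op.toLoc).toFunctor.obj q) T
        (baseChangeAut _ f q T α) =
      baseChangeAut Q f (B.objX ν q) T (mapAut (B.toQ ν) q ((Over.map f).obj T) α) := by
  refine Iso.ext ?_
  refine (homMap_fstTrans ν (extension B.π)
    (M₁ := ((B.pullbackGerbe ν).map f.op.toLoc).toFunctor.obj q)
    (M₂ := ((B.pullbackGerbe ν).map f.op.toLoc).toFunctor.obj q) (f₁ := T.hom) (f₂ := T.hom)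
    (baseChangeAut _ f q T α).hom).trans ?_
  refine congrArg (fun φ => at2 (Q.mapComp f.op.toLoc T.hom.op.toLoc).inv (B.objX ν q) ≫ φ ≫
    at2 (Q.mapComp f.op.toLoc T.hom.op.toLoc).hom (B.objX ν q)) ?_
  exact (homMap_fstTrans ν (extension B.π) (M₁ := q) (M₂ := q) α.hom).symm

theorem homMap_toTORS_baseChangeAut :
    homMap (B.toTORS ν) (M₁ := ((B.pullbackGerbe ν).map f.op.toLoc).toFunctor.obj q)
        (M₂ := ((B.pullbackGerbe ν).map f.op.toLoc).toFunctor.obj q) (f₁ := T.hom) (f₂ := T.hom)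
        (baseChangeAut _ f q T α).hom =
      ((torsorOf (B.toTORS ν) q).pullbackComp T.hom f).inv ≫
        homMap (B.toTORS ν) (M₁ := q) (M₂ := q) α.hom ≫
          ((torsorOf (B.toTORS ν) q).pullbackComp T.hom f).hom := by
  refine (homMap_sndTrans ν (extension B.π)
    (M₁ := ((B.pullbackGerbe ν).map f.op.toLoc).toFunctor.obj q)
    (M₂ := ((B.pullbackGerbe ν).map f.op.toLoc).toFunctor.obj q) (f₁ := T.hom) (f₂ := T.hom)
    (baseChangeAut _ f q T α).hom).trans ?_
  refine congrArg (fun φ => ((torsorOf (B.toTORS ν) q).pullbackComp T.hom f).inv ≫ φ ≫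
    ((torsorOf (B.toTORS ν) q).pullbackComp T.hom f).hom) ?_
  exact (homMap_sndTrans ν (extension B.π) (M₁ := q) (M₂ := q) α.hom).symm

/-- The structure map of a pulled-back triple begins with the naturality isomorphism of `ν`, which
cancels, and ends with the comparison between `π_*` and pullback. -/
theorem torsorPullback_structureMap :
    torsorPullback ν f (B.objX ν q) ≫
        B.structureMap ν (((B.pullbackGerbe ν).map f.op.toLoc).toFunctor.obj q) =
      Torsor.pullbackMap (B.structureMap ν q) f ≫
        (torsorOf (B.toTORS ν) q).extendPullback B.π f :=
  Iso.inv_hom_id_assoc (iso2 (ν.naturality f.op.toLoc) (B.objX ν q)) _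

/-- Base change passes through the three maps of the chain one at a time: the binding of `Q`, the
structure map by `torsorPullback_structureMap`, and the associativity isomorphism by
`assoc_baseChange`. -/
theorem compH_baseChangeAut :
    B.compH k (((B.pullbackGerbe ν).map f.op.toLoc).toFunctor.obj q) (baseChangeAut _ f q T α) =
      (torsorOf (B.toTORS ν) q).baseChange _ f (B.compH k q (T := (Over.map f).obj T) α) := by
  unfold compH
  rw [mapAut_toQ_baseChangeAut]
  refine Eq.trans ?_ (Torsor.assoc_baseChange B.π (torsorOf (B.toTORS ν) q) H.leftAction f _)
  refine congrArg _ ?_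
  refine (congrArg (Torsor.mapTorsor (B.structureMap ν
    (((B.pullbackGerbe ν).map f.op.toLoc).toFunctor.obj q)) H.leftAction.toLeftAction)
      (k.baseChange f (B.objX ν q) T _)).trans ?_
  refine (Torsor.mapTorsor_comp _ _ _ _).symm.trans ?_
  refine (congrArg (fun φ => Torsor.mapTorsor φ H.leftAction.toLeftAction _)
    (B.torsorPullback_structureMap f q)).trans ?_
  refine (Torsor.mapTorsor_comp _ _ _ _).trans (congrArg _ ?_)
  exact Torsor.mapTorsor_pullbackMap_baseChange (B.structureMap ν q) _ f _

theorem compE_baseChangeAut :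
    B.compE ν (((B.pullbackGerbe ν).map f.op.toLoc).toFunctor.obj q) (baseChangeAut _ f q T α) =
      (torsorOf (B.toTORS ν) q).baseChange _ f (B.compE ν q (T := (Over.map f).obj T) α) := by
  refine (B.isAd_compE _ (baseChangeAut _ f q T α)).unique ?_
  refine (congrArg (Torsor.IsAd _ _) (B.homMap_toTORS_baseChangeAut f q α)).mpr ?_
  exact (B.isAd_compE q (T := (Over.map f).obj T) α).baseChange f

theorem cprH_baseChange (P : Torsor B.E U)
    (z : P.csec B.actionK.toLeftAction ((Over.map f).obj T)) :
    B.cprH (P.pullback f) (P.baseChange _ f z) = P.baseChange _ f (B.cprH P z) :=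
  P.cmap_baseChange _ _ B.prH (fun _ _ => rfl) f z

theorem cprE_baseChange (P : Torsor B.E U)
    (z : P.csec B.actionK.toLeftAction ((Over.map f).obj T)) :
    B.cprE (P.pullback f) (P.baseChange _ f z) = P.baseChange _ f (B.cprE P z) :=
  P.cmap_baseChange _ _ B.prE (fun _ _ => rfl) f z

theorem cθ_baseChange (P : Torsor B.E U)
    (z : P.csec B.crossedModule.leftAction.toLeftAction ((Over.map f).obj T)) :
    B.cθ (P.pullback f) (P.baseChange _ f z) = P.baseChange _ f (B.cθ P z) :=
  P.cmap_baseChange _ _ B.θ (fun e x => B.θ_smul e x) f z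

theorem comp_baseChangeAut :
    B.comp k (((B.pullbackGerbe ν).map f.op.toLoc).toFunctor.obj q) (baseChangeAut _ f q T α) =
      (torsorOf (B.toTORS ν) q).baseChange _ f (B.comp k q (T := (Over.map f).obj T) α) := by
  refine B.ext_cpr _ ?_ ?_
  · refine (B.cprH_comp k _ _).trans ((B.compH_baseChangeAut k f q α).trans ?_)
    refine Eq.trans ?_ (B.cprH_baseChange f (torsorOf (B.toTORS ν) q) _).symm
    rw [cprH_comp]
  · refine (B.cprE_comp k _ _).trans ((B.compE_baseChangeAut f q α).trans ?_)
    refine Eq.trans ?_ (B.cprE_baseChange f (torsorOf (B.toTORS ν) q) _).symm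
    rw [cprE_comp]

end BaseChange

/-- The second component of `θ` is the boundary of `E_•`; this is what makes the new binding
compatible with the projection to torsors. -/
theorem cprE_cθ (P : Torsor B.E U) {T : Over U}
    (z : P.csec B.crossedModule.leftAction.toLeftAction T) :
    B.cprE P (B.cθ P z) = B.crossedModule.cdel P z := by
  refine P.cd_ext _ fun {W} t {b} h p => ?_
  refine (P.cd_cmap _ _ B.prE (fun _ _ => rfl) _ t h p).trans ?_
  refine (congrArg _ (P.cd_cmap _ _ B.θ (fun e x => B.θ_smul e x) z t h p)).trans ?_
  exact (P.cd_cmap _ _ B.delE (fun e x => B.crossedModule.del_leftAction e x) z t h p).symm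

/-- The binding of `Q' = Q ×_{TORS(H₀)} TORS(E)` by the crossed module `E_•`. -/
noncomputable def pullbackBinding (hQ : IsGerbe J Q) :
    Binding B.crossedModule (B.toTORS ν) where
  iso q := B.autIso' k q hQ
  natural {U q q'} e T α := by
    -- Since `id ∧ θ` is injective and natural, it suffices to compare sections of `P ∧ (H₁ ×_{H₀}
    -- E)`, where both components are known.
    refine (B.cθ_bijective _).1 ?_
    refine (B.cθ_autIso' k q' hQ _).trans ((B.comp_conjAut k e α).trans ?_)
    refine Eq.trans ?_ (B.cθ_mapTorsor (torsorMap (B.toTORS ν) e.hom) _).symm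
    exact congrArg _ (B.cθ_autIso' k q hQ α).symm
  baseChange {U V} f q T α := by
    -- The projection to torsors commutes strictly with pullback, so the comparison required by the
    -- axiom is an identity.
    refine Eq.trans ?_ (Torsor.mapTorsor_id ((torsorOf (B.toTORS ν) q).pullback f) _ _).symm
    refine (B.cθ_bijective ((torsorOf (B.toTORS ν) q).pullback f)).1 ?_
    refine (B.cθ_autIso' k _ hQ _).trans ((B.comp_baseChangeAut k f q α).trans ?_)
    refine Eq.trans ?_ (B.cθ_baseChange f (torsorOf (B.toTORS ν) q) _).symm
    exact congrArg _ (B.cθ_autIso' k q hQ α).symm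
  compat q T α := by
    -- The left-hand side is by definition the second component of the automorphism, which `id ∧ θ`
    -- followed by the projection recovers.
    refine (B.cprE_comp k q α).symm.trans ?_
    rw [← B.cθ_autIso' k q hQ α]
    exact B.cprE_cθ _ _

end Butterfly

end ButterflyGerbe

theorem lemma6 {C : Type u} [Category.{v} C] (J : GrothendieckTopology C)
    {H G : CrossedModule J} (B : Butterfly H G)
    (Q : Fibred C) (hQ : IsGerbe J Q)
    (ν : Pseudofunctor.StrongTrans Q (TORS H.G₀)) (k : Binding H ν) :
    IsGerbe J (B.pullbackGerbe ν) ∧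
    IsIso B.θ ∧
    (∀ (U : C) (P : Torsor B.E U) (T : Over U),
      Function.Injective (fun z : P.csec B.actionK.toLeftAction T => (B.cprH P z, B.cprE P z)) ∧
      Set.range (fun z : P.csec B.actionK.toLeftAction T => (B.cprH P z, B.cprE P z)) =
        {y | B.cdelH P y.1 = B.cπ P y.2} ∧
      Function.Bijective (fun z : P.csec B.crossedModule.leftAction.toLeftAction T =>
        (B.cfst P z, B.csnd P z))) ∧
    ∃ (k' : Binding B.crossedModule (B.toTORS ν))
      (k'' : ∀ {U : C} (q : (B.pullbackGerbe ν).obj ⟨op U⟩),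
        autPresheaf (B.pullbackGerbe ν) q ≅ (torsorOf (B.toTORS ν) q).twist B.actionK),
      ∀ {U : C} (q : (B.pullbackGerbe ν).obj ⟨op U⟩) (T : Over U)
        (α : AutOver (B.pullbackGerbe ν) q T),
        B.cprH _ (adApp (k'' q) α) = B.compH k q α ∧
        B.cprE _ (adApp (k'' q) α) = B.compE ν q α ∧
        B.cθ _ (adApp (k'.iso q) α) = adApp (k'' q) α := by
  refine ⟨B.isGerbe_pullbackGerbe ν hQ, B.isIso_θ, fun U P T => ⟨fun z z' h => ?_,
    B.range_cpr P, B.bijective_cfst_csnd P⟩, B.pullbackBinding k hQ,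
    fun q => B.autIso k q hQ, fun q T α => ⟨B.cprH_comp k q α, B.cprE_comp k q α,
      B.cθ_autIso' k q hQ α⟩⟩
  exact B.ext_cpr P (congrArg Prod.fst h) (congrArg Prod.snd h)
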